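/- Let $T=S^1\times S^1$ be a torus and let $N(T)=T\times[-1,1]$, with the product orientation and with the vertical (upward) flow, whose orbit segments in $N(T)$ are the segments $\{x\}\times[-1,1]$. Let $b=S^1\times\{1\}\subset T$, and let $\beta$ be a closed $2$-strand braid along $b$ in $N(T)$ with a single crossing, which is negative. That is, $\beta$ is an embedded closed curve in the interior of $N(T)$, lying over the annulus neighbourhood $\{(u,e^{iv}) : |v|<\pi\}$ of $b$, of the form $$\beta(s)=\bigl(s^2,\;e^{i\,\mathrm{Re}\,c(s)},\;\mathrm{Im}\,c(s)\bigr),\qquad s\in S^1,$$ for a continuous $c:S^1\to\mathbb{C}$; its projection to $T$ crosses itself exactly once, and the crossing, seen looking down on $T$ against the flow, is a negative crossing. Let $N(T)_1(\beta)$ be the result of Dehn surgery on $N(T)$ along $\beta$ with coefficient $1$, with respect to the longitude of $\beta$ obtained by pushing $\beta$ along the flow: the interior of a tubular neighbourhood of $\beta$ (the discs of a small radius $r$ about the points of $\beta$ in the slices where the first coordinate is constant) is removed, and a solid torus $D^2\times S^1$ is glued in, its meridian being attached along meridian $+$ longitude. Let $(\mathbb{RP}^2\setminus\text{two discs})\,\widetilde\times\,S^1$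 be the circle bundle over $\mathbb{RP}^2$ minus two open discs whose total space is orientable, i.e. the quotient of $(S^2\setminus\text{four open discs})\times S^1$ by $(x,z)\sim(-x,z^{-1})$, where the four discs form two antipodal pairs and have disjoint closures. Then there is a homeomorphism $N(T)_1(\beta)\cong(\mathbb{RP}^2\setminus\text{two discs})\,\widetilde\times\,S^1$ that maps the orbit segment from $\beta$ to itself within $N(T)$ to a circle fibre. Here the orbit segment is the vertical segment between the two strands at the crossing; in $N(T)_1(\beta)$, the part of it outside the tubular neighbourhood is closed up by the diameter, joining its endpoints, of a meridian disc of the glued-in solid torus. -/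

import Mathlib

/-! ### Dehn surgery on a knot with a parametrised tubular neighbourhood -/

/-- The solid torus `D² × S¹`. -/
abbrev SolidTorus : Type := Metric.closedBall (0 : ℂ) 1 × Circle

/-- The exterior in `N` of the tube `ν` : the points of `N` outside the open tube
`ν (int D² × S¹)`. -/
def tubeExterior {X : Type*} (N : Set X) (ν : ℂ × Circle → X) : Set X :=
  N \ ν '' {p | ‖p.1‖ < 1}

/-- The gluing relation of Dehn surgery with coefficient `1 / n`. The boundary torus of the
exterior is parametrised by `ν` on `∂D² × S¹`, with meridian `μ = ν (∂D² × {1})` and longitude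
`ν ({1} × S¹)`. The boundary point `(z, w)` of the new solid torus is glued to `ν (z, zⁿ w)`, so
that the new meridians `∂D² × {w}` are attached along curves of class `μ + n • longitude`. -/
inductive SurgeryRel {X : Type*} (N : Set X) (ν : ℂ × Circle → X) (n : ℤ) :
    tubeExterior N ν ⊕ SolidTorus → tubeExterior N ν ⊕ SolidTorus → Prop
  | glue (e : tubeExterior N ν) (y : SolidTorus) (z : Circle) (hz : (y.1 : ℂ) = z)
      (he : (e : X) = ν (z, z ^ n * y.2)) : SurgeryRel N ν n (Sum.inl e) (Sum.inr y)

/-- The result of Dehn surgery on `N` with coefficient `1 / n` along the core `ν ({0} × S¹)` of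
the tube `ν`, the longitude being the one given by `ν`. It has the quotient topology. -/
def DehnSurgery {X : Type*} (N : Set X) (ν : ℂ × Circle → X) (n : ℤ) : Type _ :=
  Quot (SurgeryRel N ν n)

instance {X : Type*} [TopologicalSpace X] (N : Set X) (ν : ℂ × Circle → X) (n : ℤ) :
    TopologicalSpace (DehnSurgery N ν n) :=
  inferInstanceAs (TopologicalSpace (Quot (SurgeryRel N ν n)))

/-! ### The thickened torus and the braid -/

/-- The neighbourhood `N(T) = T × [-1, 1]` of the torus `T = S¹ × S¹`, as a subset of `T × ℝ`.
The flow is vertical, upwards: its orbit segments in `N(T)` are the sets `{x} × [-1, 1]`. The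
orientation is the product one: (direction of the first circle, direction of the second circle,
flow direction) is positive. -/
def thickTorus : Set ((Circle × Circle) × ℝ) := {p | p.2 ∈ Set.Icc (-1) 1}

/-- A function `c : S¹ → ℂ` describes a closed `2`-strand braid with a single crossing, which is
negative, in the annulus neighbourhood `{(u, exp (i v)) | |v| < π}` of the curve `b = S¹ × {1}` of
`T`. The braid is the closed curve `s ↦ ((s², exp (i · re (c s))), im (c s))`, which goes round `b`
twice: its two strands over `u = s²` are at the positions `c s` and `c (-s)`, the real part being
the coordinate in the annulus across `b`, the imaginary part the height.
The projections of the strands to `T` cross exactly once, over `u = s₀²`. There the strand through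
`c s₀` is the over-strand, and with respect to the direction of the braid (in which `u` turns
counterclockwise) it passes from the right of the under-strand (smaller real part) to its left
(greater real part): looking down on `T`, against the flow, this is a negative crossing. -/
structure IsNegativeTwoBraid (c : Circle → ℂ) (s₀ : Circle) : Prop where
  continuous : Continuous c
  abs_re_lt (s : Circle) : |(c s).re| < Real.pi
  abs_im_lt (s : Circle) : |(c s).im| < 1
  re_crossing : (c s₀).re = (c (-s₀)).re
  im_crossing : (c (-s₀)).im < (c s₀).im
  re_lt (t : ℝ) (ht₀ : 0 < t) (ht : t < Real.pi) :
    (c (-(s₀ * Circle.exp t))).re < (c (s₀ * Circle.exp t)).re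

/-- The point of `T × ℝ` over `u` in the first circle, at the position `a` : the real part of `a`
is the angle in the second circle, the imaginary part is the height. -/
noncomputable def slicePoint (u : Circle) (a : ℂ) : (Circle × Circle) × ℝ :=
  ((u, Circle.exp a.re), a.im)

/-- The closed curve `β` described by `c`. -/
noncomputable def braidCurve (c : Circle → ℂ) (s : Circle) : (Circle × Circle) × ℝ :=
  slicePoint (s ^ 2) (c s)

/-- The round tube of radius `r` about `β`, made of the discs of radius `r` about the points of `β`
in the slices `u = const`. It is compatible with the orientation, and its longitudes are the
longitude of `β` given by the flow: `{I} × S¹` goes to `β` pushed in the flow direction. -/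
noncomputable def braidTube (c : Circle → ℂ) (r : ℝ) (p : ℂ × Circle) : (Circle × Circle) × ℝ :=
  slicePoint (p.2 ^ 2) (c p.2 + r * p.1)

/-- The radius `r` is so small that the closed tube of radius `r` about `β` is embedded in the
interior of `N(T)`, over the annulus neighbourhood of `b`. -/
structure IsTubeRadius (c : Circle → ℂ) (r : ℝ) : Prop where
  pos : 0 < r
  disjoint (s : Circle) : 2 * r < ‖c s - c (-s)‖
  re_add_lt (s : Circle) : |(c s).re| + r < Real.pi
  im_add_lt (s : Circle) : |(c s).im| + r < 1

/-- The orbit segment from `β` to itself in `N(T)`: it goes up from the under-strand to the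
over-strand at the crossing. -/
noncomputable def orbitSegment (c : Circle → ℂ) (s₀ : Circle) : Set ((Circle × Circle) × ℝ) :=
  {(braidCurve c s₀).1} ×ˢ Set.Icc (braidCurve c (-s₀)).2 (braidCurve c s₀).2

/-- The closed curve in the surgered manifold `N(T)₁(β)` that comes from the orbit segment from `β`
to itself. The part of the orbit segment in the exterior of the tube ends at the points
`(I, -s₀)` and `(-I, s₀)` of the boundary torus `∂D² × S¹` of the exterior. These are the points
`(I, I * s₀)` and `(-I, I * s₀)` of the boundary of the new solid torus; the curve is closed up by
the diameter of the meridian disc `D² × {I * s₀}` between them. -/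
def closedOrbitSegment (c : Circle → ℂ) (s₀ : Circle) (r : ℝ) :
    Set (DehnSurgery thickTorus (braidTube c r) 1) :=
  Quot.mk (SurgeryRel thickTorus (braidTube c r) 1) ''
    (Sum.inl '' {e | (e : (Circle × Circle) × ℝ) ∈ orbitSegment c s₀} ∪
      Sum.inr '' {y | (y.1 : ℂ).re = 0 ∧ (y.2 : ℂ) = Complex.I * s₀})

/-! ### The orientable circle bundle over the projective plane minus two discs -/

/-- The unit sphere in `ℝ³` minus two antipodal pairs of disjoint open round discs, centred at
`± e₀` and `± e₁`. -/
def SphereMinusFourDiscs : Type :=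
  {x : EuclideanSpace ℝ (Fin 3) // ‖x‖ = 1 ∧ |x 0| ≤ 4 / 5 ∧ |x 1| ≤ 4 / 5}

instance : TopologicalSpace SphereMinusFourDiscs :=
  inferInstanceAs (TopologicalSpace
    {x : EuclideanSpace ℝ (Fin 3) // ‖x‖ = 1 ∧ |x 0| ≤ 4 / 5 ∧ |x 1| ≤ 4 / 5})

/-- The antipodal map. -/
def antipode (x : SphereMinusFourDiscs) : SphereMinusFourDiscs :=
  ⟨-x.1, by simpa using x.2⟩

/-- `ℝP²` minus two open discs, as the quotient of the sphere minus four discs by the antipodal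
map. -/
def RP2MinusTwoDiscs : Type :=
  Quot fun x y : SphereMinusFourDiscs => y = antipode x

instance : TopologicalSpace RP2MinusTwoDiscs :=
  inferInstanceAs (TopologicalSpace (Quot fun x y : SphereMinusFourDiscs => y = antipode x))

/-- The circle bundle with orientable total space over `ℝP²` minus two discs: the quotient of
`(sphere minus four discs) × S¹` by the orientation-preserving free involution
`(x, z) ↦ (-x, z⁻¹)`. -/
def OrientableCircleBundle : Type :=
  Quot fun p q : SphereMinusFourDiscs × Circle => q = (antipode p.1, p.2⁻¹)

instance : TopologicalSpace OrientableCircleBundle :=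
  inferInstanceAs (TopologicalSpace
    (Quot fun p q : SphereMinusFourDiscs × Circle => q = (antipode p.1, p.2⁻¹)))

/-- The bundle projection. -/
def bundleProj : OrientableCircleBundle → RP2MinusTwoDiscs :=
  Quot.map Prod.fst fun _ _ h => congrArg Prod.fst h

/-!
In the slice of the thickened torus over `u = s²` the strands are at `c s` and `c (-s)`. As the
braid has a single crossing, which is negative, the vector `gap` between them is nowhere opposite
to the vector `frame = i s₀ s⁻¹` (`gap_div_frame_mem_slitPlane`), so that the angle between `gap`
and `frame` is a continuous function of `s`. Rotating it away straightens the braid: `position`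
provides a coordinate `q` in every slice for which the strands are at `±1` and the tubes are the
discs of radius `1 / 2`, with `(q, s)` and `(-q, -s)` describing the same point.

The circle fibration of the exterior is written down in elliptic coordinates. Slit the slices along
`[-1, 1]` and let `J`, outside the unit disc, be the coordinate with `squash J = q`; near the slit
this is the Joukowski map `q = (J + J⁻¹) / 2`. The coordinate in the base is
`p = collarRadius ‖J‖ * frame s * dir (cosquash J)`, the coordinate in the fibre is `(dir J)⁻²`.
Far from the strands `cosquash J = J`, so that `p` is the position in the slice, up to scale, and
the fibres are transverse to the slices. On the slit, `cosquash J = J - J⁻¹` is imaginary, so that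
`p` determines the slice and the fibre runs along the segment between the strands. The two sides
`J` and `J⁻¹` of the slit have opposite coordinates `p` and inverse fibre coordinates. This is the
identification `(x, z) ∼ (-x, z⁻¹)` on the boundary of a hemisphere: `ℝP²` minus two discs is a
rectangle with its vertical sides identified, minus a disc, with opposite points on the boundary
of that disc identified (`hemisphere`, `modelMap_eq_iff`).

The fibres close up in the new solid torus. There `J = W²`, and the coordinates are `(W - W⁻¹) σ⁻¹`
in the meridian disc and `i s₀ σ²` along the torus. As `squash (W²) = 1 + (W - W⁻¹)² / 2`, the
boundary of the solid torus is the boundary of the tube, and the formulas for `p` match exactly for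
the gluing with coefficient `1` (`slicePosition_eq_tube_iff`, `exteriorPoint_eq_torusPoint_iff`).

The surgered manifold and the circle bundle are thus quotients of the same compact space of
parameters `(J, s)` and `(σ, W)`, by the same relation, and `exists_homeomorph_of_parametrisation`
applies. At the crossing `gap` and `frame` have the same direction, and the orbit segment is the
slit `[-1, 1]` of that slice. Hence it is part of the fibre over `p = ± holeRadius`, the rest of
which is the diameter of the meridian disc.
-/

open Topology

namespace BraidSurgery

/-! ### A criterion for homeomorphisms out of a surgered manifold -/

/-- Two quotients of the same compact space by the same relation are homeomorphic. -/
theorem exists_homeomorph_of_parametrisation {X K Y : Type*} [TopologicalSpace X]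
    [TopologicalSpace K] [TopologicalSpace Y] [T2Space X] [CompactSpace K] [T2Space Y]
    (N : Set X) (ν : ℂ × Circle → X) (n : ℤ)
    (g : K → tubeExterior N ν ⊕ SolidTorus) (hg : Continuous g) (hgs : Function.Surjective g)
    (f : K → Y) (hf : Continuous f) (hfs : Function.Surjective f)
    (h_eq : ∀ k l, g k = g l → f k = f l)
    (h_rel : ∀ k l, SurgeryRel N ν n (g k) (g l) → f k = f l)
    (h_inj : ∀ k l, f k = f l → Quot.mk (SurgeryRel N ν n) (g k) = Quot.mk _ (g l)) :
    ∃ Φ : DehnSurgery N ν n ≃ₜ Y, ∀ k, Φ (Quot.mk _ (g k)) = f k := by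
  have hq : IsQuotientMap g := IsQuotientMap.of_surjective_continuous hgs hg
  -- `f` factors through the quotient map `g`.
  let f₀ : tubeExterior N ν ⊕ SolidTorus → Y := fun x => f (hgs x).choose
  have hf₀ : ∀ k, f₀ (g k) = f k := fun k => h_eq _ _ (hgs (g k)).choose_spec
  have hf₀c : Continuous f₀ := by
    rw [hq.continuous_iff]
    have : f₀ ∘ g = f := funext hf₀
    rwa [this]
  let F : DehnSurgery N ν n → Y := Quot.lift f₀ (by
    intro a b hab
    obtain ⟨k, rfl⟩ := hgs a
    obtain ⟨l, rfl⟩ := hgs b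
    rw [hf₀, hf₀]
    exact h_rel k l hab)
  have hFc : Continuous F := continuous_quot_lift _ hf₀c
  have hFg : ∀ k, F (Quot.mk _ (g k)) = f k := hf₀
  have hFb : Function.Bijective F := by
    constructor
    · intro a b hab
      obtain ⟨a, rfl⟩ := Quot.exists_rep a
      obtain ⟨b, rfl⟩ := Quot.exists_rep b
      obtain ⟨k, rfl⟩ := hgs a
      obtain ⟨l, rfl⟩ := hgs b
      rw [hFg, hFg] at hab
      exact h_inj k l hab
    · intro y
      obtain ⟨k, rfl⟩ := hfs y
      exact ⟨Quot.mk _ (g k), hFg k⟩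
  have : CompactSpace (DehnSurgery N ν n) := by
    have hπ : Function.Surjective (fun k => (Quot.mk _ (g k) : DehnSurgery N ν n)) := by
      intro a
      obtain ⟨a, rfl⟩ := Quot.exists_rep a
      obtain ⟨k, rfl⟩ := hgs a
      exact ⟨k, rfl⟩
    exact hπ.compactSpace (continuous_quot_mk.comp hg)
  exact ⟨Continuous.homeoOfEquivCompactToT2 (f := Equiv.ofBijective F hFb) hFc, hFg⟩

/-! ### The circle bundle as a quotient -/

theorem antipode_antipode (x : SphereMinusFourDiscs) : antipode (antipode x) = x :=
  Subtype.ext (neg_neg _)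

theorem continuous_antipode : Continuous antipode := by
  refine Continuous.subtype_mk ?_ _
  exact continuous_subtype_val.neg

/-- The deck transformation of the double covering of the circle bundle. -/
noncomputable def deck (p : SphereMinusFourDiscs × Circle) : SphereMinusFourDiscs × Circle :=
  (antipode p.1, p.2⁻¹)

theorem deck_deck (p : SphereMinusFourDiscs × Circle) : deck (deck p) = p := by
  simp [deck, antipode_antipode]

theorem continuous_deck : Continuous deck :=
  (continuous_antipode.comp continuous_fst).prodMk continuous_snd.inv

/-- The quotient map onto the circle bundle. -/
def bundleMk (p : SphereMinusFourDiscs × Circle) : OrientableCircleBundle :=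
  Quot.mk _ p

theorem continuous_bundleMk : Continuous bundleMk := continuous_quot_mk

theorem bundleMk_surjective : Function.Surjective bundleMk := Quot.exists_rep

theorem bundleMk_deck (p : SphereMinusFourDiscs × Circle) : bundleMk (deck p) = bundleMk p :=
  (Quot.sound (r := fun p q : SphereMinusFourDiscs × Circle => q = (antipode p.1, p.2⁻¹))
    (a := p) (b := deck p) rfl).symm

theorem bundleMk_eq_iff {p q : SphereMinusFourDiscs × Circle} :
    bundleMk p = bundleMk q ↔ q = p ∨ q = deck p := by
  constructor
  · intro h
    have h' := Quot.eqvGen_exact h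
    clear h
    induction h' with
    | rel x y h => exact Or.inr h
    | refl x => exact Or.inl rfl
    | symm x y _ ih =>
      rcases ih with rfl | rfl
      · exact Or.inl rfl
      · exact Or.inr (deck_deck x).symm
    | trans x y z _ _ ih₁ ih₂ =>
      rcases ih₁ with rfl | rfl <;> rcases ih₂ with rfl | rfl
      · exact Or.inl rfl
      · exact Or.inr rfl
      · exact Or.inr rfl
      · exact Or.inl (deck_deck x)
  · rintro (rfl | rfl)
    · rfl
    · exact (bundleMk_deck p).symm

instance : T2Space SphereMinusFourDiscs :=
  inferInstanceAs (T2Space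
    {x : EuclideanSpace ℝ (Fin 3) // ‖x‖ = 1 ∧ |x 0| ≤ 4 / 5 ∧ |x 1| ≤ 4 / 5})

instance : T2Space OrientableCircleBundle := by
  have hopen : IsOpenMap bundleMk := by
    intro U hU
    have : bundleMk ⁻¹' (bundleMk '' U) = U ∪ deck ⁻¹' U := by
      ext p
      constructor
      · rintro ⟨q, hq, h⟩
        rcases bundleMk_eq_iff.1 h with rfl | rfl
        · exact Or.inl hq
        · right
          simpa [deck_deck] using hq
      · rintro (h | h)
        · exact ⟨p, h, rfl⟩
        · exact ⟨deck p, h, bundleMk_deck p⟩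
    change IsOpen (bundleMk ⁻¹' (bundleMk '' U))
    rw [this]
    exact hU.union (hU.preimage continuous_deck)
  rw [t2Space_iff_of_isOpenQuotientMap ⟨bundleMk_surjective, continuous_bundleMk, hopen⟩]
  have : {q : (SphereMinusFourDiscs × Circle) × (SphereMinusFourDiscs × Circle) |
      bundleMk q.1 = bundleMk q.2} = {q | q.2 = q.1} ∪ {q | q.2 = deck q.1} := by
    ext q
    exact bundleMk_eq_iff
  rw [this]
  exact (isClosed_eq continuous_snd continuous_fst).union
    (isClosed_eq continuous_snd (continuous_deck.comp continuous_fst))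

/-- A fibre of the bundle, described upstairs. -/
theorem mem_bundleProj_fibre_iff (x : SphereMinusFourDiscs) (b : OrientableCircleBundle) :
    b ∈ bundleProj ⁻¹' {(Quot.mk _ x : RP2MinusTwoDiscs)} ↔ ∃ w, b = bundleMk (x, w) := by
  constructor
  · intro h
    obtain ⟨⟨y, w⟩, rfl⟩ := bundleMk_surjective b
    have h' : (Quot.mk _ y : RP2MinusTwoDiscs) = Quot.mk _ x := h
    have key : x = y ∨ x = antipode y := by
      have h'' := Quot.eqvGen_exact h'
      clear h h'
      induction h'' with
      | rel x y h => exact Or.inr h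
      | refl x => exact Or.inl rfl
      | symm x y _ ih =>
        rcases ih with rfl | rfl
        · exact Or.inl rfl
        · exact Or.inr (antipode_antipode x).symm
      | trans x y z _ _ ih₁ ih₂ =>
        rcases ih₁ with rfl | rfl <;> rcases ih₂ with rfl | rfl
        · exact Or.inl rfl
        · exact Or.inr rfl
        · exact Or.inr rfl
        · exact Or.inl (antipode_antipode x)
    rcases key with rfl | rfl
    · exact ⟨w, rfl⟩
    · exact ⟨w⁻¹, (bundleMk_deck (y, w)).symm⟩
  · rintro ⟨w, rfl⟩
    rfl

/-! ### Directions of complex numbers -/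

/-- The direction `x / ‖x‖` of a complex number, with value `1` at `0`. -/
noncomputable def dir (x : ℂ) : Circle := Circle.exp x.arg

theorem norm_mul_dir (x : ℂ) : (‖x‖ : ℂ) * dir x = x := by
  rw [dir, Circle.coe_exp, Complex.norm_mul_exp_arg_mul_I]

theorem coe_dir {x : ℂ} (hx : x ≠ 0) : (dir x : ℂ) = x / ‖x‖ := by
  have : (‖x‖ : ℂ) ≠ 0 := by simpa using hx
  rw [eq_div_iff this, mul_comm, norm_mul_dir]

theorem dir_eq_iff {x : ℂ} (hx : x ≠ 0) {w : Circle} : dir x = w ↔ x = ‖x‖ * w := by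
  constructor
  · rintro rfl
    exact (norm_mul_dir x).symm
  · intro h
    have : (‖x‖ : ℂ) ≠ 0 := by simpa using hx
    refine Circle.ext (mul_left_cancel₀ this ?_)
    rw [norm_mul_dir, ← h]

theorem dir_real_mul {t : ℝ} (ht : 0 < t) (w : Circle) : dir (t * w) = w := by
  have h : (t * w : ℂ) ≠ 0 := mul_ne_zero (by exact_mod_cast ht.ne') w.coe_ne_zero
  rw [dir_eq_iff h]
  simp [abs_of_pos ht, Circle.norm_coe]

theorem dir_coe (w : Circle) : dir w = w := by
  simpa using dir_real_mul one_pos w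

theorem dir_mul {x y : ℂ} (hx : x ≠ 0) (hy : y ≠ 0) : dir (x * y) = dir x * dir y := by
  rw [dir_eq_iff (mul_ne_zero hx hy)]
  nth_rw 1 [← norm_mul_dir x, ← norm_mul_dir y]
  push_cast [norm_mul]
  ring

theorem dir_ofReal {t : ℝ} (ht : 0 < t) : dir t = 1 := by
  simpa using dir_real_mul ht 1

theorem dir_neg {x : ℂ} (hx : x ≠ 0) : dir (-x) = -dir x := by
  rw [dir_eq_iff (neg_ne_zero.2 hx)]
  nth_rw 1 [← norm_mul_dir x]
  simp

theorem dir_circle_mul (w : Circle) {x : ℂ} (hx : x ≠ 0) : dir (w * x) = w * dir x := by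
  rw [dir_mul w.coe_ne_zero hx, dir_coe]

theorem continuousOn_dir : ContinuousOn dir {0}ᶜ := by
  have hind : @IsInducing Circle ℂ _ _ fun w => (w : ℂ) := ⟨rfl⟩
  rw [hind.continuousOn_iff]
  refine ContinuousOn.congr (f := fun x : ℂ => x / ‖x‖) ?_ fun x hx => coe_dir hx
  refine continuousOn_id.div (by fun_prop) ?_
  intro x hx
  simpa using hx

theorem continuous_dir_comp {X : Type*} [TopologicalSpace X] {f : X → ℂ} (hf : Continuous f)
    (h : ∀ x, f x ≠ 0) : Continuous fun x => dir (f x) :=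
  continuousOn_dir.comp_continuous hf h

theorem exists_sq_eq (u : Circle) : ∃ s : Circle, s ^ 2 = u := by
  refine ⟨Circle.exp ((u : ℂ).arg / 2), ?_⟩
  rw [pow_two, ← Circle.exp_add, add_halves, Circle.exp_arg]

theorem sq_eq_sq_iff_circle {s t : Circle} : s ^ 2 = t ^ 2 ↔ s = t ∨ s = -t := by
  rw [← Circle.coe_inj, ← Circle.coe_inj, ← Circle.coe_inj, Circle.coe_neg, Circle.coe_pow,
    Circle.coe_pow]
  exact sq_eq_sq_iff_eq_or_eq_neg

/-! ### Circle valued exponentials on `[-π, π]` -/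

theorem circle_exp_eq_iff {v w : ℝ} (hv : |v| ≤ Real.pi) (hw : |w| ≤ Real.pi) :
    Circle.exp v = Circle.exp w ↔
      v = w ∨ (v = Real.pi ∧ w = -Real.pi) ∨ (v = -Real.pi ∧ w = Real.pi) := by
  rw [abs_le] at hv hw
  have hpi := Real.pi_pos
  constructor
  · intro h
    obtain ⟨m, hm⟩ := Circle.exp_eq_exp.1 h
    have h1 : (m : ℝ) < 2 := by nlinarith
    have h2 : (-2 : ℝ) < m := by nlinarith
    have h1' : m < 2 := by exact_mod_cast h1
    have h2' : -2 < m := by exact_mod_cast h2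
    obtain rfl | rfl | rfl : m = -1 ∨ m = 0 ∨ m = 1 := by omega
    · push_cast at hm
      exact Or.inr (Or.inr ⟨by linarith, by linarith⟩)
    · push_cast at hm
      exact Or.inl (by linarith)
    · push_cast at hm
      exact Or.inr (Or.inl ⟨by linarith, by linarith⟩)
  · rintro (rfl | ⟨rfl, rfl⟩ | ⟨rfl, rfl⟩)
    · rfl
    · exact Circle.exp_eq_exp.2 ⟨1, by push_cast; ring⟩
    · exact Circle.exp_eq_exp.2 ⟨-1, by push_cast; ring⟩

/-! ### The hemisphere minus two discs as a rectangle minus a disc -/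

/-- The radius of the disc that is removed from the rectangle `[-π, π] × [-1, 1]`. It is chosen for
the discs about `e₀` and `e₁` in the sphere to have the right size, see `holeRadius_mul`. -/
noncomputable def holeRadius : ℝ := 5 * √2 / 8

/-- The height of the boundary circles of the spherical band onto which the rectangle, with its
vertical sides identified, is mapped. -/
noncomputable def bandHeight : ℝ := √7 / 5

/-- The Euclidean radius of the boundary circle of the cap about the first axis that corresponds to
the removed disc. -/
noncomputable def capRadius : ℝ := √14 / 8

theorem holeRadius_sq : holeRadius ^ 2 = 25 / 32 := by
  rw [holeRadius, div_pow, mul_pow, Real.sq_sqrt (by norm_num)]; norm_num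

theorem holeRadius_pos : 0 < holeRadius := by unfold holeRadius; positivity

theorem holeRadius_lt_one : holeRadius < 1 := by
  nlinarith [holeRadius_sq, holeRadius_pos]

theorem bandHeight_sq : bandHeight ^ 2 = 7 / 25 := by
  rw [bandHeight, div_pow, Real.sq_sqrt (by norm_num)]; norm_num

theorem bandHeight_pos : 0 < bandHeight := by unfold bandHeight; positivity

theorem capRadius_sq : capRadius ^ 2 = 7 / 32 := by
  rw [capRadius, div_pow, Real.sq_sqrt (by norm_num)]; norm_num

theorem capRadius_pos : 0 < capRadius := by unfold capRadius; positivity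

theorem capRadius_mul_bandHeight : capRadius * bandHeight = 7 * √2 / 40 := by
  have h : √14 * √7 = 7 * √2 := by
    rw [show (14 : ℝ) = 7 * 2 by norm_num, Real.sqrt_mul (by norm_num)]
    linear_combination √2 * Real.mul_self_sqrt (show (0 : ℝ) ≤ 7 by norm_num)
  rw [capRadius, bandHeight]
  linarith

theorem holeRadius_mul : holeRadius * (4 * √2 / 5) = 1 := by
  rw [holeRadius]
  nlinarith [Real.mul_self_sqrt (show (0 : ℝ) ≤ 2 by norm_num)]

theorem capRadius_mul : capRadius * (4 * √2 / 5) = bandHeight := by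
  have h : √14 * √2 = 2 * √7 := by
    rw [show (14 : ℝ) = 7 * 2 by norm_num, Real.sqrt_mul (by norm_num)]
    linear_combination √7 * Real.mul_self_sqrt (show (0 : ℝ) ≤ 2 by norm_num)
  rw [capRadius, bandHeight]
  linarith

/-- The rectangle `[-π, π] × [-1, 1]` minus an open disc. With its vertical sides identified, it
is a pair of pants. -/
def pants : Set ℂ := {p | |p.re| ≤ Real.pi ∧ |p.im| ≤ 1 ∧ holeRadius ≤ ‖p‖}

/-- The two points lie opposite each other on the vertical sides of the rectangle. -/
def Seam (p q : ℂ) : Prop :=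
  p.im = q.im ∧ ((p.re = Real.pi ∧ q.re = -Real.pi) ∨ (p.re = -Real.pi ∧ q.re = Real.pi))

/-- The projection of the real line to `[-1, 1]`. -/
def clamp (v : ℝ) : ℝ := max (-1) (min v 1)

theorem clamp_of_abs_le {v : ℝ} (h : |v| ≤ 1) : clamp v = v := by
  rw [abs_le] at h
  rw [clamp, min_eq_left h.2, max_eq_right h.1]

theorem clamp_of_one_le {v : ℝ} (h : 1 ≤ v) : clamp v = 1 := by
  rw [clamp, min_eq_right h, max_eq_right (by norm_num)]

theorem clamp_of_le {v : ℝ} (h : v ≤ -1) : clamp v = -1 := by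
  rw [clamp, min_eq_left (by linarith), max_eq_left h]

theorem abs_clamp_le (v : ℝ) : |clamp v| ≤ 1 :=
  abs_le.2 ⟨le_max_left _ _, max_le (by norm_num) (min_le_right _ _)⟩

theorem clamp_neg (v : ℝ) : clamp (-v) = -clamp v := by
  rcases le_total v (-1) with h | h
  · rw [clamp_of_le h, clamp_of_one_le (by linarith)]; ring
  · rcases le_total v 1 with h' | h'
    · rw [clamp_of_abs_le (abs_le.2 ⟨h, h'⟩),
        clamp_of_abs_le (abs_le.2 ⟨by linarith, by linarith⟩)]
    · rw [clamp_of_one_le h', clamp_of_le (by linarith)]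

theorem clamp_cases {v w : ℝ} (h : v < w) :
    (clamp v < clamp w ∧ v - clamp v ≤ w - clamp w) ∨
      (clamp v ≤ clamp w ∧ v - clamp v < w - clamp w) := by
  simp only [clamp, max_def, min_def]
  split_ifs <;> first
    | exact Or.inl ⟨by linarith, by linarith⟩
    | exact Or.inr ⟨by linarith, by linarith⟩

theorem continuous_clamp : Continuous clamp := by unfold clamp; fun_prop

/-- The radius of the parallel of height `bandHeight * h` on the unit sphere. -/
noncomputable def parallelRadius (h : ℝ) : ℝ := √(1 - bandHeight ^ 2 * h ^ 2)

theorem parallelRadius_sq {h : ℝ} (hh : |h| ≤ 1) :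
    parallelRadius h ^ 2 = 1 - bandHeight ^ 2 * h ^ 2 := by
  rw [parallelRadius, Real.sq_sqrt]
  have := (sq_le_one_iff_abs_le_one h).2 hh
  rw [bandHeight_sq]; linarith

theorem parallelRadius_sq_ge {h : ℝ} (hh : |h| ≤ 1) : 18 / 25 ≤ parallelRadius h ^ 2 := by
  have := (sq_le_one_iff_abs_le_one h).2 hh
  rw [parallelRadius_sq hh, bandHeight_sq]; linarith

theorem parallelRadius_pos {h : ℝ} (hh : |h| ≤ 1) : 0 < parallelRadius h := by
  have h1 := parallelRadius_sq_ge hh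
  have h2 : 0 ≤ parallelRadius h := Real.sqrt_nonneg _
  rcases h2.eq_or_lt with h3 | h3
  · rw [← h3] at h1; norm_num at h1
  · exact h3

theorem bandHeight_div_lt_one {h : ℝ} (hh : |h| ≤ 1) : bandHeight / parallelRadius h < 1 := by
  rw [div_lt_one (parallelRadius_pos hh)]
  have h1 := parallelRadius_sq_ge hh
  have := bandHeight_sq
  exact lt_of_pow_lt_pow_left₀ 2 (parallelRadius_pos hh).le (by linarith)

/-- The angle on the parallel of height `bandHeight * h` of the point at `v + i h` : it is chosen
such that the horizontal projection is linear for `|v| ≤ 1`, and it is linear in `v` beyond. -/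
noncomputable def bandAngle (v h : ℝ) : ℝ :=
  Real.arcsin (bandHeight / parallelRadius h * clamp v) +
    (v - clamp v) * ((Real.pi - Real.arcsin (bandHeight / parallelRadius h)) / (Real.pi - 1))

theorem one_lt_pi : (1 : ℝ) < Real.pi := by linarith [Real.pi_gt_three]

theorem bandAngle_slope_pos (h : ℝ) :
    0 < (Real.pi - Real.arcsin (bandHeight / parallelRadius h)) / (Real.pi - 1) := by
  have := Real.arcsin_le_pi_div_two (bandHeight / parallelRadius h)
  have := Real.pi_pos
  exact div_pos (by linarith) (by linarith [one_lt_pi])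

theorem bandAngle_strictMono {h : ℝ} (hh : |h| ≤ 1) : StrictMono fun v => bandAngle v h := by
  intro v w hvw
  have hs := bandAngle_slope_pos h
  have hk1 := bandHeight_div_lt_one hh
  have hk : 0 < bandHeight / parallelRadius h := div_pos bandHeight_pos (parallelRadius_pos hh)
  have hmem : ∀ x, bandHeight / parallelRadius h * clamp x ∈ Set.Icc (-1 : ℝ) 1 := by
    intro x
    have := abs_le.1 (abs_clamp_le x)
    constructor <;> nlinarith
  rcases clamp_cases hvw with ⟨h1, h2⟩ | ⟨h1, h2⟩
  · exact add_lt_add_of_lt_of_le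
      (Real.strictMonoOn_arcsin (hmem v) (hmem w) (mul_lt_mul_of_pos_left h1 hk))
      (mul_le_mul_of_nonneg_right h2 hs.le)
  · exact add_lt_add_of_le_of_lt
      (Real.monotone_arcsin (mul_le_mul_of_nonneg_left h1 hk.le))
      (mul_lt_mul_of_pos_right h2 hs)

theorem bandAngle_pi (h : ℝ) : bandAngle Real.pi h = Real.pi := by
  have : Real.pi - 1 ≠ 0 := by linarith [one_lt_pi]
  rw [bandAngle, clamp_of_one_le one_lt_pi.le]
  field_simp
  ring

theorem bandAngle_neg (v h : ℝ) : bandAngle (-v) h = -bandAngle v h := by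
  rw [bandAngle, bandAngle, clamp_neg, mul_neg, Real.arcsin_neg]
  ring

theorem bandAngle_neg_pi (h : ℝ) : bandAngle (-Real.pi) h = -Real.pi := by
  rw [bandAngle_neg, bandAngle_pi]

theorem abs_bandAngle_le {v h : ℝ} (hh : |h| ≤ 1) (hv : |v| ≤ Real.pi) :
    |bandAngle v h| ≤ Real.pi := by
  rw [abs_le] at hv ⊢
  have h1 := (bandAngle_strictMono hh).monotone hv.1
  have h2 := (bandAngle_strictMono hh).monotone hv.2
  simp only [bandAngle_pi, bandAngle_neg_pi] at h1 h2
  exact ⟨h1, h2⟩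

theorem continuous_bandAngle {X : Type*} [TopologicalSpace X] {v h : X → ℝ} (hv : Continuous v)
    (hh : Continuous h) (hh1 : ∀ x, |h x| ≤ 1) : Continuous fun x => bandAngle (v x) (h x) := by
  have hg : Continuous fun x => bandHeight / parallelRadius (h x) := by
    refine continuous_const.div ?_ fun x => (parallelRadius_pos (hh1 x)).ne'
    unfold parallelRadius
    fun_prop
  have hc := continuous_clamp.comp hv
  have := Real.continuous_arcsin
  unfold bandAngle
  exact (this.comp (hg.mul hc)).add
    ((hv.sub hc).mul ((continuous_const.sub (this.comp hg)).div_const _))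

/-- First coordinate of the point of the spherical band. -/
noncomputable def bandX (p : ℂ) : ℝ := parallelRadius p.im * Real.cos (bandAngle p.re p.im)

/-- Second coordinate of the point of the spherical band. -/
noncomputable def bandY (p : ℂ) : ℝ := parallelRadius p.im * Real.sin (bandAngle p.re p.im)

theorem band_sq_add_sq {p : ℂ} (hp : |p.im| ≤ 1) :
    bandX p ^ 2 + bandY p ^ 2 + (bandHeight * p.im) ^ 2 = 1 := by
  have := parallelRadius_sq hp
  rw [bandX, bandY]
  linear_combination this + parallelRadius p.im ^ 2 * Real.sin_sq_add_cos_sq (bandAngle p.re p.im)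

theorem bandY_of_abs_re_le {p : ℂ} (hp : |p.im| ≤ 1) (hv : |p.re| ≤ 1) :
    bandY p = bandHeight * p.re := by
  have hg := parallelRadius_pos hp
  have hk1 := bandHeight_div_lt_one hp
  have hk : 0 < bandHeight / parallelRadius p.im := div_pos bandHeight_pos hg
  rw [bandY, bandAngle, clamp_of_abs_le hv, sub_self, zero_mul, add_zero]
  rw [abs_le] at hv
  rw [Real.sin_arcsin (by nlinarith) (by nlinarith)]
  field_simp

theorem bandX_nonneg_of_abs_re_le {p : ℂ} (hp : |p.im| ≤ 1) (hv : |p.re| ≤ 1) : 0 ≤ bandX p := by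
  rw [bandX, bandAngle, clamp_of_abs_le hv, sub_self, zero_mul, add_zero]
  exact mul_nonneg (parallelRadius_pos hp).le (Real.cos_arcsin_nonneg _)

theorem bandX_sq_of_abs_re_le {p : ℂ} (hp : |p.im| ≤ 1) (hv : |p.re| ≤ 1) :
    bandX p ^ 2 = 1 - bandHeight ^ 2 * ‖p‖ ^ 2 := by
  have h1 := band_sq_add_sq hp
  rw [bandY_of_abs_re_le hp hv] at h1
  rw [← Complex.normSq_eq_norm_sq, Complex.normSq_apply]
  linear_combination h1

theorem bandX_lt_of_one_lt {p : ℂ} (hp : |p.im| ≤ 1) (hv : 1 < |p.re|)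
    (hv' : |p.re| ≤ Real.pi) : bandX p < holeRadius := by
  have hg := parallelRadius_pos hp
  have key : Real.cos (bandAngle p.re p.im) < Real.cos (bandAngle 1 p.im) := by
    have habs : |bandAngle p.re p.im| = bandAngle |p.re| p.im := by
      have h0 : bandAngle 0 p.im = 0 := by
        have := bandAngle_neg 0 p.im
        rw [neg_zero] at this
        linarith
      have hpos := (bandAngle_strictMono hp).monotone (abs_nonneg p.re)
      simp only [h0] at hpos
      rcases abs_choice p.re with h | h
      · rw [h] at hpos ⊢; exact abs_of_nonneg hpos
      · rw [h, bandAngle_neg] at hpos ⊢; exact abs_of_nonpos (by linarith)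
    rw [← Real.cos_abs (bandAngle p.re p.im), habs]
    refine Real.cos_lt_cos_of_nonneg_of_le_pi ?_ ?_ (bandAngle_strictMono hp hv)
    · rw [bandAngle, clamp_of_one_le le_rfl, sub_self, zero_mul, add_zero, mul_one]
      exact Real.arcsin_nonneg.2 (div_pos bandHeight_pos hg).le
    · have := (bandAngle_strictMono hp).monotone hv'
      simpa only [bandAngle_pi] using this
  have h1 : bandX p < bandX ⟨1, p.im⟩ := mul_lt_mul_of_pos_left key hg
  have h2 := band_sq_add_sq (p := ⟨1, p.im⟩) hp
  rw [bandY_of_abs_re_le (p := ⟨1, p.im⟩) hp (by simp)] at h2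
  have h3 : bandX ⟨1, p.im⟩ ^ 2 ≤ 18 / 25 := by
    have := bandHeight_sq
    simp only at h2
    nlinarith [sq_nonneg (bandHeight * p.im)]
  nlinarith [holeRadius_sq, holeRadius_pos]

theorem bandX_le {p : ℂ} (hp : p ∈ pants) : bandX p ≤ holeRadius := by
  obtain ⟨h1, h2, h3⟩ := hp
  rcases le_or_gt |p.re| 1 with h | h
  · have := bandX_sq_of_abs_re_le h2 h
    have h4 := bandHeight_sq
    have h5 := holeRadius_sq
    have h6 := holeRadius_pos
    rw [h4] at this
    nlinarith
  · exact (bandX_lt_of_one_lt h2 h h1).le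

theorem norm_eq_of_bandX_eq {p : ℂ} (hp : p ∈ pants) (h : bandX p = holeRadius) :
    ‖p‖ = holeRadius := by
  obtain ⟨h1, h2, h3⟩ := hp
  rcases le_or_gt |p.re| 1 with h' | h'
  · have := bandX_sq_of_abs_re_le h2 h'
    have h4 := bandHeight_sq
    have h5 := holeRadius_sq
    have h6 := holeRadius_pos
    rw [h4, h] at this
    nlinarith [norm_nonneg p]
  · exact absurd h (bandX_lt_of_one_lt h2 h' h1).ne

/-- On the disc of radius `holeRadius` the band projects linearly, so that its boundary is a
parallel about the first axis. -/
theorem bandX_of_norm_eq {p : ℂ} (h : ‖p‖ = holeRadius) : bandX p = holeRadius := by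
  have h1 := (Complex.abs_re_le_norm p).trans (h.le.trans holeRadius_lt_one.le)
  have h2 := (Complex.abs_im_le_norm p).trans (h.le.trans holeRadius_lt_one.le)
  have := bandX_sq_of_abs_re_le h2 h1
  rw [h, bandHeight_sq, holeRadius_sq] at this
  have h3 := bandX_nonneg_of_abs_re_le h2 h1
  nlinarith [holeRadius_sq, holeRadius_pos]

theorem holeRadius_lt_bandX {p : ℂ} (h : ‖p‖ < holeRadius) : holeRadius < bandX p := by
  have h1 := (Complex.abs_re_le_norm p).trans (h.le.trans holeRadius_lt_one.le)
  have h2 := (Complex.abs_im_le_norm p).trans (h.le.trans holeRadius_lt_one.le)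
  have := bandX_sq_of_abs_re_le h2 h1
  rw [bandHeight_sq] at this
  have h3 := bandX_nonneg_of_abs_re_le h2 h1
  nlinarith [holeRadius_sq, holeRadius_pos, norm_nonneg p]

/-- Points of the rectangle have the same image in the band only on the vertical sides. -/
theorem band_eq_iff {p q : ℂ} (hp : p ∈ pants) (hq : q ∈ pants) :
    (bandX p = bandX q ∧ bandY p = bandY q ∧ p.im = q.im) ↔ p = q ∨ Seam p q := by
  constructor
  · rintro ⟨h1, h2, h3⟩
    have hg := parallelRadius_pos hp.2.1
    rw [bandX, bandX, ← h3] at h1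
    rw [bandY, bandY, ← h3] at h2
    have h1' := mul_left_cancel₀ hg.ne' h1
    have h2' := mul_left_cancel₀ hg.ne' h2
    have he : Circle.exp (bandAngle p.re p.im) = Circle.exp (bandAngle q.re p.im) := by
      apply Circle.ext
      rw [Circle.coe_exp, Circle.coe_exp, Complex.exp_mul_I, Complex.exp_mul_I,
        ← Complex.ofReal_cos, ← Complex.ofReal_sin, ← Complex.ofReal_cos, ← Complex.ofReal_sin,
        h1', h2']
    have hinj := (bandAngle_strictMono hp.2.1).injective
    rcases (circle_exp_eq_iff (abs_bandAngle_le hp.2.1 hp.1) (abs_bandAngle_le hp.2.1 hq.1)).1 he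
      with h | ⟨h, h'⟩ | ⟨h, h'⟩
    · exact Or.inl (Complex.ext (hinj h) h3)
    · refine Or.inr ⟨h3, Or.inl ⟨hinj ?_, hinj ?_⟩⟩
      · simpa only [bandAngle_pi] using h
      · simpa only [bandAngle_neg_pi] using h'
    · refine Or.inr ⟨h3, Or.inr ⟨hinj ?_, hinj ?_⟩⟩
      · simpa only [bandAngle_neg_pi] using h
      · simpa only [bandAngle_pi] using h'
  · rintro (rfl | ⟨h, ⟨h1, h2⟩ | ⟨h1, h2⟩⟩)
    · exact ⟨rfl, rfl, rfl⟩
    · rw [bandX, bandX, bandY, bandY, h1, h2, h, bandAngle_pi, bandAngle_neg_pi]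
      simp
    · rw [bandX, bandX, bandY, bandY, h1, h2, h, bandAngle_pi, bandAngle_neg_pi]
      simp

theorem exists_band_eq {X Y Z : ℝ} (h : X ^ 2 + Y ^ 2 + Z ^ 2 = 1) (hZ : |Z| ≤ bandHeight)
    (hX : X ≤ holeRadius) : ∃ p ∈ pants, bandX p = X ∧ bandY p = Y ∧ bandHeight * p.im = Z := by
  have ht := bandHeight_pos
  have hh : |Z / bandHeight| ≤ 1 := by
    rw [abs_div, abs_of_pos ht, div_le_one ht]; exact hZ
  set a : ℂ := ⟨X, Y⟩ with ha
  have hnorm : ‖a‖ = parallelRadius (Z / bandHeight) := by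
    refine (sq_eq_sq₀ (norm_nonneg _) (parallelRadius_pos hh).le).1 ?_
    rw [parallelRadius_sq hh, ← Complex.normSq_eq_norm_sq, Complex.normSq_apply]
    have : bandHeight ^ 2 * (Z / bandHeight) ^ 2 = Z ^ 2 := by field_simp
    rw [this]
    simp only [ha]
    linarith
  have hcont : Continuous fun v => bandAngle v (Z / bandHeight) :=
    continuous_bandAngle continuous_id continuous_const fun _ => hh
  have hle : -Real.pi ≤ Real.pi := by linarith [Real.pi_pos]
  have hivt := intermediate_value_Icc hle hcont.continuousOn
  simp only [bandAngle_pi, bandAngle_neg_pi] at hivt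
  obtain ⟨v, hv, hva⟩ := hivt ⟨(Complex.neg_pi_lt_arg a).le, Complex.arg_le_pi a⟩
  simp only at hva
  have hXe : bandX ⟨v, Z / bandHeight⟩ = X := by
    rw [bandX, hva, ← hnorm, Complex.norm_mul_cos_arg]
  have hYe : bandY ⟨v, Z / bandHeight⟩ = Y := by
    rw [bandY, hva, ← hnorm, Complex.norm_mul_sin_arg]
  refine ⟨⟨v, Z / bandHeight⟩, ⟨abs_le.2 hv, hh, ?_⟩, hXe, hYe, by field_simp⟩
  by_contra! hlt
  have := holeRadius_lt_bandX hlt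
  linarith

theorem continuous_bandX_pants : Continuous fun p : pants => bandX p := by
  have h1 : Continuous fun p : pants => (p : ℂ).re := by fun_prop
  have h2 : Continuous fun p : pants => (p : ℂ).im := by fun_prop
  have h3 := continuous_bandAngle h1 h2 fun p => p.2.2.1
  unfold bandX parallelRadius
  fun_prop

theorem continuous_bandY_pants : Continuous fun p : pants => bandY p := by
  have h1 : Continuous fun p : pants => (p : ℂ).re := by fun_prop
  have h2 : Continuous fun p : pants => (p : ℂ).im := by fun_prop
  have h3 := continuous_bandAngle h1 h2 fun p => p.2.2.1
  unfold bandY parallelRadius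
  fun_prop

/-- The involution of the unit sphere, given by a Lorentz transformation, that exchanges the cap
`holeRadius ≤ X.1` with the hemisphere `X.1 ≤ 0`. -/
noncomputable def boost (X : ℝ × ℝ × ℝ) : ℝ × ℝ × ℝ :=
  ((holeRadius - X.1) / (1 - holeRadius * X.1), capRadius * X.2.1 / (1 - holeRadius * X.1),
    capRadius * X.2.2 / (1 - holeRadius * X.1))

/-- The points of the unit sphere, with explicit coordinates. -/
def IsUnit3 (X : ℝ × ℝ × ℝ) : Prop := X.1 ^ 2 + X.2.1 ^ 2 + X.2.2 ^ 2 = 1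

theorem IsUnit3.denom_pos {X : ℝ × ℝ × ℝ} (hX : IsUnit3 X) : 0 < 1 - holeRadius * X.1 := by
  have h : X.1 ≤ 1 := by
    unfold IsUnit3 at hX
    nlinarith [sq_nonneg X.2.1, sq_nonneg X.2.2]
  nlinarith [holeRadius_pos, holeRadius_lt_one]

theorem IsUnit3.boost {X : ℝ × ℝ × ℝ} (hX : IsUnit3 X) : IsUnit3 (boost X) := by
  have hd := hX.denom_pos.ne'
  unfold IsUnit3 BraidSurgery.boost at *
  simp only
  field_simp
  have h1 := holeRadius_sq
  have h2 := capRadius_sq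
  linear_combination capRadius ^ 2 * hX + (1 - X.1 ^ 2) * (h1 + h2)

theorem IsUnit3.boost_boost {X : ℝ × ℝ × ℝ} (hX : IsUnit3 X) :
    BraidSurgery.boost (BraidSurgery.boost X) = X := by
  have hd := hX.denom_pos
  have h1 := holeRadius_sq
  have h2 := capRadius_sq
  have h3 : 1 - holeRadius * ((holeRadius - X.1) / (1 - holeRadius * X.1)) =
      capRadius ^ 2 / (1 - holeRadius * X.1) := by
    field_simp
    linear_combination -h1 - h2
  have hc := capRadius_pos
  unfold BraidSurgery.boost
  simp only [h3]
  refine Prod.ext ?_ (Prod.ext ?_ ?_)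
  · simp only
    field_simp
    linear_combination (-X.1) * (h1 + h2)
  · simp only
    field_simp
  · simp only
    field_simp

theorem boost_neg_iff {X Y : ℝ × ℝ × ℝ} (hX : X.1 = holeRadius) (hY : Y.1 = holeRadius) :
    boost X = -boost Y ↔ X.2 = -Y.2 := by
  have hd : 1 - holeRadius * holeRadius ≠ 0 := by nlinarith [holeRadius_sq]
  have hc := capRadius_pos.ne'
  simp only [boost, hX, hY, Prod.ext_iff, Prod.neg_mk, Prod.fst_neg, Prod.snd_neg]
  constructor
  · rintro ⟨-, h1, h2⟩
    constructor
    · rw [← neg_div, div_left_inj' hd, ← mul_neg] at h1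
      exact mul_left_cancel₀ hc h1
    · rw [← neg_div, div_left_inj' hd, ← mul_neg] at h2
      exact mul_left_cancel₀ hc h2
  · rintro ⟨h1, h2⟩
    refine ⟨by simp, ?_, ?_⟩
    · rw [h1]; ring
    · rw [h2]; ring

/-- The point of `ℝ³` with the coordinate `X.1` along `e₀ + e₁`, the coordinate `X.2.2` along
`e₁ - e₀` and the coordinate `X.2.1` along `e₂`. -/
noncomputable def rotated (X : ℝ × ℝ × ℝ) : EuclideanSpace ℝ (Fin 3) :=
  !₂[(X.1 - X.2.2) / √2, (X.1 + X.2.2) / √2, X.2.1]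

theorem norm_rotated {X : ℝ × ℝ × ℝ} (hX : IsUnit3 X) : ‖rotated X‖ = 1 := by
  rw [EuclideanSpace.norm_eq, Real.sqrt_eq_one]
  simp only [rotated, Fin.sum_univ_three, Real.norm_eq_abs, sq_abs]
  simp [div_pow]
  unfold IsUnit3 at hX
  linarith

theorem rotated_injective : Function.Injective rotated := by
  intro X Y h
  have h0 : (X.1 - X.2.2) / √2 = (Y.1 - Y.2.2) / √2 := congrArg (fun x => x 0) h
  have h1 : (X.1 + X.2.2) / √2 = (Y.1 + Y.2.2) / √2 := congrArg (fun x => x 1) h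
  have h2 : X.2.1 = Y.2.1 := congrArg (fun x => x 2) h
  have h3 : √2 ≠ 0 := by positivity
  rw [div_left_inj' h3] at h0 h1
  exact Prod.ext (by linarith) (Prod.ext h2 (by linarith))

theorem rotated_neg (X : ℝ × ℝ × ℝ) : rotated (-X) = -rotated X := by
  ext i
  fin_cases i <;> simp [rotated] <;> ring

theorem continuous_rotated : Continuous rotated := by
  unfold rotated
  fun_prop

theorem exists_rotated_eq (x : EuclideanSpace ℝ (Fin 3)) : ∃ X, rotated X = x := by
  have h3 : √2 ≠ 0 := by positivity
  have h4 : √2 * √2 = 2 := Real.mul_self_sqrt (by norm_num)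
  refine ⟨((x 0 + x 1) / √2, x 2, (x 1 - x 0) / √2), ?_⟩
  ext i
  fin_cases i
  · simp only [rotated]
    simp
    field_simp
    rw [pow_two, h4]
    ring
  · simp only [rotated]
    simp
    field_simp
    rw [pow_two, h4]
    ring
  · simp [rotated]

theorem isUnit3_of_norm_rotated {X : ℝ × ℝ × ℝ} (h : ‖rotated X‖ = 1) : IsUnit3 X := by
  rw [EuclideanSpace.norm_eq, Real.sqrt_eq_one] at h
  simp only [rotated, Fin.sum_univ_three, Real.norm_eq_abs, sq_abs] at h
  simp [div_pow] at h
  unfold IsUnit3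
  linarith

/-- The point of the spherical band that corresponds to a point of the rectangle. -/
noncomputable def bandPoint (p : ℂ) : ℝ × ℝ × ℝ := (bandX p, bandY p, bandHeight * p.im)

theorem isUnit3_bandPoint {p : ℂ} (hp : p ∈ pants) : IsUnit3 (bandPoint p) :=
  band_sq_add_sq hp.2.1

theorem boost_bandPoint_fst_nonneg {p : ℂ} (hp : p ∈ pants) : 0 ≤ (boost (bandPoint p)).1 :=
  div_nonneg (sub_nonneg.2 (bandX_le hp)) (isUnit3_bandPoint hp).denom_pos.le

/-- The two holes of the pair of pants go to the polar caps about `e₀` and `e₁`. -/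
theorem abs_boost_le {p : ℂ} (hp : p ∈ pants) :
    (boost (bandPoint p)).1 + |(boost (bandPoint p)).2.2| ≤ 4 * √2 / 5 := by
  have hd : 0 < 1 - holeRadius * bandX p := (isUnit3_bandPoint hp).denom_pos
  have h1 := holeRadius_mul
  have h3 := abs_le.1 hp.2.1
  have h2 := capRadius_mul_bandHeight
  have hs : 0 < √2 := by positivity
  have key : ∀ t : ℝ, t ≤ 1 → (holeRadius - bandX p) / (1 - holeRadius * bandX p) +
      capRadius * (bandHeight * t) / (1 - holeRadius * bandX p) ≤ 4 * √2 / 5 := by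
    intro t ht
    rw [← add_div, div_le_iff₀ hd]
    have e1 : capRadius * (bandHeight * t) = 7 * √2 / 40 * t := by rw [← h2]; ring
    have e2 : 4 * √2 / 5 * (1 - holeRadius * bandX p) = 4 * √2 / 5 - bandX p := by
      linear_combination (-bandX p) * h1
    rw [e1, e2, holeRadius]
    nlinarith
  rcases abs_choice (boost (bandPoint p)).2.2 with h | h
  · rw [h]
    exact key p.im h3.2
  · rw [h]
    have := key (-p.im) (by linarith)
    have e : -(boost (bandPoint p)).2.2 =
        capRadius * (bandHeight * -p.im) / (1 - holeRadius * bandX p) := by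
      change -(capRadius * (bandHeight * p.im) / _) = _
      simp only [bandPoint]
      ring
    rw [e]
    exact this

/-- The parametrisation by the pair of pants of the hemisphere `x₀ + x₁ ≥ 0` minus the two discs
about `e₀` and `e₁`. -/
noncomputable def hemisphere (p : pants) : SphereMinusFourDiscs :=
  ⟨rotated (boost (bandPoint p)), by
    have hu := (isUnit3_bandPoint p.2).boost
    have h0 := boost_bandPoint_fst_nonneg p.2
    have h1 := abs_boost_le p.2
    have h2 : |(boost (bandPoint p)).2.2| ≤ 1 := by
      rw [← sq_le_one_iff_abs_le_one]
      unfold IsUnit3 at hu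
      nlinarith [sq_nonneg (boost (bandPoint p)).1, sq_nonneg (boost (bandPoint p)).2.1]
    have hs : 0 < √2 := by positivity
    have hs2 : √2 * √2 = 2 := Real.mul_self_sqrt (by norm_num)
    have h3 := abs_le.1 h2
    have h4 := le_abs_self (boost (bandPoint p)).2.2
    have h5 := neg_abs_le (boost (bandPoint p)).2.2
    refine ⟨norm_rotated hu, ?_, ?_⟩
    · change |(_ - _) / √2| ≤ _
      rw [abs_div, abs_of_pos hs, div_le_iff₀ hs, abs_le]
      constructor <;> nlinarith
    · change |(_ + _) / √2| ≤ _
      rw [abs_div, abs_of_pos hs, div_le_iff₀ hs, abs_le]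
      constructor <;> nlinarith⟩

theorem continuous_hemisphere : Continuous hemisphere := by
  refine Continuous.subtype_mk (continuous_rotated.comp ?_) _
  have hd : ∀ p : pants, 1 - holeRadius * bandX p ≠ 0 :=
    fun p => (isUnit3_bandPoint p.2).denom_pos.ne'
  have h1 := continuous_bandX_pants
  have h2 := continuous_bandY_pants
  have h3 : Continuous fun p : pants => (p : ℂ).im := by fun_prop
  unfold boost bandPoint
  have hden : Continuous fun p : pants => 1 - holeRadius * bandX p := by fun_prop
  exact ((continuous_const.sub h1).div hden hd).prodMk
    (((continuous_const.mul h2).div hden hd).prodMk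
      ((continuous_const.mul (continuous_const.mul h3)).div hden hd))

theorem hemisphere_eq_iff {p q : pants} :
    hemisphere p = hemisphere q ↔ (p : ℂ) = q ∨ Seam p q := by
  rw [← band_eq_iff p.2 q.2]
  constructor
  · intro h
    have h1 := rotated_injective (congrArg Subtype.val h)
    have h2 := congrArg boost h1
    rw [(isUnit3_bandPoint p.2).boost_boost, (isUnit3_bandPoint q.2).boost_boost] at h2
    simp only [bandPoint, Prod.mk.injEq] at h2
    exact ⟨h2.1, h2.2.1, mul_left_cancel₀ bandHeight_pos.ne' h2.2.2⟩
  · rintro ⟨h1, h2, h3⟩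
    have : bandPoint p = bandPoint q := by rw [bandPoint, bandPoint, h1, h2, h3]
    exact Subtype.ext (by change rotated _ = rotated _; rw [this])

/-- Points of the hemisphere are antipodal only on the boundary of the removed disc, where the
parametrisation is odd. -/
theorem hemisphere_eq_antipode_iff {p q : pants} :
    hemisphere p = antipode (hemisphere q) ↔ ‖(p : ℂ)‖ = holeRadius ∧ (p : ℂ) = -q := by
  have hle : ∀ x : ℂ, ‖x‖ = holeRadius → |x.re| ≤ 1 ∧ |x.im| ≤ 1 := fun x hx =>
    ⟨(Complex.abs_re_le_norm x).trans (hx.le.trans holeRadius_lt_one.le),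
      (Complex.abs_im_le_norm x).trans (hx.le.trans holeRadius_lt_one.le)⟩
  have ht := bandHeight_pos.ne'
  constructor
  · intro h
    have h1 : rotated (boost (bandPoint p)) = -rotated (boost (bandPoint q)) :=
      congrArg Subtype.val h
    rw [← rotated_neg] at h1
    have h2 := rotated_injective h1
    have h3 : (boost (bandPoint p)).1 = -(boost (bandPoint q)).1 := congrArg Prod.fst h2
    have h4 := boost_bandPoint_fst_nonneg p.2
    have h5 := boost_bandPoint_fst_nonneg q.2
    have key : ∀ r : pants, (boost (bandPoint r)).1 = 0 → bandX r = holeRadius := by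
      intro r hr
      have hd := (isUnit3_bandPoint r.2).denom_pos.ne'
      simp only [boost, div_eq_zero_iff, hd, or_false] at hr
      exact (sub_eq_zero.1 hr).symm
    have hp := key p (by linarith)
    have hq := key q (by linarith)
    have hnp := norm_eq_of_bandX_eq p.2 hp
    have hnq := norm_eq_of_bandX_eq q.2 hq
    have h6 := (boost_neg_iff (X := bandPoint p) (Y := bandPoint q) hp hq).1 h2
    simp only [bandPoint, Prod.neg_mk, Prod.mk.injEq] at h6
    rw [bandY_of_abs_re_le p.2.2.1 (hle _ hnp).1, bandY_of_abs_re_le q.2.2.1 (hle _ hnq).1,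
      ← mul_neg, ← mul_neg] at h6
    refine ⟨hnp, Complex.ext ?_ ?_⟩
    · simpa using mul_left_cancel₀ ht h6.1
    · simpa using mul_left_cancel₀ ht h6.2
  · rintro ⟨hn, hpq⟩
    have hn' : ‖(q : ℂ)‖ = holeRadius := by rw [← hn, hpq, norm_neg]
    have hp := bandX_of_norm_eq hn
    have hq := bandX_of_norm_eq hn'
    refine Subtype.ext ?_
    change rotated (boost (bandPoint p)) = -rotated (boost (bandPoint q))
    rw [← rotated_neg]
    congr 1
    rw [boost_neg_iff (X := bandPoint p) (Y := bandPoint q) hp hq]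
    simp only [bandPoint, Prod.neg_mk, Prod.mk.injEq]
    rw [bandY_of_abs_re_le p.2.2.1 (hle _ hn).1, bandY_of_abs_re_le q.2.2.1 (hle _ hn').1, hpq]
    simp

theorem exists_hemisphere_eq_of_nonneg {X : ℝ × ℝ × ℝ} (hX : IsUnit3 X) (h0 : 0 ≤ X.1)
    (h1 : X.1 + |X.2.2| ≤ 4 * √2 / 5) : ∃ p : pants, boost (bandPoint p) = X := by
  have hd := hX.denom_pos
  have hub := hX.boost
  have hle : (boost X).1 ≤ holeRadius := by
    rw [boost, div_le_iff₀ hd]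
    nlinarith [holeRadius_sq]
  have hZ : |(boost X).2.2| ≤ bandHeight := by
    have hc := capRadius_pos
    have h2 : |(boost X).2.2| = capRadius * |X.2.2| / (1 - holeRadius * X.1) := by
      rw [boost, abs_div, abs_mul, abs_of_pos hc, abs_of_pos hd]
    rw [h2, div_le_iff₀ hd]
    have h3 := capRadius_mul
    have h4 := holeRadius_mul
    calc capRadius * |X.2.2| ≤ capRadius * (4 * √2 / 5 - X.1) := by gcongr; linarith
      _ = bandHeight * (1 - holeRadius * X.1) := by
        rw [← h3]
        linear_combination capRadius * X.1 * h4
  obtain ⟨p, hp, e1, e2, e3⟩ := exists_band_eq hub hZ hle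
  refine ⟨⟨p, hp⟩, ?_⟩
  have : bandPoint p = boost X := Prod.ext e1 (Prod.ext e2 e3)
  rw [this, hX.boost_boost]

theorem exists_hemisphere_eq (x : SphereMinusFourDiscs) :
    ∃ p : pants, hemisphere p = x ∨ hemisphere p = antipode x := by
  obtain ⟨y, hn, ha0, ha1⟩ := x
  obtain ⟨X, rfl⟩ := exists_rotated_eq y
  have hX := isUnit3_of_norm_rotated hn
  have hs : 0 < √2 := by positivity
  have hs2 : √2 * √2 = 2 := Real.mul_self_sqrt (by norm_num)
  change |(X.1 - X.2.2) / √2| ≤ _ at ha0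
  change |(X.1 + X.2.2) / √2| ≤ _ at ha1
  rw [abs_div, abs_of_pos hs, div_le_iff₀ hs, abs_le] at ha0 ha1
  rcases le_total 0 X.1 with h | h
  · obtain ⟨p, hp⟩ := exists_hemisphere_eq_of_nonneg hX h (by
      rcases abs_choice X.2.2 with h' | h' <;> rw [h'] <;> linarith)
    exact ⟨p, Or.inl (Subtype.ext (congrArg rotated hp))⟩
  · have hX' : IsUnit3 (-X) := by
      unfold IsUnit3 at *
      simpa using hX
    obtain ⟨p, hp⟩ := exists_hemisphere_eq_of_nonneg hX' (by simpa using h) (by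
      rw [Prod.fst_neg, Prod.snd_neg, Prod.snd_neg, abs_neg]
      rcases abs_choice X.2.2 with h' | h' <;> rw [h'] <;> linarith)
    refine ⟨p, Or.inr (Subtype.ext ?_)⟩
    change rotated _ = -rotated X
    rw [hp, rotated_neg]

/-! ### The circle bundle over the pair of pants -/

/-- The vertical compression of the rectangle that maps its vertical sides to the real axis and
is the identity for `|Re p| ≤ 1`. -/
noncomputable def flatten (p : ℂ) : ℂ := ⟨p.re, p.im * min 1 ((Real.pi - |p.re|) / (Real.pi - 1))⟩

theorem flatten_of_abs_re_le {p : ℂ} (h : |p.re| ≤ 1) : flatten p = p := by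
  have : min 1 ((Real.pi - |p.re|) / (Real.pi - 1)) = 1 := by
    rw [min_eq_left]
    rw [le_div_iff₀ (by linarith [one_lt_pi])]
    linarith
  rw [flatten, this, mul_one]

theorem flatten_of_abs_re_eq_pi {p : ℂ} (h : |p.re| = Real.pi) : flatten p = (p.re : ℂ) := by
  rw [flatten, h, sub_self, zero_div, min_eq_right (by norm_num), mul_zero]
  rfl

theorem ne_zero_of_mem_pants {p : ℂ} (hp : p ∈ pants) : p ≠ 0 := by
  intro h
  have := hp.2.2
  rw [h, norm_zero] at this
  linarith [holeRadius_pos]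

theorem flatten_ne_zero {p : ℂ} (hp : p ∈ pants) : flatten p ≠ 0 := by
  intro h
  have hre : p.re = 0 := congrArg Complex.re h
  rw [flatten_of_abs_re_le (by rw [hre]; simp)] at h
  exact ne_zero_of_mem_pants hp h

theorem continuous_flatten : Continuous flatten := by
  have h : flatten = fun p : ℂ => (p.re : ℂ) +
      ((p.im * min 1 ((Real.pi - |p.re|) / (Real.pi - 1)) : ℝ) : ℂ) * Complex.I := by
    funext p
    apply Complex.ext <;> simp [flatten]
  rw [h]
  fun_prop

/-- The change of trivialisation of the circle bundle over the pair of pants. Near the removed disc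
it is trivial, and on the vertical sides it is `p ↦ (p / ‖p‖)²`. -/
noncomputable def untwist (p : ℂ) : Circle := dir p ^ 2 * (dir (flatten p) ^ 2)⁻¹

theorem untwist_of_norm_eq {p : ℂ} (h : ‖p‖ = holeRadius) : untwist p = 1 := by
  rw [untwist, flatten_of_abs_re_le, mul_inv_cancel]
  exact (Complex.abs_re_le_norm p).trans (h.le.trans holeRadius_lt_one.le)

theorem untwist_of_abs_re_eq_pi {p : ℂ} (h : |p.re| = Real.pi) : untwist p = dir p ^ 2 := by
  have h1 : dir (p.re : ℂ) ^ 2 = 1 := by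
    rcases abs_choice p.re with h' | h'
    · rw [dir_ofReal (by rw [← h', h]; exact Real.pi_pos), one_pow]
    · have hneg : 0 < -p.re := by rw [← h', h]; exact Real.pi_pos
      have : (p.re : ℂ) = -((-p.re : ℝ) : ℂ) := by push_cast; ring
      rw [this, dir_neg (by exact_mod_cast hneg.ne'), dir_ofReal hneg]
      simp
  rw [untwist, flatten_of_abs_re_eq_pi h, h1, inv_one, mul_one]

theorem continuous_untwist_pants : Continuous fun p : pants => untwist p := by
  have h1 := continuous_dir_comp (f := fun p : pants => (p : ℂ)) continuous_subtype_val
    fun p => ne_zero_of_mem_pants p.2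
  have h2 := continuous_dir_comp (f := fun p : pants => flatten p)
    (continuous_flatten.comp continuous_subtype_val) fun p => flatten_ne_zero p.2
  unfold untwist
  fun_prop

/-- The circle bundle as a quotient of `pants × S¹`. The trivialisation is changed by `untwist` in
order that the slices of the thickened torus match along the vertical sides of the rectangle. -/
noncomputable def modelMap (x : pants × Circle) : OrientableCircleBundle :=
  bundleMk (hemisphere x.1, x.2 * untwist x.1)

theorem continuous_modelMap : Continuous modelMap := by
  refine continuous_bundleMk.comp ((continuous_hemisphere.comp continuous_fst).prodMk ?_)
  exact continuous_snd.mul (continuous_untwist_pants.comp continuous_fst)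

/-- The identifications made by `modelMap` : over the vertical sides of the rectangle, and over
the boundary of the removed disc, where `(p, z)` is identified with `(-p, z⁻¹)`. -/
theorem modelMap_eq_iff {p q : pants} {z w : Circle} :
    modelMap (p, z) = modelMap (q, w) ↔
      ((p : ℂ) = q ∧ z = w) ∨ (Seam p q ∧ z * dir p ^ 2 = w * dir q ^ 2) ∨
        (‖(p : ℂ)‖ = holeRadius ∧ (q : ℂ) = -p ∧ w = z⁻¹) := by
  have hseam : ∀ {p q : ℂ}, Seam p q → |p.re| = Real.pi ∧ |q.re| = Real.pi := by
    rintro p q ⟨-, ⟨h1, h2⟩ | ⟨h1, h2⟩⟩ <;> rw [h1, h2] <;>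
      simp [abs_of_pos Real.pi_pos]
  rw [modelMap, modelMap, bundleMk_eq_iff]
  simp only [deck, Prod.mk.injEq]
  constructor
  · rintro (⟨h1, h2⟩ | ⟨h1, h2⟩)
    · rcases hemisphere_eq_iff.1 h1.symm with h | h
      · left
        rw [h] at h2
        exact ⟨h, (mul_right_cancel h2).symm⟩
      · right; left
        rw [untwist_of_abs_re_eq_pi (hseam h).1, untwist_of_abs_re_eq_pi (hseam h).2] at h2
        exact ⟨h, h2.symm⟩
    · right; right
      obtain ⟨h3, h4⟩ := hemisphere_eq_antipode_iff.1 h1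
      have h5 : ‖(p : ℂ)‖ = holeRadius := by rw [← h3, h4, norm_neg]
      rw [untwist_of_norm_eq h3, untwist_of_norm_eq h5, mul_one, mul_one] at h2
      exact ⟨h5, h4, h2⟩
  · rintro (⟨h1, h2⟩ | ⟨h1, h2⟩ | ⟨h1, h2, h3⟩)
    · left
      obtain rfl : p = q := Subtype.ext h1
      rw [h2]
      exact ⟨rfl, rfl⟩
    · left
      refine ⟨(hemisphere_eq_iff.2 (Or.inr h1)).symm, ?_⟩
      rw [untwist_of_abs_re_eq_pi (hseam h1).1, untwist_of_abs_re_eq_pi (hseam h1).2, h2]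
    · right
      have h5 : ‖(q : ℂ)‖ = holeRadius := by rw [h2, norm_neg, h1]
      refine ⟨hemisphere_eq_antipode_iff.2 ⟨h5, h2⟩, ?_⟩
      rw [untwist_of_norm_eq h1, untwist_of_norm_eq h5, mul_one, mul_one, h3]

theorem modelMap_surjective : Function.Surjective modelMap := by
  intro b
  obtain ⟨⟨x, w⟩, rfl⟩ := bundleMk_surjective b
  obtain ⟨p, h | h⟩ := exists_hemisphere_eq x
  · refine ⟨(p, w * (untwist p)⁻¹), ?_⟩
    simp only [modelMap]
    rw [h, inv_mul_cancel_right]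
  · refine ⟨(p, w⁻¹ * (untwist p)⁻¹), ?_⟩
    simp only [modelMap]
    rw [h, inv_mul_cancel_right]
    exact bundleMk_deck (x, w)

theorem holeRadius_mem_pants : (holeRadius : ℂ) ∈ pants := by
  have h1 := holeRadius_pos
  have h2 := holeRadius_lt_one
  have h3 := one_lt_pi
  refine ⟨?_, by simp, ?_⟩
  · rw [Complex.ofReal_re, abs_of_pos h1]; linarith
  · rw [Complex.norm_real, Real.norm_eq_abs, abs_of_pos h1]

/-- The base point of the circle fibre that corresponds to the orbit segment. -/
noncomputable def centralPoint : SphereMinusFourDiscs :=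
  hemisphere ⟨holeRadius, holeRadius_mem_pants⟩

theorem modelMap_mem_central_fibre_iff {p : pants} {z : Circle} :
    modelMap (p, z) ∈ bundleProj ⁻¹' {(Quot.mk _ centralPoint : RP2MinusTwoDiscs)} ↔
      (p : ℂ) = holeRadius ∨ (p : ℂ) = -holeRadius := by
  have hn : ‖(holeRadius : ℂ)‖ = holeRadius := by
    rw [Complex.norm_real, Real.norm_eq_abs, abs_of_pos holeRadius_pos]
  rw [mem_bundleProj_fibre_iff]
  constructor
  · rintro ⟨w, h⟩
    have h' : modelMap (p, z) = modelMap (⟨holeRadius, holeRadius_mem_pants⟩, w) := by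
      rw [h, modelMap, centralPoint]
      simp only
      rw [untwist_of_norm_eq hn, mul_one]
    rcases modelMap_eq_iff.1 h' with ⟨h1, -⟩ | ⟨⟨-, h1⟩, -⟩ | ⟨-, h1, -⟩
    · exact Or.inl h1
    · have h2 := holeRadius_pos
      have h3 := holeRadius_lt_one
      have h4 := one_lt_pi
      simp only [Complex.ofReal_re] at h1
      rcases h1 with ⟨-, h⟩ | ⟨-, h⟩ <;> linarith
    · right
      have h2 : (holeRadius : ℂ) = -p := h1
      rw [h2, neg_neg]
  · rintro (h | h)
    · refine ⟨z, ?_⟩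
      obtain rfl : p = ⟨holeRadius, holeRadius_mem_pants⟩ := Subtype.ext h
      simp only [modelMap, centralPoint]
      rw [untwist_of_norm_eq hn, mul_one]
    · refine ⟨z⁻¹, ?_⟩
      have h' : modelMap (p, z) = modelMap (⟨holeRadius, holeRadius_mem_pants⟩, z⁻¹) := by
        rw [modelMap_eq_iff]
        refine Or.inr (Or.inr ⟨?_, ?_, rfl⟩)
        · rw [h, norm_neg, hn]
        · rw [h, neg_neg]
      rw [h', modelMap, centralPoint]
      simp only
      rw [untwist_of_norm_eq hn, mul_one]

/-! ### The slit plane as the exterior of the unit disc -/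

/-- Half the difference of the semi-axes of the ellipse in the plane slit along `[-2, 2]` that
corresponds to the circle of radius `ρ` : near the slit it is `1 / ρ`, as for the Joukowski map, and
for `4 ≤ ρ` it is zero. -/
noncomputable def eccentricity (ρ : ℝ) : ℝ := max 0 (min (1 / ρ) ((4 - ρ) / 3))

theorem eccentricity_nonneg (ρ : ℝ) : 0 ≤ eccentricity ρ := le_max_left _ _

theorem eccentricity_of_le {ρ : ℝ} (h1 : 1 ≤ ρ) (h3 : ρ ≤ 3) : eccentricity ρ = 1 / ρ := by
  have h0 : 0 < ρ := by linarith
  rw [eccentricity, min_eq_left, max_eq_right (by positivity)]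
  rw [div_le_div_iff₀ h0 (by norm_num)]
  nlinarith

theorem eccentricity_of_ge {ρ : ℝ} (h : 4 ≤ ρ) : eccentricity ρ = 0 := by
  rw [eccentricity, max_eq_left]
  exact (min_le_right _ _).trans (by linarith)

theorem eccentricity_one : eccentricity 1 = 1 := by
  rw [eccentricity_of_le le_rfl (by norm_num)]; norm_num

theorem eccentricity_antitone {x y : ℝ} (hx : 1 ≤ x) (hxy : x ≤ y) :
    eccentricity y ≤ eccentricity x := by
  unfold eccentricity
  have : 1 / y ≤ 1 / x := one_div_le_one_div_of_le (by linarith) hxy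
  gcongr

theorem eccentricity_le_one {ρ : ℝ} (h : 1 ≤ ρ) : eccentricity ρ ≤ 1 :=
  eccentricity_one ▸ eccentricity_antitone le_rfl h

theorem add_eccentricity_lt {x y : ℝ} (hx : 1 ≤ x) (hxy : x < y) :
    x + eccentricity x < y + eccentricity y := by
  have h0 : 0 < x := by linarith
  have h0' : 0 < y := by linarith
  have h1 : 1 / x < 1 / y + (y - x) := by
    have : 1 / x - 1 / y = (y - x) / (x * y) := by field_simp
    have h2 : (y - x) / (x * y) < y - x := by
      rw [div_lt_iff₀ (by positivity)]
      have : 1 < x * y := by nlinarith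
      nlinarith
    linarith
  have h2 : (4 - x) / 3 < (4 - y) / 3 + (y - x) := by linarith
  have h3 : min (1 / x) ((4 - x) / 3) < min (1 / y) ((4 - y) / 3) + (y - x) := by
    rcases le_total (1 / y) ((4 - y) / 3) with h | h
    · rw [min_eq_left h]; exact (min_le_left _ _).trans_lt h1
    · rw [min_eq_right h]; exact (min_le_right _ _).trans_lt h2
  have h4 : eccentricity x < eccentricity y + (y - x) := by
    rw [eccentricity, max_lt_iff]
    constructor
    · linarith [eccentricity_nonneg y]
    · exact h3.trans_le (by gcongr; exact le_max_right _ _)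
  linarith

theorem sub_eccentricity_lt {x y : ℝ} (hx : 1 ≤ x) (hxy : x < y) :
    x - eccentricity x < y - eccentricity y := by
  linarith [eccentricity_antitone hx hxy.le]

theorem continuousOn_eccentricity : ContinuousOn eccentricity (Set.Ici 1) := by
  unfold eccentricity
  refine ContinuousOn.sup continuousOn_const (ContinuousOn.inf ?_ (by fun_prop))
  exact continuousOn_const.div continuousOn_id fun x hx => by
    have : (1 : ℝ) ≤ x := hx
    linarith

/-- The map from the exterior of the unit disc to the plane slit along `[-1, 1]`. It is the
Joukowski map `(J + J⁻¹) / 2` for `‖J‖ ≤ 3`, and `J / 2` for `4 ≤ ‖J‖`. -/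
noncomputable def squash (J : ℂ) : ℂ :=
  (J + (eccentricity ‖J‖ / ‖J‖ : ℝ) * (starRingEnd ℂ) J) / 2

/-- The companion of `squash` ; it is `J - J⁻¹` for `‖J‖ ≤ 3`, and `J` for `4 ≤ ‖J‖`. On the slit
`‖J‖ = 1` it is imaginary, with opposite values on the two sides `J` and `J⁻¹`. -/
noncomputable def cosquash (J : ℂ) : ℂ :=
  J - (eccentricity ‖J‖ / ‖J‖ : ℝ) * (starRingEnd ℂ) J

theorem squash_neg (J : ℂ) : squash (-J) = -squash J := by
  simp only [squash, norm_neg, map_neg]; ring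

theorem cosquash_neg (J : ℂ) : cosquash (-J) = -cosquash J := by
  simp only [cosquash, norm_neg, map_neg]; ring

theorem re_squash {J : ℂ} (hJ : 1 ≤ ‖J‖) :
    2 * (squash J).re = (‖J‖ + eccentricity ‖J‖) * (J.re / ‖J‖) := by
  have : ‖J‖ ≠ 0 := by linarith
  rw [squash, show (2 : ℂ) = ((2 : ℝ) : ℂ) by norm_num, Complex.div_ofReal_re, Complex.add_re,
    Complex.re_ofReal_mul, Complex.conj_re]
  field_simp

theorem im_squash {J : ℂ} (hJ : 1 ≤ ‖J‖) :
    2 * (squash J).im = (‖J‖ - eccentricity ‖J‖) * (J.im / ‖J‖) := by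
  have : ‖J‖ ≠ 0 := by linarith
  rw [squash, show (2 : ℂ) = ((2 : ℝ) : ℂ) by norm_num, Complex.div_ofReal_im, Complex.add_im,
    Complex.im_ofReal_mul, Complex.conj_im]
  field_simp
  ring

theorem sq_add_sq_div_norm {J : ℂ} (hJ : 1 ≤ ‖J‖) : (J.re / ‖J‖) ^ 2 + (J.im / ‖J‖) ^ 2 = 1 := by
  have : ‖J‖ ≠ 0 := by linarith
  have h := Complex.normSq_eq_norm_sq J
  rw [Complex.normSq_apply] at h
  field_simp
  linarith

theorem eq_of_norm_eq {J K : ℂ} (hJ : 1 ≤ ‖J‖) (h : ‖J‖ = ‖K‖) (hre : J.re / ‖J‖ = K.re / ‖K‖)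
    (him : J.im / ‖J‖ = K.im / ‖K‖) : J = K := by
  have : ‖K‖ ≠ 0 := by linarith
  rw [h, div_left_inj' this] at hre him
  exact Complex.ext hre him

theorem squash_injective {J K : ℂ} (hJ : 1 ≤ ‖J‖) (hK : 1 ≤ ‖K‖) (h : squash J = squash K) :
    K = J ∨ (‖J‖ = 1 ∧ K = (starRingEnd ℂ) J) := by
  have key : ∀ {J K : ℂ}, 1 ≤ ‖J‖ → 1 ≤ ‖K‖ → squash J = squash K → ¬ ‖J‖ < ‖K‖ := by
    intro J K hJ hK h hlt
    have h1 := re_squash hJ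
    have h2 := im_squash hJ
    rw [h, re_squash hK] at h1
    rw [h, im_squash hK] at h2
    have h3 := sq_add_sq_div_norm hJ
    have h4 := sq_add_sq_div_norm hK
    have h5 := add_eccentricity_lt hJ hlt
    have h6 := sub_eccentricity_lt hJ hlt
    have h7 := eccentricity_nonneg ‖J‖
    have h8 := eccentricity_le_one hJ
    set a := ‖J‖ + eccentricity ‖J‖
    set b := ‖J‖ - eccentricity ‖J‖
    set a' := ‖K‖ + eccentricity ‖K‖
    set b' := ‖K‖ - eccentricity ‖K‖
    set x := J.re / ‖J‖
    set y := J.im / ‖J‖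
    set x' := K.re / ‖K‖
    set y' := K.im / ‖K‖
    have ha : 0 < a := by simp only [a]; linarith
    have hb : 0 ≤ b := by simp only [b]; linarith
    -- The ratios of corresponding semi-axes are less than one, so `K` has norm less than itself.
    have e1 : x' ^ 2 ≤ x ^ 2 := by
      have : (a' * x') ^ 2 = (a * x) ^ 2 := by rw [h1]
      have h9 : a ^ 2 * x' ^ 2 ≤ a ^ 2 * x ^ 2 := by
        have : a ^ 2 ≤ a' ^ 2 := by gcongr
        nlinarith [sq_nonneg x']
      exact le_of_mul_le_mul_left h9 (by positivity)
    have e2 : y' ^ 2 ≤ y ^ 2 := by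
      have h10 : (b' * y') ^ 2 = (b * y) ^ 2 := by rw [h2]
      have h9 : b' ^ 2 * y' ^ 2 ≤ b' ^ 2 * y ^ 2 := by
        have : b ^ 2 ≤ b' ^ 2 := by gcongr
        nlinarith [sq_nonneg y]
      have hb' : 0 < b' := by linarith
      exact le_of_mul_le_mul_left h9 (by positivity)
    have e3 : x' ^ 2 = x ^ 2 := by linarith
    have e4 : y' ^ 2 = y ^ 2 := by linarith
    have e5 : x = 0 := by
      have h9 : (a' * x') ^ 2 = (a * x) ^ 2 := by rw [h1]
      have h10 : a ^ 2 < a' ^ 2 := by gcongr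
      have h11 : (a' ^ 2 - a ^ 2) * x ^ 2 = 0 := by rw [mul_pow, mul_pow, e3] at h9; linarith
      rcases mul_eq_zero.1 h11 with h | h
      · linarith
      · exact pow_eq_zero_iff (by norm_num) |>.1 h
    have e6 : y = 0 := by
      have h9 : (b' * y') ^ 2 = (b * y) ^ 2 := by rw [h2]
      have h10 : b ^ 2 < b' ^ 2 := by gcongr
      have h11 : (b' ^ 2 - b ^ 2) * y ^ 2 = 0 := by rw [mul_pow, mul_pow, e4] at h9; linarith
      rcases mul_eq_zero.1 h11 with h | h
      · linarith
      · exact pow_eq_zero_iff (by norm_num) |>.1 h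
    rw [e5, e6] at h3
    norm_num at h3
  have hn : ‖J‖ = ‖K‖ := le_antisymm (not_lt.1 (key hK hJ h.symm)) (not_lt.1 (key hJ hK h))
  have h1 := re_squash hJ
  have h2 := im_squash hJ
  rw [h, re_squash hK, ← hn] at h1
  rw [h, im_squash hK, ← hn] at h2
  have h7 := eccentricity_nonneg ‖J‖
  have h8 := eccentricity_le_one hJ
  have hre : K.re / ‖K‖ = J.re / ‖J‖ := by
    rw [← hn]
    exact mul_left_cancel₀ (by linarith) h1
  by_cases h9 : ‖J‖ = 1
  · have h3 := sq_add_sq_div_norm hJ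
    have h4 := sq_add_sq_div_norm hK
    rw [hre] at h4
    rw [← hn, h9, div_one, div_one] at hre
    rw [h9, ← hn, h9] at h4
    rw [h9] at h3
    have h10 : K.im ^ 2 = J.im ^ 2 := by
      simp only [div_one] at h3 h4
      linarith
    rcases sq_eq_sq_iff_eq_or_eq_neg.1 h10 with h11 | h11
    · exact Or.inl (Complex.ext hre h11)
    · exact Or.inr ⟨h9, Complex.ext hre h11⟩
  · left
    have h10 : 1 < ‖J‖ := lt_of_le_of_ne hJ (Ne.symm h9)
    refine eq_of_norm_eq hK hn.symm hre ?_
    rw [← hn]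
    exact mul_left_cancel₀ (by linarith) h2

theorem norm_two_squash_le {J : ℂ} (hJ : 1 ≤ ‖J‖) :
    ‖2 * squash J‖ ≤ ‖J‖ + eccentricity ‖J‖ := by
  have h1 := re_squash hJ
  have h2 := im_squash hJ
  have h3 := sq_add_sq_div_norm hJ
  have h7 := eccentricity_nonneg ‖J‖
  have h8 := eccentricity_le_one hJ
  refine (sq_le_sq₀ (norm_nonneg _) (by linarith)).1 ?_
  rw [← Complex.normSq_eq_norm_sq, Complex.normSq_apply]
  have e1 : (2 * squash J).re = 2 * (squash J).re := by simp
  have e2 : (2 * squash J).im = 2 * (squash J).im := by simp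
  rw [e1, e2, h1, h2]
  nlinarith [sq_nonneg (J.im / ‖J‖), mul_nonneg (show 0 ≤ ‖J‖ by linarith) h7]

theorem norm_two_squash_le_four {J : ℂ} (hJ : 1 ≤ ‖J‖) (h4 : ‖J‖ ≤ 4) : ‖2 * squash J‖ ≤ 4 := by
  refine (norm_two_squash_le hJ).trans ?_
  rcases h4.eq_or_lt with h | h
  · rw [h, eccentricity_of_ge le_rfl]; norm_num
  · have := add_eccentricity_lt hJ h
    rw [eccentricity_of_ge le_rfl] at this
    linarith

theorem two_squash_of_four_le {J : ℂ} (h : 4 ≤ ‖J‖) : 2 * squash J = J := by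
  rw [squash, eccentricity_of_ge h]
  simp only [zero_div, Complex.ofReal_zero, zero_mul, add_zero]
  ring

theorem cosquash_of_four_le {J : ℂ} (h : 4 ≤ ‖J‖) : cosquash J = J := by
  rw [cosquash, eccentricity_of_ge h]
  simp

theorem eccentricity_mul_conj {J : ℂ} (h1 : 1 ≤ ‖J‖) (h3 : ‖J‖ ≤ 3) :
    (eccentricity ‖J‖ / ‖J‖ : ℝ) * (starRingEnd ℂ) J = J⁻¹ := by
  rw [eccentricity_of_le h1 h3, Complex.inv_def, Complex.normSq_eq_norm_sq, mul_comm]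
  congr 2
  field_simp

theorem squash_of_le {J : ℂ} (h1 : 1 ≤ ‖J‖) (h3 : ‖J‖ ≤ 3) : squash J = (J + J⁻¹) / 2 := by
  rw [squash, eccentricity_mul_conj h1 h3]

theorem cosquash_of_le {J : ℂ} (h1 : 1 ≤ ‖J‖) (h3 : ‖J‖ ≤ 3) : cosquash J = J - J⁻¹ := by
  rw [cosquash, eccentricity_mul_conj h1 h3]

theorem cosquash_ne_zero {J : ℂ} (hJ : 1 ≤ ‖J‖) (h1 : squash J ≠ 1) (h2 : squash J ≠ -1) :
    cosquash J ≠ 0 := by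
  intro h
  have hJ0 : J ≠ 0 := by rintro rfl; norm_num at hJ
  have hn : ‖J‖ = eccentricity ‖J‖ := by
    have h3 : J = (eccentricity ‖J‖ / ‖J‖ : ℝ) * (starRingEnd ℂ) J := sub_eq_zero.1 h
    have h4 := congrArg norm h3
    have h5 : 0 < ‖J‖ := by linarith
    rw [norm_mul, RCLike.norm_conj, Complex.norm_real, Real.norm_eq_abs,
      abs_of_nonneg (div_nonneg (eccentricity_nonneg _) h5.le), div_mul_cancel₀ _ h5.ne'] at h4
    exact h4
  have hone : ‖J‖ = 1 := le_antisymm (hn.le.trans (eccentricity_le_one hJ)) hJ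
  rw [cosquash_of_le hJ (by linarith), sub_eq_zero] at h
  have hsq : squash J = J := by
    rw [squash_of_le hJ (by linarith), ← h]; ring
  have : J * J = 1 := by
    nth_rw 2 [h]
    exact mul_inv_cancel₀ hJ0
  rcases mul_self_eq_one_iff.1 this with h' | h'
  · exact h1 (hsq.trans h')
  · exact h2 (hsq.trans h')

theorem exists_squash_eq (q : ℂ) : ∃ J : ℂ, 1 ≤ ‖J‖ ∧ squash J = q := by
  -- It suffices to find the radius and the direction of `J` separately.
  have key : ∀ (ρ x y : ℝ), 1 ≤ ρ → x ^ 2 + y ^ 2 = 1 → 2 * q.re = (ρ + eccentricity ρ) * x →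
      2 * q.im = (ρ - eccentricity ρ) * y → ∃ J : ℂ, 1 ≤ ‖J‖ ∧ squash J = q := by
    intro ρ x y hρ hxy h1 h2
    have hn : ‖(⟨ρ * x, ρ * y⟩ : ℂ)‖ = ρ := by
      refine (sq_eq_sq₀ (norm_nonneg _) (by linarith)).1 ?_
      rw [← Complex.normSq_eq_norm_sq, Complex.normSq_apply]
      simp only
      linear_combination ρ ^ 2 * hxy
    have hJ : 1 ≤ ‖(⟨ρ * x, ρ * y⟩ : ℂ)‖ := by rw [hn]; exact hρ
    have hρ0 : ρ ≠ 0 := by linarith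
    refine ⟨⟨ρ * x, ρ * y⟩, hJ, Complex.ext ?_ ?_⟩
    · have := re_squash hJ
      rw [hn] at this
      simp only [mul_div_cancel_left₀ _ hρ0] at this
      linarith
    · have := im_squash hJ
      rw [hn] at this
      simp only [mul_div_cancel_left₀ _ hρ0] at this
      linarith
  set M : ℝ := 4 + 2 * ‖q‖ with hM
  have hM1 : (4 : ℝ) ≤ M := by simp only [hM]; linarith [norm_nonneg q]
  have hIcc : Set.Icc 1 M ⊆ Set.Ici (1 : ℝ) := fun x hx => hx.1
  have hcont := continuousOn_eccentricity.mono hIcc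
  have heM := eccentricity_of_ge hM1
  have hre := Complex.abs_re_le_norm q
  have hnq := Complex.normSq_eq_norm_sq q
  rw [Complex.normSq_apply] at hnq
  by_cases hy : q.im = 0
  · by_cases hx : |q.re| ≤ 1
    · refine key 1 q.re (√(1 - q.re ^ 2)) le_rfl ?_ ?_ ?_
      · rw [Real.sq_sqrt]
        · ring
        · have := (sq_le_one_iff_abs_le_one _).2 hx
          linarith
      · rw [eccentricity_one]; ring
      · rw [eccentricity_one, hy]; ring
    · push Not at hx
      have hivt := intermediate_value_Icc (by linarith : (1 : ℝ) ≤ M)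
        ((continuousOn_id.add hcont : ContinuousOn (fun ρ => ρ + eccentricity ρ) (Set.Icc 1 M)))
      have hmem : 2 * |q.re| ∈ Set.Icc (1 + eccentricity 1) (M + eccentricity M) := by
        rw [eccentricity_one, heM]
        constructor <;> linarith
      obtain ⟨ρ, hρ, hρe⟩ := hivt hmem
      replace hρe : ρ + eccentricity ρ = 2 * |q.re| := hρe
      rcases abs_choice q.re with h | h
      · refine key ρ 1 0 hρ.1 (by norm_num) ?_ (by rw [hy]; ring)
        rw [hρe, h]; ring
      · refine key ρ (-1) 0 hρ.1 (by norm_num) ?_ (by rw [hy]; ring)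
        rw [hρe, h]; ring
  · -- The ellipses with the given semi-axes exhaust the plane, by the intermediate value theorem.
    set F : ℝ → ℝ := fun ρ =>
      (ρ + eccentricity ρ) ^ 2 * (ρ - eccentricity ρ) ^ 2 -
        (2 * q.re) ^ 2 * (ρ - eccentricity ρ) ^ 2 - (2 * q.im) ^ 2 * (ρ + eccentricity ρ) ^ 2
      with hF
    have hFc : ContinuousOn F (Set.Icc 1 M) := by
      simp only [hF]
      fun_prop
    have hivt := intermediate_value_Icc (by linarith : (1 : ℝ) ≤ M) hFc
    have hmem : (0 : ℝ) ∈ Set.Icc (F 1) (F M) := by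
      simp only [hF, eccentricity_one, heM]
      constructor
      · nlinarith [sq_nonneg q.im]
      · have h1 : (2 * q.re) ^ 2 + (2 * q.im) ^ 2 = (2 * ‖q‖) ^ 2 := by linarith
        have h2 : (2 * ‖q‖) ^ 2 ≤ M ^ 2 := by
          have := norm_nonneg q
          gcongr
          linarith
        have h3 : M ^ 2 * ((2 * q.re) ^ 2 + (2 * q.im) ^ 2) ≤ M ^ 2 * M ^ 2 := by
          rw [h1]; gcongr
        simp only [add_zero, sub_zero]
        linarith
    obtain ⟨ρ, hρ, hρe⟩ := hivt hmem
    have ha : 0 < ρ + eccentricity ρ := by linarith [eccentricity_nonneg ρ, hρ.1]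
    have hb : 0 < ρ - eccentricity ρ := by
      rcases hρ.1.eq_or_lt with h | h
      · exfalso
        rw [← h] at hρe
        simp only [hF, eccentricity_one] at hρe
        apply hy
        have : q.im ^ 2 = 0 := by nlinarith
        exact pow_eq_zero_iff (by norm_num) |>.1 this
      · linarith [eccentricity_le_one hρ.1]
    refine key ρ (2 * q.re / (ρ + eccentricity ρ)) (2 * q.im / (ρ - eccentricity ρ)) hρ.1 ?_ ?_ ?_
    · simp only [hF] at hρe
      field_simp
      linarith
    · field_simp
    · field_simp

theorem norm_le_three_of_squash_near {J : ℂ} (hJ : 1 ≤ ‖J‖) (h : ‖squash J - 1‖ ≤ 1 / 2) :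
    ‖J‖ ≤ 3 := by
  by_contra! h3
  have h1 := re_squash hJ
  have h2 := im_squash hJ
  have h4 := sq_add_sq_div_norm hJ
  have h5 := add_eccentricity_lt (by norm_num) h3
  have h6 := sub_eccentricity_lt (by norm_num) h3
  rw [eccentricity_of_le (by norm_num) le_rfl] at h5 h6
  have hsq : ‖squash J - 1‖ ^ 2 ≤ 1 / 4 := by
    have := norm_nonneg (squash J - 1)
    nlinarith
  rw [← Complex.normSq_eq_norm_sq, Complex.normSq_apply] at hsq
  simp only [Complex.sub_re, Complex.one_re, Complex.sub_im, Complex.one_im, sub_zero] at hsq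
  set x := J.re / ‖J‖
  set y := J.im / ‖J‖
  set a := ‖J‖ + eccentricity ‖J‖
  set b := ‖J‖ - eccentricity ‖J‖
  set u := (squash J).re
  set v := (squash J).im
  have hv : (8 / 3) ^ 2 * y ^ 2 ≤ 4 * v ^ 2 := by
    have : (2 * v) ^ 2 = b ^ 2 * y ^ 2 := by rw [h2]; ring
    have h7 : (8 / 3) ^ 2 ≤ b ^ 2 := by
      have : (8 / 3 : ℝ) ≤ b := by linarith
      gcongr
    nlinarith [sq_nonneg y]
  have hu : (10 / 3) ^ 2 * x ^ 2 ≤ 4 * u ^ 2 := by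
    have : (2 * u) ^ 2 = a ^ 2 * x ^ 2 := by rw [h1]; ring
    have h7 : (10 / 3) ^ 2 ≤ a ^ 2 := by
      have : (10 / 3 : ℝ) ≤ a := by linarith
      gcongr
    nlinarith [sq_nonneg x]
  -- The point would lie inside the ellipse with foci `±1` and semi-axes `5/3` and `4/3`.
  nlinarith [sq_nonneg (u - 3 / 2)]

/-! ### Piecewise linear interpolation on an interval -/

/-- The piecewise linear function with the value `m + x / l` for `|x| ≤ l p`, and with the values
`± X` at `± 8 X`. -/
noncomputable def interp (X m p l x : ℝ) : ℝ :=
  m + max (-(l * p)) (min x (l * p)) / l + (X - m - p) / (8 * X - l * p) * max (x - l * p) 0 -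
    (X + m - p) / (8 * X - l * p) * max (-x - l * p) 0

section interp
variable {X m p l : ℝ}

theorem interp_of_abs_le {x : ℝ} (h : |x| ≤ l * p) : interp X m p l x = m + x / l := by
  rw [abs_le] at h
  rw [interp, min_eq_left h.2, max_eq_right h.1, max_eq_right (by linarith),
    max_eq_right (by linarith)]
  ring

theorem interp_of_le {x : ℝ} (hl : 0 < l) (hp : 0 ≤ p) (h : l * p ≤ x) :
    interp X m p l x = m + p + (X - m - p) / (8 * X - l * p) * (x - l * p) := by
  have : 0 ≤ l * p := by positivity
  rw [interp, min_eq_right h, max_eq_right (by linarith), max_eq_left (by linarith),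
    max_eq_right (by linarith)]
  field_simp
  ring

theorem interp_of_le_neg {x : ℝ} (hl : 0 < l) (hp : 0 ≤ p) (h : x ≤ -(l * p)) :
    interp X m p l x = m - p - (X + m - p) / (8 * X - l * p) * (-x - l * p) := by
  have : 0 ≤ l * p := by positivity
  rw [interp, min_eq_left (by linarith), max_eq_left (by linarith), max_eq_right (by linarith),
    max_eq_left (by linarith)]
  field_simp
  ring

theorem interp_strictMono (hl : 0 < l) (hp : 0 ≤ p) (hm : |m| + p < X) (hb : l * p < 8 * X) :
    StrictMono (interp X m p l) := by
  have hm1 := le_abs_self m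
  have hm2 := neg_abs_le m
  have h1 : 0 < (X - m - p) / (8 * X - l * p) := div_pos (by linarith) (by linarith)
  have h2 : 0 < (X + m - p) / (8 * X - l * p) := div_pos (by linarith) (by linarith)
  have h0 : 0 ≤ l * p := by positivity
  intro x y hxy
  have a1 : max (-(l * p)) (min x (l * p)) / l ≤ max (-(l * p)) (min y (l * p)) / l := by
    gcongr
  have a2 : (X - m - p) / (8 * X - l * p) * max (x - l * p) 0 ≤
      (X - m - p) / (8 * X - l * p) * max (y - l * p) 0 := by gcongr
  have a3 : (X + m - p) / (8 * X - l * p) * max (-y - l * p) 0 ≤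
      (X + m - p) / (8 * X - l * p) * max (-x - l * p) 0 := by gcongr
  unfold interp
  rcases lt_or_ge x (-(l * p)) with h | h
  · have : (X + m - p) / (8 * X - l * p) * max (-y - l * p) 0 <
        (X + m - p) / (8 * X - l * p) * max (-x - l * p) 0 := by
      refine mul_lt_mul_of_pos_left ?_ h2
      rw [max_eq_left (by linarith : 0 ≤ -x - l * p)]
      exact max_lt (by linarith) (by linarith)
    linarith
  · rcases lt_or_ge (l * p) y with h' | h'
    · have : (X - m - p) / (8 * X - l * p) * max (x - l * p) 0 <
          (X - m - p) / (8 * X - l * p) * max (y - l * p) 0 := by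
        refine mul_lt_mul_of_pos_left ?_ h1
        rw [max_eq_left (by linarith : 0 ≤ y - l * p)]
        exact max_lt (by linarith) (by linarith)
      linarith
    · have : max (-(l * p)) (min x (l * p)) / l < max (-(l * p)) (min y (l * p)) / l := by
        rw [min_eq_left h', min_eq_left (by linarith), max_eq_right h, max_eq_right (by linarith)]
        gcongr
      linarith

theorem interp_right (hl : 0 < l) (hp : 0 ≤ p) (hb : l * p < 8 * X) :
    interp X m p l (8 * X) = X := by
  have : 8 * X - l * p ≠ 0 := by linarith
  rw [interp_of_le hl hp hb.le, div_mul_cancel₀ _ this]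
  ring

theorem interp_left (hl : 0 < l) (hp : 0 ≤ p) (hb : l * p < 8 * X) :
    interp X m p l (-(8 * X)) = -X := by
  have : 8 * X - l * p ≠ 0 := by linarith
  rw [interp_of_le_neg hl hp (by linarith), neg_neg, div_mul_cancel₀ _ this]
  ring

theorem abs_interp_le_iff (hl : 0 < l) (hp : 0 ≤ p) (hm : |m| + p < X) (hb : l * p < 8 * X)
    {x : ℝ} : |interp X m p l x| ≤ X ↔ |x| ≤ 8 * X := by
  have hs := interp_strictMono hl hp hm hb
  rw [abs_le, abs_le, ← hs.le_iff_le (a := -(8 * X)), ← hs.le_iff_le (b := 8 * X),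
    interp_right hl hp hb, interp_left hl hp hb]

theorem continuous_interp_comp {Y : Type*} [TopologicalSpace Y] {m p l x : Y → ℝ} (X : ℝ)
    (hm : Continuous m) (hp : Continuous p) (hl : Continuous l) (hx : Continuous x)
    (hl0 : ∀ y, 0 < l y) (hb : ∀ y, l y * p y < 8 * X) :
    Continuous fun y => interp X (m y) (p y) (l y) (x y) := by
  have h1 : ∀ y, l y ≠ 0 := fun y => (hl0 y).ne'
  have h2 : ∀ y, 8 * X - l y * p y ≠ 0 := fun y => by linarith [hb y]
  unfold interp
  fun_prop (disch := assumption)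

theorem exists_interp_eq (hl : 0 < l) (hp : 0 ≤ p) (hb : l * p < 8 * X) {v : ℝ} (hv : |v| ≤ X) :
    ∃ x, interp X m p l x = v := by
  have hc : Continuous (interp X m p l) := by unfold interp; fun_prop
  have h0 : 0 ≤ l * p := by positivity
  have h := intermediate_value_Icc (by linarith : -(8 * X) ≤ 8 * X) hc.continuousOn
  rw [interp_right hl hp hb, interp_left hl hp hb] at h
  obtain ⟨x, -, hx⟩ := h (abs_le.1 hv)
  exact ⟨x, hx⟩

end interp

/-! ### Rotation of the plane near the origin -/

/-- The rotation by `g` of the disc of radius `4`, tapering off to the identity at radius `6`. -/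
noncomputable def spin (g : ℝ) (a : ℂ) : ℂ :=
  a * Circle.exp (g * max 0 (min 1 ((6 - ‖a‖) / 2)))

theorem norm_spin (g : ℝ) (a : ℂ) : ‖spin g a‖ = ‖a‖ := by
  rw [spin, norm_mul, Circle.norm_coe, mul_one]

theorem spin_of_le (g : ℝ) {a : ℂ} (h : ‖a‖ ≤ 4) : spin g a = a * Circle.exp g := by
  rw [spin, min_eq_left (by linarith), max_eq_right (by norm_num), mul_one]

theorem spin_of_ge (g : ℝ) {a : ℂ} (h : 6 ≤ ‖a‖) : spin g a = a := by
  rw [spin, max_eq_left]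
  · simp
  · exact (min_le_right _ _).trans (by linarith)

theorem spin_neg_spin (g : ℝ) (a : ℂ) : spin (-g) (spin g a) = a := by
  conv_lhs => rw [spin, norm_spin, spin]
  rw [neg_mul, Circle.exp_neg, Circle.coe_inv, mul_assoc, mul_inv_cancel₀ (Circle.coe_ne_zero _),
    mul_one]

theorem spin_spin_neg (g : ℝ) (a : ℂ) : spin g (spin (-g) a) = a := by
  simpa using spin_neg_spin (-g) a

theorem spin_zero (a : ℂ) : spin 0 a = a := by simp [spin]

theorem spin_injective (g : ℝ) : Function.Injective (spin g) :=
  Function.LeftInverse.injective (g := spin (-g)) (spin_neg_spin g)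

theorem continuous_spin_comp {Y : Type*} [TopologicalSpace Y] {g : Y → ℝ} {a : Y → ℂ}
    (hg : Continuous g) (ha : Continuous a) : Continuous fun y => spin (g y) (a y) := by
  unfold spin
  have h : Continuous fun y => Circle.exp (g y * max 0 (min 1 ((6 - ‖a y‖) / 2))) :=
    Circle.exp.continuous.comp (by fun_prop)
  exact ha.mul (continuous_subtype_val.comp h)

/-! ### Change of the tubes -/

/-- The radial part of `annulusTwist`. -/
noncomputable def annulusRadius (η x : ℝ) : ℝ := x + max ((1 + η) / 2 - x) 0 * (2 - 1 / η)

/-- The homeomorphism from the exterior of the disc of radius `1 / 2` to the exterior of the disc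
of radius `η` that rotates the inner boundary circle by `-g` ; it is the identity outside the
circle of radius `(1 + η) / 2`. -/
noncomputable def annulusTwist (η g : ℝ) (d : ℂ) : ℂ :=
  d * ((annulusRadius η ‖d‖ / ‖d‖ : ℝ) : ℂ) *
    Circle.exp (-g * (max ((1 + η) / 2 - ‖d‖) 0 / (η / 2)))

section tweak
variable {η g : ℝ}

theorem annulusRadius_of_ge {x : ℝ} (h : (1 + η) / 2 ≤ x) : annulusRadius η x = x := by
  rw [annulusRadius, max_eq_right (by linarith)]; ring

theorem annulusRadius_of_le (hη : 0 < η) {x : ℝ} (h : x ≤ (1 + η) / 2) :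
    annulusRadius η x = (1 + η) / 2 - ((1 + η) / 2 - x) * ((1 - η) / η) := by
  rw [annulusRadius, max_eq_left (by linarith)]
  field_simp
  ring

theorem annulusRadius_half (hη : 0 < η) : annulusRadius η (1 / 2) = η := by
  rw [annulusRadius_of_le hη (by linarith)]
  field_simp
  ring

theorem annulusRadius_strictMono (hη : 0 < η) (hη1 : η < 1) : StrictMono (annulusRadius η) := by
  have hk : 0 < (1 - η) / η := div_pos (by linarith) hη
  intro x y hxy
  rcases le_total y ((1 + η) / 2) with h | h
  · rw [annulusRadius_of_le hη h, annulusRadius_of_le hη (by linarith)]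
    nlinarith
  · rw [annulusRadius_of_ge h]
    rcases le_total x ((1 + η) / 2) with h' | h'
    · rw [annulusRadius_of_le hη h']
      rcases h'.eq_or_lt with h'' | h''
      · rw [h'']; linarith
      · nlinarith
    · rw [annulusRadius_of_ge h']; exact hxy

theorem le_annulusRadius (hη : 0 < η) (hη1 : η < 1) {x : ℝ} (hx : 1 / 2 ≤ x) :
    η ≤ annulusRadius η x := by
  have := (annulusRadius_strictMono hη hη1).monotone hx
  rwa [annulusRadius_half hη] at this

theorem exists_annulusRadius_eq (hη : 0 < η) (hη1 : η < 1) {y : ℝ} (hy : η ≤ y) :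
    ∃ x, 1 / 2 ≤ x ∧ annulusRadius η x = y := by
  rcases le_total y ((1 + η) / 2) with h | h
  · have h1 : 1 - η ≠ 0 := by linarith
    have e : ((1 + η) / 2 - y) * (η / (1 - η)) ≤ η / 2 := by
      rw [mul_div_assoc', div_le_iff₀ (by linarith)]
      nlinarith
    have e' : 0 ≤ ((1 + η) / 2 - y) * (η / (1 - η)) :=
      mul_nonneg (by linarith) (div_nonneg hη.le (by linarith))
    refine ⟨(1 + η) / 2 - ((1 + η) / 2 - y) * (η / (1 - η)), by linarith, ?_⟩
    rw [annulusRadius_of_le hη (by linarith)]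
    field_simp
    ring
  · exact ⟨y, by linarith, annulusRadius_of_ge h⟩

theorem norm_annulusTwist (hη : 0 < η) (hη1 : η < 1) {d : ℂ} (hd : 1 / 2 ≤ ‖d‖) :
    ‖annulusTwist η g d‖ = annulusRadius η ‖d‖ := by
  have h1 := le_annulusRadius hη hη1 hd
  have h2 : 0 < ‖d‖ := by linarith
  rw [annulusTwist, norm_mul, norm_mul, Circle.norm_coe, mul_one, Complex.norm_real,
    Real.norm_eq_abs, abs_of_nonneg (div_nonneg (by linarith) h2.le)]
  field_simp

theorem annulusTwist_of_ge (hη : 0 < η) {d : ℂ} (h : (1 + η) / 2 ≤ ‖d‖) :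
    annulusTwist η g d = d := by
  have h2 : ‖d‖ ≠ 0 := by linarith
  rw [annulusTwist, annulusRadius_of_ge h, max_eq_right (by linarith), div_self h2]
  simp

theorem annulusTwist_of_norm_eq (hη : 0 < η) {d : ℂ} (h : ‖d‖ = 1 / 2) :
    annulusTwist η g d = 2 * η * d * (Circle.exp g)⁻¹ := by
  rw [annulusTwist, h, annulusRadius_half hη, max_eq_left (by linarith)]
  have : -g * (((1 + η) / 2 - 1 / 2) / (η / 2)) = -g := by field_simp; ring
  rw [this, Circle.exp_neg, Circle.coe_inv]
  push_cast
  ring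

theorem annulusTwist_injective (hη : 0 < η) (hη1 : η < 1) {d e : ℂ} (hd : 1 / 2 ≤ ‖d‖)
    (he : 1 / 2 ≤ ‖e‖) (h : annulusTwist η g d = annulusTwist η g e) : d = e := by
  have hn : ‖d‖ = ‖e‖ := by
    refine (annulusRadius_strictMono hη hη1).injective ?_
    rw [← norm_annulusTwist (g := g) hη hη1 hd, ← norm_annulusTwist (g := g) hη hη1 he, h]
  have h1 := le_annulusRadius hη hη1 he
  rw [annulusTwist, annulusTwist, hn] at h
  have h2 := mul_right_cancel₀ (Circle.coe_ne_zero _) h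
  refine mul_right_cancel₀ ?_ h2
  have : annulusRadius η ‖e‖ / ‖e‖ ≠ 0 := div_ne_zero (by linarith) (by linarith)
  exact_mod_cast this

theorem exists_annulusTwist_eq (hη : 0 < η) (hη1 : η < 1) {e : ℂ} (he : η ≤ ‖e‖) :
    ∃ d, 1 / 2 ≤ ‖d‖ ∧ annulusTwist η g d = e := by
  obtain ⟨x, hx, hxe⟩ := exists_annulusRadius_eq hη hη1 he
  have he0 : ‖e‖ ≠ 0 := by linarith
  have hx0 : x ≠ 0 := by linarith
  set w : Circle := Circle.exp (-g * (max ((1 + η) / 2 - x) 0 / (η / 2))) with hw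
  have hn : ‖e * ((x / ‖e‖ : ℝ) : ℂ) * (w⁻¹ : Circle)‖ = x := by
    rw [norm_mul, norm_mul, Circle.norm_coe, mul_one, Complex.norm_real,
      Real.norm_eq_abs, abs_of_nonneg (div_nonneg (by linarith) (norm_nonneg e))]
    field_simp
  refine ⟨e * ((x / ‖e‖ : ℝ) : ℂ) * (w⁻¹ : Circle), by rw [hn]; exact hx, ?_⟩
  rw [annulusTwist, hn, hxe, ← hw]
  have e1 : (w : ℂ) ≠ 0 := w.coe_ne_zero
  have e2 : ((‖e‖ : ℝ) : ℂ) ≠ 0 := by exact_mod_cast he0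
  have e3 : (x : ℂ) ≠ 0 := by exact_mod_cast hx0
  push_cast
  field_simp

/-- The homeomorphism from the exterior of the discs of radius `1 / 2` about `±1` to the exterior
of the discs of radius `η` about `±1` that is given by `annulusTwist` about these two points. -/
noncomputable def tweak (η g : ℝ) (q : ℂ) : ℂ :=
  q + (annulusTwist η g (q - 1) - (q - 1)) - (annulusTwist η g (-q - 1) - (-q - 1))

theorem tweak_neg (q : ℂ) : tweak η g (-q) = -tweak η g q := by
  rw [tweak, tweak, neg_neg]; ring

theorem norm_neg_sub_one (q : ℂ) : ‖-q - 1‖ = ‖q + 1‖ := by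
  rw [← norm_neg]; congr 1; ring

theorem two_sub_le_norm_add_one (q : ℂ) : 2 - ‖q - 1‖ ≤ ‖q + 1‖ := by
  have : ‖(q + 1) - (q - 1)‖ ≤ ‖q + 1‖ + ‖q - 1‖ := norm_sub_le _ _
  rw [show (q + 1) - (q - 1) = (2 : ℂ) by ring] at this
  norm_num at this
  linarith

theorem tweak_of_near (hη : 0 < η) (hη1 : η < 1) {q : ℂ} (h : ‖q - 1‖ ≤ (1 + η) / 2) :
    tweak η g q = 1 + annulusTwist η g (q - 1) := by
  have h1 := two_sub_le_norm_add_one q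
  rw [tweak, annulusTwist_of_ge hη (d := -q - 1) (by rw [norm_neg_sub_one]; linarith)]
  ring

theorem tweak_of_far (hη : 0 < η) {q : ℂ} (h : (1 + η) / 2 ≤ ‖q - 1‖)
    (h' : (1 + η) / 2 ≤ ‖q + 1‖) : tweak η g q = q := by
  rw [tweak, annulusTwist_of_ge hη (d := -q - 1) (by rw [norm_neg_sub_one]; exact h'),
    annulusTwist_of_ge hη h]
  ring

/-- The exterior of the discs of radius `x` about `±1`. -/
def twoDiscExterior (x : ℝ) : Set ℂ := {q | x ≤ ‖q - 1‖ ∧ x ≤ ‖q + 1‖}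

theorem neg_mem_twoDiscExterior {x : ℝ} {q : ℂ} :
    -q ∈ twoDiscExterior x ↔ q ∈ twoDiscExterior x := by
  have : ‖-q + 1‖ = ‖q - 1‖ := by rw [← norm_neg]; congr 1; ring
  rw [twoDiscExterior, Set.mem_ofPred_eq, Set.mem_ofPred_eq, norm_neg_sub_one, this]
  exact and_comm

/-- Reduction of statements about `tweak` to the neighbourhood of `1` and the far region, by
symmetry. -/
theorem twoDisc_cases {P : ℂ → Prop} (hneg : ∀ q, P (-q) → P q) (η : ℝ)
    (near : ∀ q, ‖q - 1‖ < (1 + η) / 2 → P q)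
    (far : ∀ q, (1 + η) / 2 ≤ ‖q - 1‖ → (1 + η) / 2 ≤ ‖q + 1‖ → P q) (q : ℂ) : P q := by
  rcases lt_or_ge ‖q - 1‖ ((1 + η) / 2) with h | h
  · exact near q h
  · rcases lt_or_ge ‖q + 1‖ ((1 + η) / 2) with h' | h'
    · refine hneg q (near _ ?_)
      rwa [norm_neg_sub_one]
    · exact far q h h'

theorem norm_tweak_sub_one_of_near (hη : 0 < η) (hη1 : η < 1) {q : ℂ}
    (hq : q ∈ twoDiscExterior (1 / 2)) (h : ‖q - 1‖ ≤ (1 + η) / 2) :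
    ‖tweak η g q - 1‖ = annulusRadius η ‖q - 1‖ := by
  rw [tweak_of_near hη hη1 h, add_sub_cancel_left, norm_annulusTwist hη hη1 hq.1]

theorem norm_tweak_sub_one_lt_iff (hη : 0 < η) (hη1 : η < 1) {q : ℂ}
    (hq : q ∈ twoDiscExterior (1 / 2)) :
    ‖tweak η g q - 1‖ < (1 + η) / 2 ↔ ‖q - 1‖ < (1 + η) / 2 := by
  have near : ∀ q ∈ twoDiscExterior (1 / 2), ‖q - 1‖ < (1 + η) / 2 →
      ‖tweak η g q - 1‖ < (1 + η) / 2 := by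
    intro q hq h
    rw [norm_tweak_sub_one_of_near hη hη1 hq h.le]
    have := annulusRadius_strictMono hη hη1 h
    rwa [annulusRadius_of_ge le_rfl] at this
  refine ⟨fun h => ?_, near q hq⟩
  by_contra! h1
  rcases lt_or_ge ‖q + 1‖ ((1 + η) / 2) with h' | h'
  · have h2 := near (-q) (neg_mem_twoDiscExterior.2 hq) (by rwa [norm_neg_sub_one])
    rw [tweak_neg, norm_neg_sub_one] at h2
    have := two_sub_le_norm_add_one (tweak η g q)
    linarith
  · rw [tweak_of_far hη h1 h'] at h
    linarith

theorem tweak_mem (hη : 0 < η) (hη1 : η < 1) {q : ℂ} (hq : q ∈ twoDiscExterior (1 / 2)) :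
    tweak η g q ∈ twoDiscExterior η := by
  revert hq
  refine twoDisc_cases (P := fun q => q ∈ twoDiscExterior (1 / 2) → tweak η g q ∈ twoDiscExterior η)
    ?_ η ?_ ?_ q
  · intro q h hq
    have := h (neg_mem_twoDiscExterior.2 hq)
    rwa [tweak_neg, neg_mem_twoDiscExterior] at this
  · intro q h hq
    have h1 := (norm_tweak_sub_one_lt_iff (g := g) hη hη1 hq).2 h
    have h2 := two_sub_le_norm_add_one (tweak η g q)
    have h3 := le_annulusRadius hη hη1 hq.1
    rw [← norm_tweak_sub_one_of_near (g := g) hη hη1 hq h.le] at h3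
    exact ⟨h3, by linarith⟩
  · intro q h h' hq
    rw [tweak_of_far hη h h']
    exact ⟨by linarith, by linarith⟩

theorem tweak_injective (hη : 0 < η) (hη1 : η < 1) {q q' : ℂ}
    (hq : q ∈ twoDiscExterior (1 / 2)) (hq' : q' ∈ twoDiscExterior (1 / 2))
    (h : tweak η g q = tweak η g q') : q = q' := by
  have near : ∀ q ∈ twoDiscExterior (1 / 2), ∀ q' ∈ twoDiscExterior (1 / 2),
      tweak η g q = tweak η g q' → ‖q - 1‖ < (1 + η) / 2 → q = q' := by
    intro q hq q' hq' h h1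
    have h2 := (norm_tweak_sub_one_lt_iff (g := g) hη hη1 hq).2 h1
    rw [h, norm_tweak_sub_one_lt_iff hη hη1 hq'] at h2
    rw [tweak_of_near hη hη1 h1.le, tweak_of_near hη hη1 h2.le] at h
    have := annulusTwist_injective hη hη1 hq.1 hq'.1 (add_left_cancel h)
    exact sub_left_injective this
  rcases lt_or_ge ‖q - 1‖ ((1 + η) / 2) with h1 | h1
  · exact near q hq q' hq' h h1
  rcases lt_or_ge ‖q + 1‖ ((1 + η) / 2) with h2 | h2
  · refine neg_injective (near _ (neg_mem_twoDiscExterior.2 hq) _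
      (neg_mem_twoDiscExterior.2 hq') ?_ (by rwa [norm_neg_sub_one]))
    rw [tweak_neg, tweak_neg, h]
  rcases lt_or_ge ‖q' - 1‖ ((1 + η) / 2) with h3 | h3
  · exact (near q' hq' q hq h.symm h3).symm
  rcases lt_or_ge ‖q' + 1‖ ((1 + η) / 2) with h4 | h4
  · refine (neg_injective (near _ (neg_mem_twoDiscExterior.2 hq') _
      (neg_mem_twoDiscExterior.2 hq) ?_ (by rwa [norm_neg_sub_one]))).symm
    rw [tweak_neg, tweak_neg, h]
  rwa [tweak_of_far hη h1 h2, tweak_of_far hη h3 h4] at h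

theorem exists_tweak_eq (hη : 0 < η) (hη1 : η < 1) {q' : ℂ} (hq' : q' ∈ twoDiscExterior η) :
    ∃ q ∈ twoDiscExterior (1 / 2), tweak η g q = q' := by
  revert hq'
  refine twoDisc_cases (P := fun q' => q' ∈ twoDiscExterior η →
    ∃ q ∈ twoDiscExterior (1 / 2), tweak η g q = q') ?_ η ?_ ?_ q'
  · intro q' h hq'
    obtain ⟨q, hq, h1⟩ := h (neg_mem_twoDiscExterior.2 hq')
    exact ⟨-q, neg_mem_twoDiscExterior.2 hq, by rw [tweak_neg, h1, neg_neg]⟩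
  · intro q' h hq'
    obtain ⟨d, hd, hde⟩ := exists_annulusTwist_eq (g := g) hη hη1 hq'.1
    have hd' : ‖d‖ ≤ (1 + η) / 2 := by
      by_contra! hlt
      rw [annulusTwist_of_ge hη hlt.le] at hde
      rw [hde] at hlt
      linarith
    have e : d + 1 - 1 = d := by ring
    have h2 := two_sub_le_norm_add_one (d + 1)
    rw [e] at h2
    refine ⟨d + 1, ⟨by rw [e]; exact hd, by linarith⟩, ?_⟩
    rw [tweak_of_near hη hη1 (by rw [e]; exact hd'), e, hde]
    ring
  · intro q' h h' hq'
    exact ⟨q', ⟨by linarith, by linarith⟩, tweak_of_far hη h h'⟩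

theorem norm_sub_one_ge (q : ℂ) : ‖q‖ - 1 ≤ ‖q - 1‖ ∧ ‖q‖ - 1 ≤ ‖q + 1‖ := by
  constructor
  · have := norm_sub_norm_le q 1
    simpa using this
  · have := norm_sub_norm_le q (-1)
    simpa using this

theorem tweak_of_two_le (hη : 0 < η) (hη1 : η < 1) {q : ℂ} (h : 2 ≤ ‖q‖) : tweak η g q = q := by
  obtain ⟨h1, h2⟩ := norm_sub_one_ge q
  exact tweak_of_far hη (by linarith) (by linarith)

theorem norm_tweak_le_two (hη : 0 < η) (hη1 : η < 1) {q : ℂ}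
    (hq : q ∈ twoDiscExterior (1 / 2)) (h2 : ‖q‖ ≤ 2) : ‖tweak η g q‖ ≤ 2 := by
  revert hq h2
  refine twoDisc_cases (P := fun q => q ∈ twoDiscExterior (1 / 2) → ‖q‖ ≤ 2 → ‖tweak η g q‖ ≤ 2)
    ?_ η ?_ ?_ q
  · intro q h hq h2
    have := h (neg_mem_twoDiscExterior.2 hq) (by rwa [norm_neg])
    rwa [tweak_neg, norm_neg] at this
  · intro q h hq _
    have h1 := (norm_tweak_sub_one_lt_iff (g := g) hη hη1 hq).2 h
    have := (norm_sub_one_ge (tweak η g q)).1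
    linarith
  · intro q h h' _ h2
    rwa [tweak_of_far hη h h']

theorem tweak_sub_one_of_norm_eq (hη : 0 < η) (hη1 : η < 1) {q : ℂ} (h : ‖q - 1‖ = 1 / 2) :
    tweak η g q - 1 = 2 * η * (q - 1) * (Circle.exp g)⁻¹ := by
  rw [tweak_of_near hη hη1 (by rw [h]; linarith), add_sub_cancel_left,
    annulusTwist_of_norm_eq hη h]

/-- Without rotation, `tweak` preserves the segment `[-1, 1]` minus the discs about its ends. -/
theorem tweak_mem_segment_iff (hη : 0 < η) (hη1 : η < 1) {q : ℂ}
    (hq : q ∈ twoDiscExterior (1 / 2)) :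
    (∃ t : ℝ, |t| ≤ 1 ∧ tweak η 0 q = t) ↔ ∃ t : ℝ, |t| ≤ 1 ∧ q = t := by
  revert hq
  refine twoDisc_cases (P := fun q => q ∈ twoDiscExterior (1 / 2) →
    ((∃ t : ℝ, |t| ≤ 1 ∧ tweak η 0 q = t) ↔ ∃ t : ℝ, |t| ≤ 1 ∧ q = t)) ?_ η ?_ ?_ q
  · intro q h hq
    have h1 := h (neg_mem_twoDiscExterior.2 hq)
    rw [tweak_neg] at h1
    have key : ∀ x : ℂ, (∃ t : ℝ, |t| ≤ 1 ∧ -x = t) ↔ ∃ t : ℝ, |t| ≤ 1 ∧ x = t := by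
      intro x
      constructor
      · rintro ⟨t, ht, h⟩
        exact ⟨-t, by rwa [abs_neg], by rw [Complex.ofReal_neg, ← h, neg_neg]⟩
      · rintro ⟨t, ht, h⟩
        exact ⟨-t, by rwa [abs_neg], by rw [Complex.ofReal_neg, ← h]⟩
    rwa [key, key] at h1
  · intro q h hq
    have h0 : 0 < ‖q - 1‖ := by linarith [hq.1]
    have hN := le_annulusRadius hη hη1 hq.1
    set k : ℝ := annulusRadius η ‖q - 1‖ / ‖q - 1‖ with hk
    have hk0 : 0 < k := div_pos (by linarith) h0
    have e : tweak η 0 q = 1 + (q - 1) * k := by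
      rw [tweak_of_near hη hη1 h.le, annulusTwist, ← hk]
      simp
    have h1 := (norm_tweak_sub_one_lt_iff (g := 0) hη hη1 hq).2 h
    constructor
    · rintro ⟨t, ht, hte⟩
      have e2 : q = ((1 + (t - 1) / k : ℝ) : ℂ) := by
        have hk' : (k : ℂ) ≠ 0 := by exact_mod_cast hk0.ne'
        rw [hte] at e
        push_cast
        rw [e]
        field_simp
        ring
      refine ⟨1 + (t - 1) / k, ?_, e2⟩
      have h3 : ‖q - 1‖ = |(t - 1) / k| := by
        rw [e2, ← Real.norm_eq_abs, ← Complex.norm_real]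
        congr 1
        push_cast
        ring
      have h4 : (t - 1) / k ≤ 0 :=
        div_nonpos_of_nonpos_of_nonneg (by linarith [(abs_le.1 ht).2]) hk0.le
      rw [abs_of_nonpos h4] at h3
      rw [abs_le]
      constructor <;> linarith
    · rintro ⟨t, ht, hte⟩
      have e2 : tweak η 0 q = ((1 + (t - 1) * k : ℝ) : ℂ) := by
        rw [e, hte]
        push_cast
        ring
      refine ⟨1 + (t - 1) * k, ?_, e2⟩
      have h3 : ‖tweak η 0 q - 1‖ = |(t - 1) * k| := by
        rw [e2, ← Real.norm_eq_abs, ← Complex.norm_real]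
        congr 1
        push_cast
        ring
      have h4 : (t - 1) * k ≤ 0 :=
        mul_nonpos_of_nonpos_of_nonneg (by linarith [(abs_le.1 ht).2]) hk0.le
      rw [abs_of_nonpos h4] at h3
      rw [abs_le]
      constructor <;> linarith
  · intro q h h' _
    rw [tweak_of_far hη h h']

end tweak

theorem continuous_annulusTwist_comp {Y : Type*} [TopologicalSpace Y] {η g : Y → ℝ} {d : Y → ℂ}
    (hη : Continuous η) (hg : Continuous g) (hd : Continuous d) (hη0 : ∀ y, 0 < η y)
    (hd0 : ∀ y, d y ≠ 0) : Continuous fun y => annulusTwist (η y) (g y) (d y) := by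
  have h1 : ∀ y, η y ≠ 0 := fun y => (hη0 y).ne'
  have h2 : ∀ y, ‖d y‖ ≠ 0 := fun y => norm_ne_zero_iff.2 (hd0 y)
  have h3 : ∀ y, η y / 2 ≠ 0 := fun y => by linarith [hη0 y]
  have hr : Continuous fun y => annulusRadius (η y) ‖d y‖ / ‖d y‖ := by
    unfold annulusRadius
    fun_prop (disch := assumption)
  have he : Continuous fun y =>
      Circle.exp (-g y * (max ((1 + η y) / 2 - ‖d y‖) 0 / (η y / 2))) := by
    refine Circle.exp.continuous.comp ?_
    fun_prop (disch := assumption)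
  unfold annulusTwist
  exact (hd.mul (Complex.continuous_ofReal.comp hr)).mul (continuous_subtype_val.comp he)

theorem continuous_tweak_comp {Y : Type*} [TopologicalSpace Y] {η g : Y → ℝ} {q : Y → ℂ}
    (hη : Continuous η) (hg : Continuous g) (hq : Continuous q) (hη0 : ∀ y, 0 < η y)
    (hq0 : ∀ y, q y ∈ twoDiscExterior (1 / 2)) :
    Continuous fun y => tweak (η y) (g y) (q y) := by
  have h1 := continuous_annulusTwist_comp hη hg (hq.sub continuous_const) hη0
    (d := fun y => q y - 1)
    fun y h => by have := (hq0 y).1; rw [h, norm_zero] at this; norm_num at this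
  have h2 := continuous_annulusTwist_comp hη hg (hq.neg.sub continuous_const) hη0
    (d := fun y => -q y - 1) fun y h => by
      have := (hq0 y).2
      rw [← norm_neg_sub_one, h, norm_zero] at this
      norm_num at this
  unfold tweak
  fun_prop

/-! ### The two strands in a slice -/

/-- The imaginary unit as an element of the circle. -/
noncomputable def circleI : Circle := Circle.exp (Real.pi / 2)

theorem coe_circleI : (circleI : ℂ) = Complex.I := by
  rw [circleI, Circle.coe_exp]
  push_cast
  exact Complex.exp_pi_div_two_mul_I

/-- The direction from the strand `-s` to the strand `s` in the braid `s ↦ i s₀ s⁻¹`, to which all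
the others are deformed. -/
noncomputable def frame (s₀ s : Circle) : Circle := circleI * s₀ * s⁻¹

theorem frame_neg (s₀ s : Circle) : frame s₀ (-s) = -frame s₀ s := by
  rw [frame, frame, inv_neg, mul_neg]

theorem frame_self (s₀ : Circle) : frame s₀ s₀ = circleI := by
  rw [frame, mul_inv_cancel_right]

theorem continuous_frame (s₀ : Circle) : Continuous (frame s₀) := by
  unfold frame
  fun_prop

section slice
variable (c : Circle → ℂ) (s₀ : Circle) (r : ℝ)

/-- The vector from the strand `-s` to the strand `s`. -/
noncomputable def gap (s : Circle) : ℂ := c s - c (-s)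

/-- The midpoint of the two strands. -/
noncomputable def mid (s : Circle) : ℂ := (c s + c (-s)) / 2

/-- The scaling factor that makes the distance of the two strands equal to `4`. -/
noncomputable def scale (s : Circle) : ℝ := 4 / ‖gap c s‖

/-- The radius of the tube relative to half the distance of the strands. -/
noncomputable def relRadius (s : Circle) : ℝ := 2 * r / ‖gap c s‖

/-- The angle from the direction `frame s₀ s` to the direction of the vector between the strands. It
is continuous in `s` by `gap_div_frame_mem_slitPlane`. -/
noncomputable def twistAngle (s : Circle) : ℝ := (gap c s / frame s₀ s).arg

theorem gap_neg (s : Circle) : gap c (-s) = -gap c s := by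
  rw [gap, gap, neg_neg, neg_sub]

theorem mid_neg (s : Circle) : mid c (-s) = mid c s := by
  rw [mid, mid, neg_neg, add_comm]

theorem scale_neg (s : Circle) : scale c (-s) = scale c s := by
  rw [scale, scale, gap_neg, norm_neg]

theorem relRadius_neg (s : Circle) : relRadius c r (-s) = relRadius c r s := by
  rw [relRadius, relRadius, gap_neg, norm_neg]

theorem twistAngle_neg (s : Circle) : twistAngle c s₀ (-s) = twistAngle c s₀ s := by
  rw [twistAngle, twistAngle, gap_neg, frame_neg, Circle.coe_neg, neg_div_neg_eq]

/-- Half the width of the bounding box of the two discs of radius `r` about the strands. -/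
noncomputable def boxWidth (s : Circle) : ℝ := |(gap c s).re| / 2 + r

/-- Half the height of the bounding box of the two discs of radius `r` about the strands. -/
noncomputable def boxHeight (s : Circle) : ℝ := |(gap c s).im| / 2 + r

/-- The homeomorphism from the rectangle `[-8 π, 8 π] × [-8, 8]` onto the slice `[-π, π] × [-1, 1]`,
acting on each coordinate separately. Near the strands it is a similarity, and the strands are
the images of two opposite points of norm `2`. -/
noncomputable def boxMap (s : Circle) (a : ℂ) : ℂ :=
  ⟨interp Real.pi (mid c s).re (boxWidth c r s) (scale c s) a.re,
    interp 1 (mid c s).im (boxHeight c r s) (scale c s) a.im⟩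

/-- The homeomorphism from the exterior of the discs of radius `1 / 2` about `±1` to the exterior
of the tubes in the slice of `s`. It composes the change of the radius of the tubes, the rotation of
`frame s₀ s` to the direction of `gap c s`, and the map of rectangles. The inner boundaries are
counter-rotated by `tweak`, so that the boundaries of the tubes keep their angular coordinate. -/
noncomputable def position (s : Circle) (q : ℂ) : ℂ :=
  boxMap c r s (spin (twistAngle c s₀ s)
    (2 * frame s₀ s * tweak (relRadius c r s) (twistAngle c s₀ s) q))

end slice

section braid
variable {c : Circle → ℂ} {s₀ : Circle} {r : ℝ}

theorem position_neg (s : Circle) (q : ℂ) : position c s₀ r (-s) (-q) = position c s₀ r s q := by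
  rw [position, position, twistAngle_neg, relRadius_neg, tweak_neg, frame_neg, Circle.coe_neg,
    mul_neg, mul_neg, neg_mul, neg_neg, boxMap, boxMap, mid_neg, scale_neg, boxWidth, boxWidth,
    boxHeight, boxHeight, gap_neg, Complex.neg_re, Complex.neg_im, abs_neg, abs_neg]

theorem scale_mul_radius (s : Circle) : scale c s * r = 2 * relRadius c r s := by
  rw [scale, relRadius]; ring

theorem position_of_norm_tweak_le (s : Circle) {q : ℂ}
    (h : ‖tweak (relRadius c r s) (twistAngle c s₀ s) q‖ ≤ 2) :
    position c s₀ r s q = boxMap c r s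
      (2 * frame s₀ s * Circle.exp (twistAngle c s₀ s) *
        tweak (relRadius c r s) (twistAngle c s₀ s) q) := by
  rw [position, spin_of_le]
  · congr 1; ring
  · rw [norm_mul, norm_mul, Circle.norm_coe]
    norm_num
    linarith

theorem norm_two_frame_mul (s : Circle) (q : ℂ) : ‖2 * (frame s₀ s : ℂ) * q‖ = 2 * ‖q‖ := by
  rw [norm_mul, norm_mul, Circle.norm_coe]
  norm_num

theorem abs_le_of_norm_lt {a : ℂ} (h : ‖a‖ < 6) : |a.re| ≤ 8 * Real.pi ∧ |a.im| ≤ 8 := by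
  have h1 := Complex.abs_re_le_norm a
  have h2 := Complex.abs_im_le_norm a
  have h3 := one_lt_pi
  constructor <;> linarith

section radius
variable (hr : IsTubeRadius c r)
include hr

theorem two_mul_lt_norm_gap (s : Circle) : 2 * r < ‖gap c s‖ := hr.disjoint s

theorem norm_gap_pos (s : Circle) : 0 < ‖gap c s‖ := by
  linarith [two_mul_lt_norm_gap hr s, hr.pos]

theorem scale_pos (s : Circle) : 0 < scale c s := div_pos (by norm_num) (norm_gap_pos hr s)

theorem relRadius_pos (s : Circle) : 0 < relRadius c r s :=
  div_pos (by linarith [hr.pos]) (norm_gap_pos hr s)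

theorem relRadius_lt_one (s : Circle) : relRadius c r s < 1 :=
  (div_lt_one (norm_gap_pos hr s)).2 (two_mul_lt_norm_gap hr s)

theorem scale_mul_norm_gap (s : Circle) : scale c s * ‖gap c s‖ = 4 :=
  div_mul_cancel₀ _ (norm_gap_pos hr s).ne'

theorem boxWidth_nonneg (s : Circle) : 0 ≤ boxWidth c r s := by
  have := hr.pos
  unfold boxWidth
  positivity

theorem boxHeight_nonneg (s : Circle) : 0 ≤ boxHeight c r s := by
  have := hr.pos
  unfold boxHeight
  positivity

theorem scale_mul_boxHeight_lt (s : Circle) : scale c s * boxHeight c r s < 8 * 1 := by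
  have h1 := scale_mul_norm_gap hr s
  have h2 := scale_mul_radius (c := c) (r := r) s
  have h3 := relRadius_lt_one hr s
  have h4 := Complex.abs_im_le_norm (gap c s)
  have h5 := scale_pos hr s
  rw [boxHeight, mul_add, h2]
  nlinarith

theorem scale_mul_boxWidth_lt (s : Circle) : scale c s * boxWidth c r s < 8 * Real.pi := by
  have h1 := scale_mul_norm_gap hr s
  have h2 := scale_mul_radius (c := c) (r := r) s
  have h3 := relRadius_lt_one hr s
  have h4 := Complex.abs_re_le_norm (gap c s)
  have h5 := scale_pos hr s
  have h6 := one_lt_pi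
  rw [boxWidth, mul_add, h2]
  nlinarith

theorem abs_mid_add_boxWidth_lt (s : Circle) : |(mid c s).re| + boxWidth c r s < Real.pi := by
  have h1 := hr.re_add_lt s
  have h2 := hr.re_add_lt (-s)
  have e : (mid c s).re = ((c s).re + (c (-s)).re) / 2 := by
    rw [mid, show (2 : ℂ) = ((2 : ℝ) : ℂ) by norm_num, Complex.div_ofReal_re, Complex.add_re]
  rw [boxWidth, e, gap, Complex.sub_re]
  rw [← lt_sub_iff_add_lt, abs_lt] at h1 h2
  rcases abs_cases (((c s).re + (c (-s)).re) / 2) with ⟨h, -⟩ | ⟨h, -⟩ <;>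
    rcases abs_cases ((c s).re - (c (-s)).re) with ⟨h', -⟩ | ⟨h', -⟩ <;> rw [h, h'] <;> linarith

theorem abs_mid_add_boxHeight_lt (s : Circle) : |(mid c s).im| + boxHeight c r s < 1 := by
  have h1 := hr.im_add_lt s
  have h2 := hr.im_add_lt (-s)
  have e : (mid c s).im = ((c s).im + (c (-s)).im) / 2 := by
    rw [mid, show (2 : ℂ) = ((2 : ℝ) : ℂ) by norm_num, Complex.div_ofReal_im, Complex.add_im]
  rw [boxHeight, e, gap, Complex.sub_im]
  rw [← lt_sub_iff_add_lt, abs_lt] at h1 h2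
  rcases abs_cases (((c s).im + (c (-s)).im) / 2) with ⟨h, -⟩ | ⟨h, -⟩ <;>
    rcases abs_cases ((c s).im - (c (-s)).im) with ⟨h', -⟩ | ⟨h', -⟩ <;> rw [h, h'] <;> linarith

theorem boxMap_re_strictMono (s : Circle) :
    StrictMono (interp Real.pi (mid c s).re (boxWidth c r s) (scale c s)) :=
  interp_strictMono (scale_pos hr s) (boxWidth_nonneg hr s) (abs_mid_add_boxWidth_lt hr s)
    (scale_mul_boxWidth_lt hr s)

theorem boxMap_im_strictMono (s : Circle) :
    StrictMono (interp 1 (mid c s).im (boxHeight c r s) (scale c s)) :=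
  interp_strictMono (scale_pos hr s) (boxHeight_nonneg hr s) (abs_mid_add_boxHeight_lt hr s)
    (scale_mul_boxHeight_lt hr s)

theorem boxMap_injective (s : Circle) : Function.Injective (boxMap c r s) := by
  intro a b h
  exact Complex.ext ((boxMap_re_strictMono hr s).injective (congrArg Complex.re h))
    ((boxMap_im_strictMono hr s).injective (congrArg Complex.im h))

theorem abs_boxMap_re_le_iff (s : Circle) (a : ℂ) :
    |(boxMap c r s a).re| ≤ Real.pi ↔ |a.re| ≤ 8 * Real.pi :=
  abs_interp_le_iff (scale_pos hr s) (boxWidth_nonneg hr s) (abs_mid_add_boxWidth_lt hr s)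
    (scale_mul_boxWidth_lt hr s)

theorem abs_boxMap_im_le_iff (s : Circle) (a : ℂ) :
    |(boxMap c r s a).im| ≤ 1 ↔ |a.im| ≤ 8 := by
  have := abs_interp_le_iff (scale_pos hr s) (boxHeight_nonneg hr s)
    (abs_mid_add_boxHeight_lt hr s) (scale_mul_boxHeight_lt hr s) (x := a.im)
  rw [mul_one] at this
  exact this

theorem boxMap_re_eq_pi_iff (s : Circle) (a : ℂ) :
    (boxMap c r s a).re = Real.pi ↔ a.re = 8 * Real.pi := by
  have h := interp_right (m := (mid c s).re) (scale_pos hr s) (boxWidth_nonneg hr s)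
    (scale_mul_boxWidth_lt hr s)
  have hs := boxMap_re_strictMono hr s
  constructor
  · intro h'
    exact hs.injective (h'.trans h.symm)
  · intro h'
    rw [boxMap, h', h]

theorem boxMap_re_eq_neg_pi_iff (s : Circle) (a : ℂ) :
    (boxMap c r s a).re = -Real.pi ↔ a.re = -(8 * Real.pi) := by
  have h := interp_left (m := (mid c s).re) (scale_pos hr s) (boxWidth_nonneg hr s)
    (scale_mul_boxWidth_lt hr s)
  have hs := boxMap_re_strictMono hr s
  constructor
  · intro h'
    exact hs.injective (h'.trans h.symm)
  · intro h'
    rw [boxMap, h', h]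

theorem boxMap_im_eq_iff (s : Circle) (a b : ℂ) :
    (boxMap c r s a).im = (boxMap c r s b).im ↔ a.im = b.im :=
  (boxMap_im_strictMono hr s).injective.eq_iff

theorem exists_boxMap_eq (s : Circle) {x : ℂ} (h1 : |x.re| ≤ Real.pi) (h2 : |x.im| ≤ 1) :
    ∃ a, boxMap c r s a = x := by
  obtain ⟨u, hu⟩ := exists_interp_eq (m := (mid c s).re) (scale_pos hr s) (boxWidth_nonneg hr s)
    (scale_mul_boxWidth_lt hr s) h1
  obtain ⟨v, hv⟩ := exists_interp_eq (m := (mid c s).im) (scale_pos hr s) (boxHeight_nonneg hr s)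
    (scale_mul_boxHeight_lt hr s) h2
  exact ⟨⟨u, v⟩, Complex.ext hu hv⟩

/-- On the bounding box of the two discs, `boxMap` is a similarity. -/
theorem boxMap_scale_mul (s : Circle) {y : ℂ} (h1 : |y.re| ≤ boxWidth c r s)
    (h2 : |y.im| ≤ boxHeight c r s) : boxMap c r s (scale c s * y) = mid c s + y := by
  have hs := scale_pos hr s
  apply Complex.ext
  · rw [boxMap, Complex.re_ofReal_mul, Complex.add_re]
    simp only
    rw [interp_of_abs_le, mul_div_cancel_left₀ _ hs.ne']
    rw [abs_mul, abs_of_pos hs]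
    gcongr
  · rw [boxMap, Complex.im_ofReal_mul, Complex.add_im]
    simp only
    rw [interp_of_abs_le, mul_div_cancel_left₀ _ hs.ne']
    rw [abs_mul, abs_of_pos hs]
    gcongr

theorem boxMap_disc (s : Circle) {z : ℂ} (hz : ‖z‖ ≤ 1) :
    boxMap c r s (scale c s * (gap c s / 2 + r * z)) = c s + r * z := by
  have hr0 := hr.pos
  have e1 : (gap c s / 2).re = (gap c s).re / 2 := by
    rw [show (2 : ℂ) = ((2 : ℝ) : ℂ) by norm_num, Complex.div_ofReal_re]
  have e2 : (gap c s / 2).im = (gap c s).im / 2 := by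
    rw [show (2 : ℂ) = ((2 : ℝ) : ℂ) by norm_num, Complex.div_ofReal_im]
  rw [boxMap_scale_mul hr s]
  · rw [mid, gap]; ring
  · rw [Complex.add_re, e1, Complex.re_ofReal_mul, boxWidth]
    refine (abs_add_le _ _).trans (add_le_add ?_ ?_)
    · rw [abs_div, abs_two]
    · rw [abs_mul, abs_of_pos hr0]
      exact mul_le_of_le_one_right hr0.le ((Complex.abs_re_le_norm z).trans hz)
  · rw [Complex.add_im, e2, Complex.im_ofReal_mul, boxHeight]
    refine (abs_add_le _ _).trans (add_le_add ?_ ?_)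
    · rw [abs_div, abs_two]
    · rw [abs_mul, abs_of_pos hr0]
      exact mul_le_of_le_one_right hr0.le ((Complex.abs_im_le_norm z).trans hz)

theorem boxMap_segment (s : Circle) {t : ℝ} (ht : |t| ≤ 1) :
    boxMap c r s (scale c s * (t * (gap c s / 2))) = mid c s + t * (gap c s / 2) := by
  have hr0 := hr.pos
  have e1 : (gap c s / 2).re = (gap c s).re / 2 := by
    rw [show (2 : ℂ) = ((2 : ℝ) : ℂ) by norm_num, Complex.div_ofReal_re]
  have e2 : (gap c s / 2).im = (gap c s).im / 2 := by
    rw [show (2 : ℂ) = ((2 : ℝ) : ℂ) by norm_num, Complex.div_ofReal_im]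
  rw [boxMap_scale_mul hr s]
  · rw [Complex.re_ofReal_mul, e1, abs_mul, boxWidth, abs_div, abs_two]
    nlinarith [abs_nonneg (gap c s).re]
  · rw [Complex.im_ofReal_mul, e2, abs_mul, boxHeight, abs_div, abs_two]
    nlinarith [abs_nonneg (gap c s).im]

/-- Half the scaled vector between the strands has length `2` and the angle `twistAngle` with the
frame. -/
theorem scale_mul_gap (s : Circle) :
    (scale c s : ℂ) * (gap c s / 2) = 2 * frame s₀ s * Circle.exp (twistAngle c s₀ s) := by
  have h1 : (frame s₀ s : ℂ) ≠ 0 := Circle.coe_ne_zero _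
  have h2 := norm_mul_dir (gap c s / frame s₀ s)
  rw [dir, norm_div, Circle.norm_coe, div_one, eq_div_iff h1] at h2
  rw [twistAngle]
  have h3 : (scale c s : ℂ) * (‖gap c s‖ : ℂ) = 4 := by
    rw [← Complex.ofReal_mul, scale_mul_norm_gap hr s]; norm_num
  nth_rw 1 [← h2]
  linear_combination (Circle.exp (gap c s / frame s₀ s).arg * frame s₀ s / 2 : ℂ) * h3

/-- The tubes correspond to the discs about `±1`. -/
theorem position_eq_disc_iff (s : Circle) {q z : ℂ} (hz : ‖z‖ ≤ 1) :
    position c s₀ r s q = c s + r * z ↔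
      tweak (relRadius c r s) (twistAngle c s₀ s) q =
        1 + relRadius c r s * z / (frame s₀ s * Circle.exp (twistAngle c s₀ s)) := by
  have h1 : (frame s₀ s : ℂ) ≠ 0 := Circle.coe_ne_zero _
  have h2 : (Circle.exp (twistAngle c s₀ s) : ℂ) ≠ 0 := Circle.coe_ne_zero _
  have h3 : (scale c s : ℂ) * r = 2 * relRadius c r s := by
    exact_mod_cast scale_mul_radius s
  have hη := relRadius_pos hr s
  have hη1 := relRadius_lt_one hr s
  set T := tweak (relRadius c r s) (twistAngle c s₀ s) q with hT
  have key : 2 * (frame s₀ s : ℂ) * Circle.exp (twistAngle c s₀ s) *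
      (1 + relRadius c r s * z / (frame s₀ s * Circle.exp (twistAngle c s₀ s))) =
      scale c s * (gap c s / 2 + r * z) := by
    rw [show (scale c s : ℂ) * (gap c s / 2 + r * z) =
      scale c s * (gap c s / 2) + scale c s * r * z by ring, scale_mul_gap (s₀ := s₀) hr s, h3]
    field_simp
  have hsmall :
      ‖(relRadius c r s : ℂ) * z / (frame s₀ s * Circle.exp (twistAngle c s₀ s))‖ ≤ 1 := by
    rw [norm_div, norm_mul, norm_mul, Circle.norm_coe, Circle.norm_coe, Complex.norm_real,
      Real.norm_eq_abs, abs_of_pos hη]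
    nlinarith [norm_nonneg z]
  constructor
  · intro h
    rw [← boxMap_disc hr s hz, position] at h
    have h4 := boxMap_injective hr s h
    have h5 : ‖T‖ ≤ 2 := by
      have h6 := congrArg norm h4
      rw [norm_spin, ← key, norm_mul, norm_mul, norm_mul _ (1 + _), norm_mul, norm_mul,
        Circle.norm_coe, Circle.norm_coe] at h6
      have h7 := norm_add_le (1 : ℂ)
        ((relRadius c r s : ℂ) * z / (frame s₀ s * Circle.exp (twistAngle c s₀ s)))
      rw [norm_one] at h7
      have h8 : ‖(2 : ℂ)‖ = 2 := by norm_num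
      rw [h8] at h6
      linarith
    rw [spin_of_le] at h4
    · rw [← key] at h4
      have h9 : 2 * (frame s₀ s : ℂ) * Circle.exp (twistAngle c s₀ s) ≠ 0 :=
        mul_ne_zero (mul_ne_zero two_ne_zero h1) h2
      refine mul_left_cancel₀ h9 (Eq.trans ?_ h4)
      ring
    · rw [norm_mul, norm_mul, Circle.norm_coe]
      norm_num
      linarith
  · intro h
    have h5 : ‖T‖ ≤ 2 := by
      rw [h]
      refine (norm_add_le _ _).trans ?_
      rw [norm_one]
      linarith
    rw [position_of_norm_tweak_le s h5, ← boxMap_disc hr s hz, ← key, ← h]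

/-- The points of `twoDiscExterior` are mapped to the exterior of the tubes. -/
theorem one_le_norm_of_position_eq (s : Circle) {q z : ℂ} (hq : q ∈ twoDiscExterior (1 / 2))
    (h : position c s₀ r s q = c s + r * z) : 1 ≤ ‖z‖ := by
  by_contra! hlt
  have h1 := (position_eq_disc_iff hr s hlt.le).1 h
  have hη := relRadius_pos hr s
  have h2 := (tweak_mem (g := twistAngle c s₀ s) hη (relRadius_lt_one hr s) hq).1
  rw [h1, add_sub_cancel_left, norm_div, norm_mul, norm_mul, Circle.norm_coe, Circle.norm_coe,
    Complex.norm_real, Real.norm_eq_abs, abs_of_pos hη, mul_one, div_one] at h2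
  nlinarith

/-- The boundary of the tube about the strand `s`, with its parametrisation. The right hand side no
longer depends on the braid. -/
theorem position_eq_boundary_iff (s : Circle) {q : ℂ} (hq : q ∈ twoDiscExterior (1 / 2))
    (z : Circle) : position c s₀ r s q = c s + r * z ↔ q = 1 + z / (2 * frame s₀ s) := by
  have h1 : (frame s₀ s : ℂ) ≠ 0 := Circle.coe_ne_zero _
  have h2 : (Circle.exp (twistAngle c s₀ s) : ℂ) ≠ 0 := Circle.coe_ne_zero _
  have hη := relRadius_pos hr s
  have hη1 := relRadius_lt_one hr s
  have hn : ‖(1 + z / (2 * frame s₀ s) : ℂ) - 1‖ = 1 / 2 := by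
    rw [add_sub_cancel_left, norm_div, norm_mul, Circle.norm_coe, Circle.norm_coe]
    norm_num
  have hmem : (1 + z / (2 * frame s₀ s) : ℂ) ∈ twoDiscExterior (1 / 2) := by
    have := two_sub_le_norm_add_one (1 + z / (2 * frame s₀ s) : ℂ)
    exact ⟨hn.ge, by linarith⟩
  have h3 := tweak_sub_one_of_norm_eq (g := twistAngle c s₀ s) hη hη1 hn
  have h4 : tweak (relRadius c r s) (twistAngle c s₀ s) (1 + z / (2 * frame s₀ s)) =
      1 + relRadius c r s * z / (frame s₀ s * Circle.exp (twistAngle c s₀ s)) := by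
    rw [sub_eq_iff_eq_add] at h3
    rw [h3, Circle.coe_inv]
    field_simp
    ring
  rw [position_eq_disc_iff hr s (Circle.norm_coe z).le, ← h4]
  constructor
  · exact tweak_injective hη hη1 hq hmem
  · rintro rfl; rfl

/-- Outside a disc, `spin` and `tweak` do nothing. -/
theorem position_eq_boxMap (s : Circle) {q : ℂ} (h : 3 ≤ ‖q‖) :
    position c s₀ r s q = boxMap c r s (2 * frame s₀ s * q) := by
  rw [position, tweak_of_two_le (relRadius_pos hr s) (relRadius_lt_one hr s) (by linarith),
    spin_of_ge]
  rw [norm_two_frame_mul]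
  linarith

/-- The point is in the slice if and only if it is in the model rectangle. -/
theorem position_mem_iff (s : Circle) {q : ℂ} (hq : q ∈ twoDiscExterior (1 / 2)) :
    (|(position c s₀ r s q).re| ≤ Real.pi ∧ |(position c s₀ r s q).im| ≤ 1) ↔
      |(2 * frame s₀ s * q : ℂ).re| ≤ 8 * Real.pi ∧ |(2 * frame s₀ s * q : ℂ).im| ≤ 8 := by
  rcases le_or_gt 3 ‖q‖ with h | h
  · rw [position_eq_boxMap hr s h, abs_boxMap_re_le_iff hr, abs_boxMap_im_le_iff hr]
  · refine iff_of_true ?_ (abs_le_of_norm_lt (by rw [norm_two_frame_mul]; linarith))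
    rw [position, abs_boxMap_re_le_iff hr, abs_boxMap_im_le_iff hr]
    apply abs_le_of_norm_lt
    rw [norm_spin, norm_two_frame_mul]
    rcases le_total 2 ‖q‖ with h' | h'
    · rw [tweak_of_two_le (relRadius_pos hr s) (relRadius_lt_one hr s) h']
      linarith
    · have := norm_tweak_le_two (g := twistAngle c s₀ s) (relRadius_pos hr s)
        (relRadius_lt_one hr s) hq h'
      linarith

theorem position_injective (s : Circle) {q q' : ℂ} (hq : q ∈ twoDiscExterior (1 / 2))
    (hq' : q' ∈ twoDiscExterior (1 / 2)) (h : position c s₀ r s q = position c s₀ r s q') :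
    q = q' := by
  have h1 := spin_injective _ (boxMap_injective hr s h)
  have h2 : 2 * (frame s₀ s : ℂ) ≠ 0 := mul_ne_zero two_ne_zero (Circle.coe_ne_zero _)
  exact tweak_injective (relRadius_pos hr s) (relRadius_lt_one hr s) hq hq'
    (mul_left_cancel₀ h2 h1)

theorem three_le_norm_of_position_re (s : Circle) {q : ℂ} (hq : q ∈ twoDiscExterior (1 / 2))
    (h : |(position c s₀ r s q).re| = Real.pi) : 3 ≤ ‖q‖ := by
  by_contra! hlt
  have h1 : |(spin (twistAngle c s₀ s)
      (2 * frame s₀ s * tweak (relRadius c r s) (twistAngle c s₀ s) q)).re| = 8 * Real.pi := by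
    rcases eq_or_eq_neg_of_abs_eq h with h' | h'
    · rw [position, boxMap_re_eq_pi_iff hr] at h'
      rw [h', abs_of_pos (by linarith [Real.pi_pos])]
    · rw [position, boxMap_re_eq_neg_pi_iff hr] at h'
      rw [h', abs_neg, abs_of_pos (by linarith [Real.pi_pos])]
  have h2 := Complex.abs_re_le_norm (spin (twistAngle c s₀ s)
      (2 * frame s₀ s * tweak (relRadius c r s) (twistAngle c s₀ s) q))
  rw [h1, norm_spin, norm_two_frame_mul] at h2
  have h3 := one_lt_pi
  rcases le_total 2 ‖q‖ with h' | h'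
  · rw [tweak_of_two_le (relRadius_pos hr s) (relRadius_lt_one hr s) h'] at h2
    linarith
  · have := norm_tweak_le_two (g := twistAngle c s₀ s) (relRadius_pos hr s)
      (relRadius_lt_one hr s) hq h'
    linarith

/-- The vertical sides of the slice correspond to the vertical sides of the model rectangle. -/
theorem position_seam_iff (s : Circle) {q q' : ℂ} (hq : q ∈ twoDiscExterior (1 / 2))
    (hq' : q' ∈ twoDiscExterior (1 / 2)) :
    ((position c s₀ r s q).re = Real.pi ∧ (position c s₀ r s q').re = -Real.pi ∧
      (position c s₀ r s q).im = (position c s₀ r s q').im) ↔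
    ((2 * frame s₀ s * q : ℂ).re = 8 * Real.pi ∧ (2 * frame s₀ s * q' : ℂ).re = -(8 * Real.pi) ∧
      (2 * frame s₀ s * q : ℂ).im = (2 * frame s₀ s * q' : ℂ).im) := by
  have hpi := Real.pi_pos
  have hone := one_lt_pi
  have key : 3 ≤ ‖q‖ → 3 ≤ ‖q'‖ → (((position c s₀ r s q).re = Real.pi ∧
      (position c s₀ r s q').re = -Real.pi ∧
      (position c s₀ r s q).im = (position c s₀ r s q').im) ↔
    ((2 * frame s₀ s * q : ℂ).re = 8 * Real.pi ∧ (2 * frame s₀ s * q' : ℂ).re = -(8 * Real.pi) ∧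
      (2 * frame s₀ s * q : ℂ).im = (2 * frame s₀ s * q' : ℂ).im)) := by
    intro h h'
    rw [position_eq_boxMap hr s h, position_eq_boxMap hr s h', boxMap_re_eq_pi_iff hr,
      boxMap_re_eq_neg_pi_iff hr, boxMap_im_eq_iff hr]
  constructor
  · rintro ⟨h1, h2, h3⟩
    refine (key ?_ ?_).1 ⟨h1, h2, h3⟩
    · exact three_le_norm_of_position_re hr s hq (by rw [h1, abs_of_pos hpi])
    · exact three_le_norm_of_position_re hr s hq' (by rw [h2, abs_neg, abs_of_pos hpi])
  · rintro ⟨h1, h2, h3⟩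
    have h4 := Complex.abs_re_le_norm (2 * frame s₀ s * q : ℂ)
    have h5 := Complex.abs_re_le_norm (2 * frame s₀ s * q' : ℂ)
    rw [h1, norm_two_frame_mul, abs_of_pos (by linarith)] at h4
    rw [h2, norm_two_frame_mul, abs_neg, abs_of_pos (by linarith)] at h5
    exact (key (by linarith) (by linarith)).2 ⟨h1, h2, h3⟩

theorem exists_position_eq (s : Circle) {x : ℂ} (h1 : |x.re| ≤ Real.pi) (h2 : |x.im| ≤ 1)
    (h3 : ∀ z : ℂ, ‖z‖ < 1 → x ≠ c s + r * z) (h4 : ∀ z : ℂ, ‖z‖ < 1 → x ≠ c (-s) + r * z) :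
    ∃ q ∈ twoDiscExterior (1 / 2), position c s₀ r s q = x := by
  obtain ⟨a, ha⟩ := exists_boxMap_eq hr s h1 h2
  set g := twistAngle c s₀ s with hg
  have hη := relRadius_pos hr s
  have hη1 := relRadius_lt_one hr s
  have hf : (frame s₀ s : ℂ) ≠ 0 := Circle.coe_ne_zero _
  have he : (Circle.exp g : ℂ) ≠ 0 := Circle.coe_ne_zero _
  set q' : ℂ := spin (-g) a / (2 * frame s₀ s) with hq'
  have e1 : 2 * (frame s₀ s : ℂ) * q' = spin (-g) a := by
    rw [hq']; field_simp
  have hn : 2 * ‖q'‖ = ‖a‖ := by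
    rw [← norm_two_frame_mul (s₀ := s₀) s, e1, norm_spin]
  -- Near the strands all the maps are similarities, so that discs correspond to discs.
  have near : ∀ d : ℂ, ‖q'‖ ≤ 2 → a = 2 * frame s₀ s * Circle.exp g * q' := by
    intro _ h
    have h5 : spin g (spin (-g) a) = a := spin_spin_neg g a
    rw [← e1, spin_of_le _ (by rw [norm_two_frame_mul]; linarith)] at h5
    rw [← h5]; ring
  have hgap := scale_mul_gap (s₀ := s₀) hr s
  rw [← hg] at hgap
  have hsc := scale_pos hr s
  have hr0 := hr.pos
  have hsr : scale c s * r = 2 * relRadius c r s := scale_mul_radius s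
  have disc : ∀ d : ℂ, ‖d‖ < relRadius c r s →
      ‖(frame s₀ s * Circle.exp g * d / relRadius c r s : ℂ)‖ < 1 := by
    intro d hd
    rw [norm_div, norm_mul, norm_mul, Circle.norm_coe, Circle.norm_coe, Complex.norm_real,
      Real.norm_eq_abs, abs_of_pos hη, div_lt_one hη]
    linarith
  have hηc : (relRadius c r s : ℂ) ≠ 0 := by exact_mod_cast hη.ne'
  have hsrc : (scale c s : ℂ) * r = 2 * relRadius c r s := by exact_mod_cast hsr
  have hmem : q' ∈ twoDiscExterior (relRadius c r s) := by
    constructor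
    · by_contra! hlt
      have h5 := disc _ hlt
      have h6 : ‖q'‖ ≤ 2 := by linarith [(norm_sub_one_ge q').1]
      refine h3 _ h5 ?_
      rw [← ha, ← boxMap_disc hr s h5.le, near 0 h6, mul_add, hgap, ← mul_assoc (scale c s : ℂ),
        hsrc]
      congr 1
      field_simp
      ring
    · by_contra! hlt
      have h5 := disc _ hlt
      have h6 : ‖q'‖ ≤ 2 := by linarith [(norm_sub_one_ge q').2]
      refine h4 _ h5 ?_
      have h7 := boxMap_disc hr (-s) h5.le
      rw [scale_neg, gap_neg] at h7
      have h8 : boxMap c r (-s) = boxMap c r s := by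
        funext b
        rw [boxMap, boxMap, mid_neg, scale_neg, boxWidth, boxWidth,
          boxHeight, boxHeight, gap_neg, Complex.neg_re, Complex.neg_im, abs_neg, abs_neg]
      rw [← ha, ← h7, h8, near 0 h6, mul_add, neg_div, mul_neg, hgap,
        ← mul_assoc (scale c s : ℂ), hsrc]
      congr 1
      field_simp
      ring
  obtain ⟨q, hq, hqe⟩ := exists_tweak_eq (g := g) hη hη1 hmem
  refine ⟨q, hq, ?_⟩
  rw [position, ← hg, hqe, e1, spin_spin_neg, ha]

end radius

section crossing
variable (hc : IsNegativeTwoBraid c s₀) (hr : IsTubeRadius c r)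
include hc

theorem gap_crossing : gap c s₀ = (((c s₀).im - (c (-s₀)).im : ℝ) : ℂ) * Complex.I := by
  apply Complex.ext
  · rw [gap, Complex.sub_re, hc.re_crossing]
    simp
  · simp [gap]

theorem twistAngle_crossing : twistAngle c s₀ s₀ = 0 := by
  rw [twistAngle, frame_self, coe_circleI, gap_crossing hc,
    mul_div_cancel_right₀ _ Complex.I_ne_zero,
    Complex.arg_ofReal_of_nonneg]
  linarith [hc.im_crossing]

/-- The single negative crossing means that the vector between the strands is nowhere opposite to
the frame. -/
theorem gap_div_frame_mem_slitPlane (s : Circle) : gap c s / frame s₀ s ∈ Complex.slitPlane := by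
  have hneg : ∀ s : Circle, gap c (-s) / frame s₀ (-s) = gap c s / frame s₀ s := by
    intro s
    rw [gap_neg, frame_neg, Circle.coe_neg, neg_div_neg_eq]
  -- For `0 < t < π` the gap has positive real part and the frame, `sin t + i cos t`, too. At
  -- `t = 0` both point upwards: this is where the sign of the crossing enters.
  have hpos : ∀ t : ℝ, 0 ≤ t → t < Real.pi →
      gap c (s₀ * Circle.exp t) / frame s₀ (s₀ * Circle.exp t) ∈ Complex.slitPlane := by
    intro t h0 ht
    rcases h0.eq_or_lt with h | h
    · rw [← h, Circle.exp_zero, mul_one, frame_self, coe_circleI, gap_crossing hc,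
        mul_div_cancel_right₀ _ Complex.I_ne_zero, Complex.ofReal_mem_slitPlane]
      linarith [hc.im_crossing]
    · have h1 := hc.re_lt t h ht
      have hf : frame s₀ (s₀ * Circle.exp t) = circleI * (Circle.exp t)⁻¹ := by
        rw [frame]
        simp only [mul_inv]
        rw [mul_assoc, mul_inv_cancel_left]
      set w := gap c (s₀ * Circle.exp t) with hw
      have hwre : 0 < w.re := by
        rw [hw, gap, Complex.sub_re]; linarith
      by_contra hns
      rw [Complex.mem_slitPlane_iff_not_le_zero, not_not, Complex.le_def] at hns
      obtain ⟨h2, h3⟩ := hns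
      have hfc : (frame s₀ (s₀ * Circle.exp t) : ℂ) = ⟨Real.sin t, Real.cos t⟩ := by
        rw [hf, Circle.coe_mul, coe_circleI, ← Circle.exp_neg, Circle.coe_exp, Complex.exp_mul_I,
          ← Complex.ofReal_cos, ← Complex.ofReal_sin, Real.cos_neg, Real.sin_neg]
        apply Complex.ext <;> simp [Complex.cos_ofReal_re, Complex.sin_ofReal_re]
      set k := w / frame s₀ (s₀ * Circle.exp t) with hk
      have h4 : w = k * frame s₀ (s₀ * Circle.exp t) :=
        (div_mul_cancel₀ _ (Circle.coe_ne_zero _)).symm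
      rw [hfc] at h4
      have h5 := congrArg Complex.re h4
      rw [Complex.mul_re, h3] at h5
      simp only [Complex.zero_im, Complex.zero_re, zero_mul, sub_zero] at h5 h2
      have h6 := Real.sin_pos_of_pos_of_lt_pi h ht
      nlinarith
  set t := ((s * s₀⁻¹ : Circle) : ℂ).arg with ht
  have hs : s = s₀ * Circle.exp t := by
    rw [ht, Circle.exp_arg, mul_comm s, mul_inv_cancel_left]
  have ht1 := Complex.neg_pi_lt_arg ((s * s₀⁻¹ : Circle) : ℂ)
  have ht2 := Complex.arg_le_pi ((s * s₀⁻¹ : Circle) : ℂ)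
  rw [← ht] at ht1 ht2
  have hexp : Circle.exp Real.pi = -1 := by
    apply Circle.ext
    rw [Circle.coe_exp, Complex.exp_pi_mul_I, Circle.coe_neg, Circle.coe_one]
  rcases lt_or_ge t 0 with h | h
  · rw [← hneg]
    have : -s = s₀ * Circle.exp (t + Real.pi) := by
      rw [Circle.exp_add, hexp, mul_neg, mul_neg, mul_one, ← hs]
    rw [this]
    exact hpos _ (by linarith) (by linarith)
  · rcases ht2.eq_or_lt with h' | h'
    · rw [← hneg]
      have : -s = s₀ * Circle.exp 0 := by
        rw [hs, h', hexp, Circle.exp_zero, mul_neg, neg_neg]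
      rw [this]
      exact hpos _ le_rfl Real.pi_pos
    · rw [hs]
      exact hpos _ h h'

theorem continuous_gap : Continuous (gap c) := by
  have := hc.continuous
  unfold gap
  fun_prop

theorem continuous_twistAngle : Continuous (twistAngle c s₀) := by
  have h1 : Continuous fun s => gap c s / (frame s₀ s : ℂ) :=
    (continuous_gap hc).div (continuous_subtype_val.comp (continuous_frame s₀))
      fun s => Circle.coe_ne_zero _
  exact continuous_iff_continuousAt.2 fun s =>
    ContinuousAt.comp (f := fun s => gap c s / (frame s₀ s : ℂ)) (g := Complex.arg)
      (Complex.continuousAt_arg (gap_div_frame_mem_slitPlane hc s)) h1.continuousAt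

include hr

theorem continuous_position_comp {Y : Type*} [TopologicalSpace Y] {s : Y → Circle} {q : Y → ℂ}
    (hs : Continuous s) (hq : Continuous q) (hq0 : ∀ y, q y ∈ twoDiscExterior (1 / 2)) :
    Continuous fun y => position c s₀ r (s y) (q y) := by
  have hg : Continuous fun y => gap c (s y) := (continuous_gap hc).comp hs
  have hg0 : ∀ y, ‖gap c (s y)‖ ≠ 0 := fun y => (norm_gap_pos hr (s y)).ne'
  have hm : Continuous fun y => mid c (s y) := by
    have := hc.continuous
    unfold mid
    fun_prop
  have hsc : Continuous fun y => scale c (s y) := by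
    unfold scale
    fun_prop (disch := assumption)
  have hη : Continuous fun y => relRadius c r (s y) := by
    unfold relRadius
    fun_prop (disch := assumption)
  have ht : Continuous fun y => twistAngle c s₀ (s y) := (continuous_twistAngle hc).comp hs
  have hf : Continuous fun y => (frame s₀ (s y) : ℂ) :=
    continuous_subtype_val.comp ((continuous_frame s₀).comp hs)
  have h1 := continuous_tweak_comp hη ht hq (fun y => relRadius_pos hr (s y)) hq0
  have h2 : Continuous fun y => spin (twistAngle c s₀ (s y)) (2 * (frame s₀ (s y) : ℂ) *
      tweak (relRadius c r (s y)) (twistAngle c s₀ (s y)) (q y)) :=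
    continuous_spin_comp ht ((continuous_const.mul hf).mul h1)
  have hw : Continuous fun y => boxWidth c r (s y) :=
    ((Complex.continuous_re.comp hg).abs.div_const 2).add continuous_const
  have hh : Continuous fun y => boxHeight c r (s y) :=
    ((Complex.continuous_im.comp hg).abs.div_const 2).add continuous_const
  have h3 := continuous_interp_comp Real.pi (Complex.continuous_re.comp hm) hw hsc
    (Complex.continuous_re.comp h2) (fun y => scale_pos hr (s y))
    fun y => scale_mul_boxWidth_lt hr (s y)
  have h4 := continuous_interp_comp 1 (Complex.continuous_im.comp hm) hh hsc
    (Complex.continuous_im.comp h2) (fun y => scale_pos hr (s y))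
    fun y => scale_mul_boxHeight_lt hr (s y)
  exact Complex.equivRealProdCLM.symm.continuous.comp (h3.prodMk h4)

/-- The segment between the strands at the crossing corresponds to `[-1, 1]`. -/
theorem position_crossing_mem_segment_iff {q : ℂ} (hq : q ∈ twoDiscExterior (1 / 2)) :
    (∃ t : ℝ, |t| ≤ 1 ∧ position c s₀ r s₀ q = mid c s₀ + t * (gap c s₀ / 2)) ↔
      ∃ t : ℝ, |t| ≤ 1 ∧ q = t := by
  have hη := relRadius_pos hr s₀
  have hη1 := relRadius_lt_one hr s₀
  have h0 := twistAngle_crossing hc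
  have hgap := scale_mul_gap (s₀ := s₀) hr s₀
  rw [h0, Circle.exp_zero, Circle.coe_one, mul_one] at hgap
  have hf : 2 * (frame s₀ s₀ : ℂ) ≠ 0 := mul_ne_zero two_ne_zero (Circle.coe_ne_zero _)
  rw [← tweak_mem_segment_iff hη hη1 hq]
  refine exists_congr fun t => and_congr_right fun ht => ?_
  rw [← boxMap_segment hr s₀ ht, position, (boxMap_injective hr s₀).eq_iff, h0, spin_zero,
    mul_left_comm, hgap, mul_comm (t : ℂ)]
  exact (mul_right_injective₀ hf).eq_iff

end crossing

end braid

/-! ### The two charts and their maps to the model -/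

/-- The rescaling of radii in the model: the slit becomes the circle of radius `holeRadius`, and the
rectangle becomes that of `pants`. -/
noncomputable def collarRadius (ρ : ℝ) : ℝ := max (ρ / 8) (1 - (8 - ρ) * (1 - holeRadius) / 7)

theorem holeRadius_gt : 1 / 8 < holeRadius := by
  by_contra! h
  nlinarith [holeRadius_sq, holeRadius_pos]

theorem collarRadius_one : collarRadius 1 = holeRadius := by
  rw [collarRadius, max_eq_right] <;> linarith [holeRadius_gt]

theorem collarRadius_strictMono : StrictMono collarRadius := by
  intro x y h
  have h1 := holeRadius_lt_one
  have h2 : 1 - (8 - x) * (1 - holeRadius) / 7 < 1 - (8 - y) * (1 - holeRadius) / 7 := by nlinarith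
  exact max_lt_max (by linarith) h2

theorem collarRadius_of_ge {ρ : ℝ} (h : 8 ≤ ρ) : collarRadius ρ = ρ / 8 := by
  rw [collarRadius, max_eq_left]
  nlinarith [holeRadius_gt]

theorem collarRadius_le_one {ρ : ℝ} (h : ρ ≤ 8) : collarRadius ρ ≤ 1 :=
  (collarRadius_strictMono.monotone h).trans (by rw [collarRadius_of_ge le_rfl]; norm_num)

theorem holeRadius_le_collarRadius {ρ : ℝ} (h : 1 ≤ ρ) : holeRadius ≤ collarRadius ρ :=
  collarRadius_one ▸ collarRadius_strictMono.monotone h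

theorem collarRadius_pos {ρ : ℝ} (h : 1 ≤ ρ) : 0 < collarRadius ρ :=
  holeRadius_pos.trans_le (holeRadius_le_collarRadius h)

theorem continuous_collarRadius : Continuous collarRadius := by
  unfold collarRadius
  fun_prop

theorem exists_collarRadius_eq {y : ℝ} (h : holeRadius ≤ y) : ∃ ρ, 1 ≤ ρ ∧ collarRadius ρ = y := by
  have h1 : y ∈ Set.Icc (collarRadius 1) (collarRadius (max 8 (8 * y))) := by
    refine ⟨by rwa [collarRadius_one], ?_⟩
    rw [collarRadius_of_ge (le_max_left _ _)]
    linarith [le_max_right 8 (8 * y)]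
  obtain ⟨ρ, hρ, h⟩ := intermediate_value_Icc
    ((by norm_num : (1 : ℝ) ≤ 8).trans (le_max_left 8 (8 * y)))
    continuous_collarRadius.continuousOn h1
  exact ⟨ρ, hρ.1, h⟩

theorem norm_collarRadius_mul {ρ : ℝ} (h : 1 ≤ ρ) (w : Circle) :
    ‖(collarRadius ρ * w : ℂ)‖ = collarRadius ρ := by
  rw [norm_mul, Circle.norm_coe, mul_one, Complex.norm_real, Real.norm_eq_abs,
    abs_of_pos (collarRadius_pos h)]

theorem mem_pants_of_norm_le_one {p : ℂ} (h1 : holeRadius ≤ ‖p‖) (h2 : ‖p‖ ≤ 1) : p ∈ pants :=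
  ⟨(Complex.abs_re_le_norm p).trans (h2.trans one_lt_pi.le),
    (Complex.abs_im_le_norm p).trans h2, h1⟩

/-- The fibre coordinate in the model. It takes the same value at `J` and `-J`, and inverse values
at the two sides `J` and `J⁻¹` of the slit. -/
noncomputable def fibreAngle (J : ℂ) : Circle := (dir J ^ 2)⁻¹

/-- The parameters `(J, s)` of the points of the exterior of the tube. A point in the slice of `s`
is given by its coordinate `J` in the exterior of the unit disc, and `(-J, -s)` describes the same
point as `(J, s)`. -/
def exteriorChart (s₀ : Circle) : Set (ℂ × Circle) :=
  {k | 1 ≤ ‖k.1‖ ∧ squash k.1 ∈ twoDiscExterior (1 / 2) ∧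
    |(frame s₀ k.2 * k.1 : ℂ).re| ≤ 8 * Real.pi ∧ |(frame s₀ k.2 * k.1 : ℂ).im| ≤ 8}

/-- The parameters `(σ, W)` of the points of the new solid torus, whose coordinate in the meridian
disc is `(W - W⁻¹) σ⁻¹`. The parameter `W` ranges over a half disc with respect to the coordinate
`W - W⁻¹`; the other half is reached with `-σ`, and on the common diameter `‖W‖ = 1` the parameters
`(σ, W)` and `(-σ, W⁻¹)` describe the same point. -/
def torusChart : Set (Circle × ℂ) :=
  {k | 1 ≤ ‖k.2‖ ∧ 0 ≤ k.2.re ∧ ‖k.2 - k.2⁻¹‖ ≤ 1}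

theorem ne_zero_of_one_le_norm {J : ℂ} (h : 1 ≤ ‖J‖) : J ≠ 0 := by
  rintro rfl
  norm_num at h

theorem continuousOn_eccentricity_norm :
    ContinuousOn (fun J : ℂ => eccentricity ‖J‖ / ‖J‖) {J | 1 ≤ ‖J‖} :=
  (continuousOn_eccentricity.comp continuous_norm.continuousOn fun _ h => h).div
    continuous_norm.continuousOn fun _ h => (zero_lt_one.trans_le h).ne'

theorem continuousOn_squash : ContinuousOn squash {J | 1 ≤ ‖J‖} := by
  have h := Complex.continuous_ofReal.comp_continuousOn continuousOn_eccentricity_norm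
  exact (continuousOn_id.add (h.mul Complex.continuous_conj.continuousOn)).div_const 2

theorem continuousOn_cosquash : ContinuousOn cosquash {J | 1 ≤ ‖J‖} := by
  have h := Complex.continuous_ofReal.comp_continuousOn continuousOn_eccentricity_norm
  exact continuousOn_id.sub (h.mul Complex.continuous_conj.continuousOn)

theorem isClosed_twoDiscExterior (x : ℝ) : IsClosed (twoDiscExterior x) :=
  IsClosed.inter (s₁ := {q : ℂ | x ≤ ‖q - 1‖}) (s₂ := {q : ℂ | x ≤ ‖q + 1‖})
    (isClosed_le continuous_const (by fun_prop)) (isClosed_le continuous_const (by fun_prop))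

theorem isCompact_exteriorChart (s₀ : Circle) : IsCompact (exteriorChart s₀) := by
  have hf : Continuous fun k : ℂ × Circle => (frame s₀ k.2 * k.1 : ℂ) :=
    (continuous_subtype_val.comp ((continuous_frame s₀).comp continuous_snd)).mul continuous_fst
  have h1 : IsClosed {k : ℂ × Circle | 1 ≤ ‖k.1‖} := isClosed_le continuous_const (by fun_prop)
  have h2 : IsClosed ({k : ℂ × Circle | 1 ≤ ‖k.1‖} ∩
      (fun k => squash k.1) ⁻¹' twoDiscExterior (1 / 2)) :=
    ContinuousOn.preimage_isClosed_of_isClosed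
      (continuousOn_squash.comp continuous_fst.continuousOn fun _ h => h) h1
      (isClosed_twoDiscExterior _)
  have h3 : IsClosed {k : ℂ × Circle | |(frame s₀ k.2 * k.1 : ℂ).re| ≤ 8 * Real.pi} :=
    isClosed_le (Complex.continuous_re.comp hf).abs continuous_const
  have h4 : IsClosed {k : ℂ × Circle | |(frame s₀ k.2 * k.1 : ℂ).im| ≤ 8} :=
    isClosed_le (Complex.continuous_im.comp hf).abs continuous_const
  have h5 : IsClosed (exteriorChart s₀) := by
    have : exteriorChart s₀ = ({k : ℂ × Circle | 1 ≤ ‖k.1‖} ∩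
      (fun k => squash k.1) ⁻¹' twoDiscExterior (1 / 2)) ∩
      ({k | |(frame s₀ k.2 * k.1 : ℂ).re| ≤ 8 * Real.pi} ∩
      {k | |(frame s₀ k.2 * k.1 : ℂ).im| ≤ 8}) := by
      ext k
      exact ⟨fun ⟨a, b, c, d⟩ => ⟨⟨a, b⟩, c, d⟩, fun ⟨⟨a, b⟩, c, d⟩ => ⟨a, b, c, d⟩⟩
    rw [this]
    exact h2.inter (h3.inter h4)
  refine ((isCompact_closedBall (0 : ℂ) (8 * Real.pi + 8)).prod
    (isCompact_univ (X := Circle))).of_isClosed_subset h5 ?_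
  rintro ⟨J, s⟩ ⟨-, -, h, h'⟩
  refine ⟨?_, trivial⟩
  have h6 := Complex.norm_le_abs_re_add_abs_im (frame s₀ s * J : ℂ)
  rw [norm_mul, Circle.norm_coe, one_mul] at h6
  rw [mem_closedBall_zero_iff]
  exact h6.trans (add_le_add h h')

theorem norm_le_two_of_mem_torusChart {σ : Circle} {W : ℂ} (h : (σ, W) ∈ torusChart) :
    ‖W‖ ≤ 2 := by
  obtain ⟨h1, -, h3⟩ := h
  have h4 := norm_sub_norm_le W W⁻¹
  rw [norm_inv] at h4
  have h5 : ‖W‖⁻¹ ≤ 1 := inv_le_one_of_one_le₀ h1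
  simp only at h3
  linarith

theorem isCompact_torusChart : IsCompact torusChart := by
  have h1 : IsClosed {k : Circle × ℂ | 1 ≤ ‖k.2‖} := isClosed_le continuous_const (by fun_prop)
  have h2 : IsClosed {k : Circle × ℂ | 0 ≤ k.2.re} :=
    isClosed_le continuous_const (Complex.continuous_re.comp continuous_snd)
  have hc : ContinuousOn (fun k : Circle × ℂ => k.2 - k.2⁻¹) {k | 1 ≤ ‖k.2‖} :=
    continuous_snd.continuousOn.sub
      (continuous_snd.continuousOn.inv₀ fun _ h => ne_zero_of_one_le_norm h)
  have h3 : IsClosed ({k : Circle × ℂ | 1 ≤ ‖k.2‖} ∩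
      (fun k => k.2 - k.2⁻¹) ⁻¹' Metric.closedBall 0 1) :=
    hc.preimage_isClosed_of_isClosed h1 Metric.isClosed_closedBall
  have h5 : IsClosed torusChart := by
    have : torusChart = ({k : Circle × ℂ | 1 ≤ ‖k.2‖} ∩
      (fun k => k.2 - k.2⁻¹) ⁻¹' Metric.closedBall 0 1) ∩ {k | 0 ≤ k.2.re} := by
      ext k
      simp only [torusChart, Set.mem_inter_iff, Set.mem_preimage, mem_closedBall_zero_iff,
        Set.mem_ofPred_eq]
      tauto
    rw [this]
    exact h3.inter h2
  refine ((isCompact_univ (X := Circle)).prod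
    (isCompact_closedBall (0 : ℂ) 2)).of_isClosed_subset h5 ?_
  rintro ⟨σ, W⟩ h
  exact ⟨trivial, mem_closedBall_zero_iff.2 (norm_le_two_of_mem_torusChart h)⟩

/-! ### The relations between `W`, `W - W⁻¹` and `J = W²` -/

theorem add_inv_sq {W : ℂ} (h : W ≠ 0) : (W + W⁻¹) ^ 2 = (W - W⁻¹) ^ 2 + 4 := by
  field_simp
  ring

theorem re_inv_mul {W : ℂ} (h : 1 ≤ ‖W‖) : (W⁻¹).re * ‖W‖ ^ 2 = W.re := by
  rw [Complex.inv_re, Complex.normSq_eq_norm_sq, div_mul_cancel₀]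
  positivity

theorem re_pos_of_norm_le_one {a : ℂ} (h : ‖a‖ ≤ 1) : 0 < (a ^ 2 + 4).re := by
  have h1 : |(a ^ 2).re| ≤ 1 := by
    refine (Complex.abs_re_le_norm _).trans ?_
    rw [norm_pow]
    exact pow_le_one₀ (norm_nonneg a) h
  have := (abs_le.1 h1).1
  rw [Complex.add_re]
  norm_num
  linarith

theorem add_inv_ne_zero {W : ℂ} (h1 : W ≠ 0) (h2 : ‖W - W⁻¹‖ ≤ 1) : W + W⁻¹ ≠ 0 := by
  intro h
  have h3 := re_pos_of_norm_le_one h2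
  rw [← add_inv_sq h1, h] at h3
  norm_num at h3

theorem re_pos_of_mem_torusChart {σ : Circle} {W : ℂ} (h : (σ, W) ∈ torusChart) : 0 < W.re := by
  obtain ⟨h1, h2, h3⟩ := h
  simp only at h1 h2 h3
  refine h2.lt_of_ne fun h0 => ?_
  have h4 := re_inv_mul h1
  have h5 := re_pos_of_norm_le_one h3
  rw [← add_inv_sq (ne_zero_of_one_le_norm h1), pow_two, Complex.mul_re, Complex.add_re, ← h0] at h5
  rw [← h0] at h4
  have h6 : (W⁻¹).re = 0 := by
    rcases mul_eq_zero.1 h4 with h | h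
    · exact h
    · nlinarith
  rw [h6] at h5
  nlinarith

/-- In the right half plane, `W` is determined by `W - W⁻¹`. -/
theorem eq_of_sub_inv_eq {W V : ℂ} (hW : 0 < W.re) (hV : 0 < V.re) (h : W - W⁻¹ = V - V⁻¹) :
    W = V := by
  have hW0 : W ≠ 0 := by rintro rfl; simp at hW
  have hV0 : V ≠ 0 := by rintro rfl; simp at hV
  have h1 : (W - V) * (1 + W⁻¹ * V⁻¹) = 0 := by
    have : (W - V) * (1 + W⁻¹ * V⁻¹) = (W - W⁻¹) - (V - V⁻¹) := by field_simp; ring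
    rw [this, h, sub_self]
  rcases mul_eq_zero.1 h1 with h2 | h2
  · exact sub_eq_zero.1 h2
  · exfalso
    have h3 : W = -V⁻¹ := by
      have : W * (1 + W⁻¹ * V⁻¹) = W + V⁻¹ := by field_simp
      rw [h2, mul_zero] at this
      exact eq_neg_of_add_eq_zero_left this.symm
    rw [h3, Complex.neg_re, Complex.inv_re] at hW
    have : 0 ≤ V.re / Complex.normSq V := div_nonneg hV.le (Complex.normSq_nonneg _)
    linarith

theorem exists_sub_inv_eq {a : ℂ} (h : ‖a‖ ≤ 1) : ∃ W : ℂ, 0 < W.re ∧ W - W⁻¹ = a := by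
  obtain ⟨b, hb⟩ : ∃ b : ℂ, b ^ 2 = a ^ 2 + 4 := IsAlgClosed.exists_pow_nat_eq _ two_pos
  have h1 := re_pos_of_norm_le_one h
  rw [← hb] at h1
  have key : ∀ b : ℂ, b ^ 2 = a ^ 2 + 4 → 0 < b.re → ∃ W : ℂ, 0 < W.re ∧ W - W⁻¹ = a := by
    intro b hb h0
    have h2 : ((b + a) / 2) * ((b - a) / 2) = 1 := by linear_combination hb / 4
    have h3 : ((b + a) / 2)⁻¹ = (b - a) / 2 := inv_eq_of_mul_eq_one_right h2
    refine ⟨(b + a) / 2, ?_, by rw [h3]; ring⟩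
    have h4 : (b + a) / 2 ≠ 0 := left_ne_zero_of_mul_eq_one h2
    have h5 : b = (b + a) / 2 + ((b + a) / 2)⁻¹ := by rw [h3]; ring
    rw [h5, Complex.add_re, Complex.inv_re] at h0
    by_contra! hneg
    have : ((b + a) / 2).re / Complex.normSq ((b + a) / 2) ≤ 0 :=
      div_nonpos_of_nonpos_of_nonneg hneg (Complex.normSq_nonneg _)
    linarith
  rcases lt_trichotomy b.re 0 with h2 | h2 | h2
  · exact key (-b) (by rw [neg_sq, hb]) (by rw [Complex.neg_re]; linarith)
  · rw [pow_two, Complex.mul_re, h2] at h1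
    nlinarith
  · exact key b hb h2

theorem inv_re_pos {W : ℂ} (h : 0 < W.re) : 0 < (W⁻¹).re := by
  have hW0 : W ≠ 0 := by rintro rfl; simp at h
  rw [Complex.inv_re]
  exact div_pos h (Complex.normSq_pos.2 hW0)

theorem inv_mem_torusChart {σ : Circle} {W : ℂ} (hn : ‖W‖ = 1) (h : (σ, W) ∈ torusChart) :
    (-σ, W⁻¹) ∈ torusChart := by
  have h1 := re_pos_of_mem_torusChart h
  refine ⟨?_, (inv_re_pos h1).le, ?_⟩
  · simp [hn]
  · have := h.2.2
    simp only [inv_inv] at this ⊢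
    rwa [norm_sub_rev]

theorem one_le_norm_sq {W : ℂ} (h : 1 ≤ ‖W‖) : 1 ≤ ‖W ^ 2‖ := by
  rw [norm_pow]
  exact one_le_pow₀ h

theorem norm_sq_le_three {σ : Circle} {W : ℂ} (h : (σ, W) ∈ torusChart) : ‖W ^ 2‖ ≤ 3 := by
  obtain ⟨h1, -, h3⟩ := h
  simp only at h1 h3
  have h4 := norm_sub_norm_le W W⁻¹
  have h5 : ‖W‖ * ‖W⁻¹‖ = 1 := by
    rw [norm_inv, mul_inv_cancel₀]
    linarith
  rw [norm_pow]
  nlinarith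

/-- The solid torus is a neighbourhood of the strands in the coordinate `squash J`: its boundary,
`‖W - W⁻¹‖ = 1`, corresponds to the circle of radius `1 / 2` about `1`. -/
theorem squash_sq {σ : Circle} {W : ℂ} (h : (σ, W) ∈ torusChart) :
    squash (W ^ 2) = 1 + (W - W⁻¹) ^ 2 / 2 := by
  have hW := ne_zero_of_one_le_norm h.1
  rw [squash_of_le (one_le_norm_sq h.1) (norm_sq_le_three h)]
  simp only at hW
  field_simp
  ring

theorem cosquash_sq {σ : Circle} {W : ℂ} (h : (σ, W) ∈ torusChart) :
    cosquash (W ^ 2) = (W - W⁻¹) * (W + W⁻¹) := by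
  have hW := ne_zero_of_one_le_norm h.1
  rw [cosquash_of_le (one_le_norm_sq h.1) (norm_sq_le_three h)]
  simp only at hW
  field_simp
  ring

theorem re_sq_pos {σ : Circle} {W : ℂ} (h : (σ, W) ∈ torusChart) : 0 < (W ^ 2).re := by
  have h1 := re_squash (one_le_norm_sq h.1)
  have h2 : 0 < (squash (W ^ 2)).re := by
    have h3 := re_pos_of_norm_le_one h.2.2
    have h4 : |((W - W⁻¹) ^ 2 / 2).re| ≤ 1 / 2 := by
      refine (Complex.abs_re_le_norm _).trans ?_
      rw [norm_div, norm_pow]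
      have := pow_le_one₀ (n := 2) (norm_nonneg _) h.2.2
      norm_num
      linarith
    rw [squash_sq h, Complex.add_re, Complex.one_re]
    linarith [(abs_le.1 h4).1]
  have h5 : 0 < ‖W ^ 2‖ := zero_lt_one.trans_le (one_le_norm_sq h.1)
  by_contra! h6
  have h7 : (W ^ 2).re / ‖W ^ 2‖ ≤ 0 := div_nonpos_of_nonpos_of_nonneg h6 h5.le
  nlinarith [eccentricity_nonneg ‖W ^ 2‖]

section charts
variable {c : Circle → ℂ} {s₀ : Circle} {r : ℝ}

/-- The point of the model plane that the fibre through the point with the parameters `(J, s)` lies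
over. -/
noncomputable def exteriorPoint (s₀ : Circle) (J : ℂ) (s : Circle) : ℂ :=
  collarRadius ‖J‖ * (frame s₀ s * dir (cosquash J) : Circle)

/-- The point of the model plane that the fibre through the point with the parameters `(σ, W)` lies
over. -/
noncomputable def torusPoint (σ : Circle) (W : ℂ) : ℂ :=
  collarRadius ‖W ^ 2‖ * (σ⁻¹ * dir (W + W⁻¹) : Circle)

theorem cosquash_ne_zero_of_mem {J : ℂ} {s : Circle} (h : (J, s) ∈ exteriorChart s₀) :
    cosquash J ≠ 0 := by
  obtain ⟨h1, ⟨h2, h3⟩, -⟩ := h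
  refine cosquash_ne_zero h1 ?_ ?_
  · intro h
    rw [h] at h2
    norm_num at h2
  · intro h
    rw [h] at h3
    norm_num at h3

/-- Far from the slit, the model is the slice itself, scaled by `1 / 8`. -/
theorem exteriorPoint_of_ge {J : ℂ} {s : Circle} (h : 8 ≤ ‖J‖) :
    exteriorPoint s₀ J s = frame s₀ s * J / 8 := by
  rw [exteriorPoint, cosquash_of_four_le (by linarith), collarRadius_of_ge h, Circle.coe_mul]
  nth_rw 3 [← norm_mul_dir J]
  push_cast
  ring

theorem exteriorPoint_mem_pants {J : ℂ} {s : Circle} (h : (J, s) ∈ exteriorChart s₀) :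
    exteriorPoint s₀ J s ∈ pants := by
  obtain ⟨h1, -, h3, h4⟩ := h
  simp only at h1 h3 h4
  have hn : holeRadius ≤ ‖exteriorPoint s₀ J s‖ := by
    rw [exteriorPoint, norm_collarRadius_mul h1]
    exact holeRadius_le_collarRadius h1
  rcases le_total 8 ‖J‖ with h8 | h8
  · refine ⟨?_, ?_, hn⟩
    · rw [exteriorPoint_of_ge h8, show (8 : ℂ) = ((8 : ℝ) : ℂ) by norm_num, Complex.div_ofReal_re,
        abs_div, abs_of_pos (by norm_num : (0 : ℝ) < 8), div_le_iff₀ (by norm_num)]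
      linarith
    · rw [exteriorPoint_of_ge h8, show (8 : ℂ) = ((8 : ℝ) : ℂ) by norm_num, Complex.div_ofReal_im,
        abs_div, abs_of_pos (by norm_num : (0 : ℝ) < 8), div_le_iff₀ (by norm_num)]
      linarith
  · refine mem_pants_of_norm_le_one hn ?_
    rw [exteriorPoint, norm_collarRadius_mul h1]
    exact collarRadius_le_one h8

theorem norm_torusPoint_le_one {σ : Circle} {W : ℂ} (h : (σ, W) ∈ torusChart) :
    ‖torusPoint σ W‖ ≤ 1 := by
  rw [torusPoint, norm_collarRadius_mul (one_le_norm_sq h.1)]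
  exact collarRadius_le_one ((norm_sq_le_three h).trans (by norm_num))

theorem torusPoint_mem_pants {σ : Circle} {W : ℂ} (h : (σ, W) ∈ torusChart) :
    torusPoint σ W ∈ pants := by
  refine mem_pants_of_norm_le_one ?_ (norm_torusPoint_le_one h)
  rw [torusPoint, norm_collarRadius_mul (one_le_norm_sq h.1)]
  exact holeRadius_le_collarRadius (one_le_norm_sq h.1)

/-- The map from the parameters of the exterior to the circle bundle. -/
noncomputable def exteriorModel (k : exteriorChart s₀) : OrientableCircleBundle :=
  modelMap (⟨exteriorPoint s₀ k.1.1 k.1.2, exteriorPoint_mem_pants k.2⟩, fibreAngle k.1.1)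

/-- The map from the parameters of the new solid torus to the circle bundle. -/
noncomputable def torusModel (k : torusChart) : OrientableCircleBundle :=
  modelMap (⟨torusPoint k.1.1 k.1.2, torusPoint_mem_pants k.2⟩, fibreAngle (k.1.2 ^ 2))

theorem continuous_fibreAngle_comp {Y : Type*} [TopologicalSpace Y] {J : Y → ℂ} (h : Continuous J)
    (h0 : ∀ y, J y ≠ 0) : Continuous fun y => fibreAngle (J y) :=
  ((continuous_dir_comp h h0).pow 2).inv

theorem continuous_exteriorModel : Continuous (exteriorModel (s₀ := s₀)) := by
  have hJ : Continuous fun k : exteriorChart s₀ => k.1.1 := by fun_prop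
  have hs : Continuous fun k : exteriorChart s₀ => k.1.2 := by fun_prop
  have h1 : Continuous fun k : exteriorChart s₀ => cosquash k.1.1 :=
    continuousOn_cosquash.comp_continuous hJ fun k => k.2.1
  have h2 := continuous_dir_comp h1 fun k => cosquash_ne_zero_of_mem k.2
  have h3 : Continuous fun k : exteriorChart s₀ => exteriorPoint s₀ k.1.1 k.1.2 :=
    (Complex.continuous_ofReal.comp (continuous_collarRadius.comp hJ.norm)).mul
      (continuous_subtype_val.comp (((continuous_frame s₀).comp hs).mul h2))
  exact continuous_modelMap.comp ((h3.subtype_mk _).prodMk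
    (continuous_fibreAngle_comp hJ fun k => ne_zero_of_one_le_norm k.2.1))

theorem continuous_torusModel : Continuous torusModel := by
  have hσ : Continuous fun k : torusChart => k.1.1 := by fun_prop
  have hW : Continuous fun k : torusChart => k.1.2 := by fun_prop
  have h0 : ∀ k : torusChart, k.1.2 ≠ 0 := fun k => ne_zero_of_one_le_norm k.2.1
  have h2 := continuous_dir_comp (hW.add (hW.inv₀ h0)) fun k => add_inv_ne_zero (h0 k) k.2.2.2
  have h3 : Continuous fun k : torusChart => torusPoint k.1.1 k.1.2 :=
    (Complex.continuous_ofReal.comp (continuous_collarRadius.comp (hW.pow 2).norm)).mul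
      (continuous_subtype_val.comp (hσ.inv.mul h2))
  exact continuous_modelMap.comp ((h3.subtype_mk _).prodMk
    (continuous_fibreAngle_comp (hW.pow 2) fun k => pow_ne_zero 2 (h0 k)))

/-! ### The charts parametrise the two pieces of the surgered manifold -/

theorem norm_frame_mul (s : Circle) (J : ℂ) : ‖(frame s₀ s * J : ℂ)‖ = ‖J‖ := by
  rw [norm_mul, Circle.norm_coe, one_mul]

/-- The two descriptions of the model rectangle agree, as `2 * squash J = J` away from the slit. -/
theorem rectangle_iff (s : Circle) {J : ℂ} (h1 : 1 ≤ ‖J‖) :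
    (|(2 * frame s₀ s * squash J : ℂ).re| ≤ 8 * Real.pi ∧
      |(2 * frame s₀ s * squash J : ℂ).im| ≤ 8) ↔
    (|(frame s₀ s * J : ℂ).re| ≤ 8 * Real.pi ∧ |(frame s₀ s * J : ℂ).im| ≤ 8) := by
  have e : (2 * frame s₀ s * squash J : ℂ) = frame s₀ s * (2 * squash J) := by ring
  rcases le_total 4 ‖J‖ with h | h
  · rw [e, two_squash_of_four_le h]
  · refine iff_of_true (abs_le_of_norm_lt ?_) (abs_le_of_norm_lt ?_)
    · rw [e, norm_frame_mul]
      linarith [norm_two_squash_le_four h1 h]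
    · rw [norm_frame_mul]
      linarith

/-- The point of `T × ℝ` with the parameters `(J, s)`. -/
noncomputable def slicePosition (c : Circle → ℂ) (s₀ : Circle) (r : ℝ) (J : ℂ) (s : Circle) :
    (Circle × Circle) × ℝ :=
  slicePoint (s ^ 2) (position c s₀ r s (squash J))

theorem abs_re_add_mul_lt (hr : IsTubeRadius c r) (s : Circle) {z : ℂ} (hz : ‖z‖ ≤ 1) :
    |(c s + r * z).re| < Real.pi := by
  have h1 := hr.re_add_lt s
  have h2 : |(r * z : ℂ).re| ≤ r := by
    rw [Complex.re_ofReal_mul, abs_mul, abs_of_pos hr.pos]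
    exact mul_le_of_le_one_right hr.pos.le ((Complex.abs_re_le_norm z).trans hz)
  rw [Complex.add_re]
  linarith [abs_add_le (c s).re (r * z : ℂ).re]

/-- The coordinates of a point are unique unless it lies over the end of the annulus, at the angles
`± π`. -/
theorem slicePoint_eq_iff {u v : Circle} {a b : ℂ} (ha : |a.re| ≤ Real.pi)
    (hb : |b.re| < Real.pi) : slicePoint u a = slicePoint v b ↔ u = v ∧ a = b := by
  constructor
  · intro h
    rw [slicePoint, slicePoint, Prod.mk.injEq, Prod.mk.injEq, circle_exp_eq_iff ha hb.le] at h
    obtain ⟨⟨h1, h2⟩, h3⟩ := h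
    refine ⟨h1, Complex.ext ?_ h3⟩
    rcases h2 with h2 | ⟨-, h2⟩ | ⟨-, h2⟩
    · exact h2
    · rw [h2, abs_neg, abs_of_pos Real.pi_pos] at hb
      exact (lt_irrefl _ hb).elim
    · rw [h2, abs_of_pos Real.pi_pos] at hb
      exact (lt_irrefl _ hb).elim
  · rintro ⟨rfl, rfl⟩
    rfl

theorem abs_position_le (hr : IsTubeRadius c r) {J : ℂ} {s : Circle}
    (h : (J, s) ∈ exteriorChart s₀) : |(position c s₀ r s (squash J)).re| ≤ Real.pi ∧
      |(position c s₀ r s (squash J)).im| ≤ 1 :=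
  (position_mem_iff hr s h.2.1).2 ((rectangle_iff s h.1).2 h.2.2)

theorem neg_mem_exteriorChart {J : ℂ} {s : Circle} (h : (J, s) ∈ exteriorChart s₀) :
    (-J, -s) ∈ exteriorChart s₀ := by
  obtain ⟨h1, h2, h3⟩ := h
  refine ⟨by rwa [norm_neg], by rwa [squash_neg, neg_mem_twoDiscExterior], ?_⟩
  simp only [frame_neg, Circle.coe_neg, neg_mul_neg]
  exact h3

theorem slicePosition_neg (J : ℂ) (s : Circle) :
    slicePosition c s₀ r (-J) (-s) = slicePosition c s₀ r J s := by
  rw [slicePosition, slicePosition, squash_neg, position_neg, neg_sq]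

theorem exteriorPoint_neg {J : ℂ} {s : Circle} (h : (J, s) ∈ exteriorChart s₀) :
    exteriorPoint s₀ (-J) (-s) = exteriorPoint s₀ J s := by
  rw [exteriorPoint, exteriorPoint, norm_neg, cosquash_neg, frame_neg,
    dir_neg (cosquash_ne_zero_of_mem h), neg_mul_neg]

theorem fibreAngle_neg {J : ℂ} (h : J ≠ 0) : fibreAngle (-J) = fibreAngle J := by
  rw [fibreAngle, fibreAngle, dir_neg h, neg_sq]

theorem exteriorModel_neg {J : ℂ} {s : Circle} (h : (J, s) ∈ exteriorChart s₀) :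
    exteriorModel ⟨(-J, -s), neg_mem_exteriorChart h⟩ = exteriorModel ⟨(J, s), h⟩ := by
  refine modelMap_eq_iff.2 (Or.inl ⟨exteriorPoint_neg h, ?_⟩)
  exact fibreAngle_neg (ne_zero_of_one_le_norm h.1)

theorem slicePosition_mem (hr : IsTubeRadius c r) {J : ℂ} {s : Circle}
    (h : (J, s) ∈ exteriorChart s₀) :
    slicePosition c s₀ r J s ∈ tubeExterior thickTorus (braidTube c r) := by
  refine ⟨abs_le.1 (abs_position_le hr h).2, ?_⟩
  rintro ⟨⟨z, s'⟩, hz, he⟩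
  have hz : ‖z‖ < 1 := hz
  have key : ∀ {J : ℂ} {s : Circle}, (J, s) ∈ exteriorChart s₀ → s = s' →
      slicePosition c s₀ r J s ≠ braidTube c r (z, s') := by
    rintro J s h rfl he
    have h1 := ((slicePoint_eq_iff (abs_position_le hr h).1 (abs_re_add_mul_lt hr s hz.le)).1 he).2
    exact hz.not_ge (one_le_norm_of_position_eq hr s h.2.1 h1)
  have h2 : s ^ 2 = s' ^ 2 := congrArg (fun x => x.1.1) he.symm
  rcases sq_eq_sq_iff_circle.1 h2 with h3 | h3
  · exact key h h3 he.symm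
  · refine key (neg_mem_exteriorChart h) (by rw [h3, neg_neg]) ?_
    rw [slicePosition_neg]
    exact he.symm

/-- The map from the parameters to the exterior of the tube. -/
noncomputable def exteriorPiece (hr : IsTubeRadius c r) (k : exteriorChart s₀) :
    tubeExterior thickTorus (braidTube c r) :=
  ⟨slicePosition c s₀ r k.1.1 k.1.2, slicePosition_mem hr k.2⟩

theorem exteriorPiece_neg (hr : IsTubeRadius c r) {J : ℂ} {s : Circle}
    (h : (J, s) ∈ exteriorChart s₀) :
    exteriorPiece hr ⟨(-J, -s), neg_mem_exteriorChart h⟩ = exteriorPiece hr ⟨(J, s), h⟩ :=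
  Subtype.ext (slicePosition_neg J s)

theorem norm_discCoordinate {σ : Circle} {W : ℂ} :
    ‖(W - W⁻¹) * (σ⁻¹ : Circle)‖ = ‖W - W⁻¹‖ := by
  rw [norm_mul, Circle.norm_coe, mul_one]

/-- The map from the parameters to the new solid torus. -/
noncomputable def torusPiece (s₀ : Circle) (k : torusChart) : SolidTorus :=
  (⟨(k.1.2 - k.1.2⁻¹) * (k.1.1⁻¹ : Circle), by
    rw [mem_closedBall_zero_iff, norm_discCoordinate]; exact k.2.2.2⟩, circleI * s₀ * k.1.1 ^ 2)

theorem continuous_exteriorPiece (hc : IsNegativeTwoBraid c s₀) (hr : IsTubeRadius c r) :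
    Continuous (exteriorPiece (s₀ := s₀) hr) := by
  have hJ : Continuous fun k : exteriorChart s₀ => k.1.1 := by fun_prop
  have hs : Continuous fun k : exteriorChart s₀ => k.1.2 := by fun_prop
  have h1 : Continuous fun k : exteriorChart s₀ => squash k.1.1 :=
    continuousOn_squash.comp_continuous hJ fun k => k.2.1
  have h2 := continuous_position_comp hc hr hs h1 fun k => k.2.2.1
  exact ((((hs.pow 2).prodMk (Circle.exp.continuous.comp (Complex.continuous_re.comp h2))).prodMk
    (Complex.continuous_im.comp h2))).subtype_mk _

theorem continuous_torusPiece : Continuous (torusPiece s₀) := by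
  have hσ : Continuous fun k : torusChart => k.1.1 := by fun_prop
  have hW : Continuous fun k : torusChart => k.1.2 := by fun_prop
  have h0 : ∀ k : torusChart, k.1.2 ≠ 0 := fun k => ne_zero_of_one_le_norm k.2.1
  have h1 : Continuous fun k : torusChart => (k.1.2 - k.1.2⁻¹) * (k.1.1⁻¹ : Circle) :=
    (hW.sub (hW.inv₀ h0)).mul (continuous_subtype_val.comp hσ.inv)
  exact (h1.subtype_mk _).prodMk (continuous_const.mul (hσ.pow 2))

theorem exteriorPiece_surjective (hr : IsTubeRadius c r) :
    Function.Surjective (exteriorPiece (s₀ := s₀) hr) := by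
  rintro ⟨⟨⟨u, x⟩, h⟩, h1, h2⟩
  obtain ⟨s, rfl⟩ := exists_sq_eq u
  set a : ℂ := ⟨(x : ℂ).arg, h⟩ with ha
  have hx : slicePoint (s ^ 2) a = ((s ^ 2, x), h) := by
    rw [slicePoint, ha, Circle.exp_arg]
  have h3 : ∀ t : Circle, t ^ 2 = s ^ 2 → ∀ z : ℂ, ‖z‖ < 1 → a ≠ c t + r * z := by
    intro t ht z hz he
    refine h2 ⟨(z, t), hz, ?_⟩
    rw [← hx, braidTube, ht, he]
  have h4 : |a.im| ≤ 1 := abs_le.2 h1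
  obtain ⟨q, hq, hqa⟩ := exists_position_eq (s₀ := s₀) hr s (Complex.abs_arg_le_pi x) h4
    (h3 s rfl) (h3 (-s) (neg_sq s))
  obtain ⟨J, hJ, rfl⟩ := exists_squash_eq q
  have hmem : (J, s) ∈ exteriorChart s₀ := by
    refine ⟨hJ, hq, (rectangle_iff s hJ).1 ((position_mem_iff hr s hq).1 ?_)⟩
    rw [hqa]
    exact ⟨Complex.abs_arg_le_pi x, h4⟩
  refine ⟨⟨(J, s), hmem⟩, Subtype.ext ?_⟩
  change slicePoint (s ^ 2) (position c s₀ r s (squash J)) = _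
  rw [hqa, hx]

theorem torusPiece_surjective : Function.Surjective (torusPiece s₀) := by
  rintro ⟨⟨z, hz⟩, y⟩
  rw [mem_closedBall_zero_iff] at hz
  obtain ⟨σ, hσ⟩ := exists_sq_eq ((circleI * s₀)⁻¹ * y)
  have hy : circleI * s₀ * σ ^ 2 = y := by rw [hσ, mul_inv_cancel_left]
  obtain ⟨W, hW, hWz⟩ := exists_sub_inv_eq (a := z * σ)
    (by rwa [norm_mul, Circle.norm_coe, mul_one])
  have hW0 : W ≠ 0 := by rintro rfl; simp at hW
  have hn : ‖W - W⁻¹‖ ≤ 1 := by rwa [hWz, norm_mul, Circle.norm_coe, mul_one]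
  have hzz : (W - W⁻¹) * (σ⁻¹ : Circle) = z := by
    rw [hWz, Circle.coe_inv, mul_assoc, mul_inv_cancel₀ σ.coe_ne_zero, mul_one]
  -- The root of norm at least one is `W` or `W⁻¹`, and the latter comes with `-σ`.
  rcases le_total 1 ‖W‖ with h | h
  · refine ⟨⟨(σ, W), h, hW.le, hn⟩, Prod.ext (Subtype.ext ?_) hy⟩
    exact hzz
  · refine ⟨⟨(-σ, W⁻¹), ?_, (inv_re_pos hW).le, ?_⟩, Prod.ext (Subtype.ext ?_) ?_⟩
    · simp only [norm_inv]
      exact (one_le_inv₀ (norm_pos_iff.2 hW0)).2 h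
    · simp only [inv_inv]
      rwa [norm_sub_rev]
    · simp only [torusPiece, inv_inv]
      rw [← hzz, inv_neg, Circle.coe_neg]
      ring
    · simp only [torusPiece]
      rw [neg_sq, hy]

end charts

section gluing
variable {c : Circle → ℂ} {s₀ : Circle} {r : ℝ}

/-! ### Parameters with the same image -/

theorem conj_eq_inv_of_norm_one {J : ℂ} (h : ‖J‖ = 1) : (starRingEnd ℂ) J = J⁻¹ := by
  rw [Complex.inv_def, Complex.normSq_eq_norm_sq, h]
  simp

theorem squash_inv {J : ℂ} (h : ‖J‖ = 1) : squash J⁻¹ = squash J := by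
  rw [squash_of_le (by simp [h]) (by simp [h]), squash_of_le h.ge (by linarith), inv_inv, add_comm]

theorem cosquash_inv {J : ℂ} (h : ‖J‖ = 1) : cosquash J⁻¹ = -cosquash J := by
  rw [cosquash_of_le (by simp [h]) (by simp [h]), cosquash_of_le h.ge (by linarith), inv_inv,
    neg_sub]

theorem dir_inv {J : ℂ} (h : J ≠ 0) : dir J⁻¹ = (dir J)⁻¹ := by
  rw [eq_inv_iff_mul_eq_one, ← dir_mul (inv_ne_zero h) h, inv_mul_cancel₀ h]
  exact_mod_cast dir_ofReal one_pos

theorem fibreAngle_inv {J : ℂ} (h : J ≠ 0) : fibreAngle J⁻¹ = (fibreAngle J)⁻¹ := by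
  rw [fibreAngle, fibreAngle, dir_inv h, inv_pow]

/-- Points with the same radius and the same or opposite fibre coordinate. -/
theorem eq_or_eq_neg_of_fibreAngle_eq {J K : ℂ} (hn : ‖K‖ = ‖J‖)
    (h : fibreAngle K = fibreAngle J) : K = J ∨ K = -J := by
  rw [fibreAngle, fibreAngle, inv_inj, sq_eq_sq_iff_circle] at h
  rw [← norm_mul_dir K, ← norm_mul_dir J, hn]
  rcases h with h | h
  · exact Or.inl (by rw [h])
  · exact Or.inr (by rw [h, Circle.coe_neg, mul_neg])

/-- The two sides of the slit are exchanged by `J ↦ J⁻¹`. -/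
theorem inv_mem_exteriorChart {J : ℂ} {s : Circle} (hn : ‖J‖ = 1)
    (h : (J, s) ∈ exteriorChart s₀) : (J⁻¹, s) ∈ exteriorChart s₀ := by
  have h1 : ‖J⁻¹‖ = 1 := by rw [norm_inv, hn, inv_one]
  refine ⟨h1.ge, ?_, abs_le_of_norm_lt ?_⟩
  · rw [squash_inv hn]
    exact h.2.1
  · rw [norm_frame_mul, h1]
    norm_num

theorem exteriorPoint_inv {J : ℂ} {s : Circle} (hn : ‖J‖ = 1) (h : (J, s) ∈ exteriorChart s₀) :
    exteriorPoint s₀ J⁻¹ s = -exteriorPoint s₀ J s := by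
  rw [exteriorPoint, exteriorPoint, norm_inv, hn, inv_one, cosquash_inv hn,
    dir_neg (cosquash_ne_zero_of_mem h), mul_neg, Circle.coe_neg, mul_neg]

theorem norm_exteriorPoint {J : ℂ} (hJ : 1 ≤ ‖J‖) (s : Circle) :
    ‖exteriorPoint s₀ J s‖ = collarRadius ‖J‖ := norm_collarRadius_mul hJ _

theorem norm_torusPoint {W : ℂ} (hW : 1 ≤ ‖W‖) (σ : Circle) :
    ‖torusPoint σ W‖ = collarRadius ‖W ^ 2‖ := norm_collarRadius_mul (one_le_norm_sq hW) _

theorem exteriorModel_inv {J : ℂ} {s : Circle} (hn : ‖J‖ = 1) (h : (J, s) ∈ exteriorChart s₀) :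
    exteriorModel ⟨(J⁻¹, s), inv_mem_exteriorChart hn h⟩ = exteriorModel ⟨(J, s), h⟩ := by
  refine (modelMap_eq_iff.2 (Or.inr (Or.inr ⟨?_, ?_, ?_⟩))).symm
  · exact (norm_exteriorPoint h.1 s).trans (by simp only [hn]; exact collarRadius_one)
  · exact exteriorPoint_inv hn h
  · exact fibreAngle_inv (ne_zero_of_one_le_norm h.1)

theorem exteriorPiece_inv (hr : IsTubeRadius c r) {J : ℂ} {s : Circle} (hn : ‖J‖ = 1)
    (h : (J, s) ∈ exteriorChart s₀) :
    exteriorPiece hr ⟨(J⁻¹, s), inv_mem_exteriorChart hn h⟩ = exteriorPiece hr ⟨(J, s), h⟩ := by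
  refine Subtype.ext ?_
  simp only [exteriorPiece, slicePosition]
  rw [squash_inv hn]

theorem torusPoint_inv {σ : Circle} {W : ℂ} (hn : ‖W‖ = 1) :
    torusPoint (-σ) W⁻¹ = -torusPoint σ W := by
  rw [torusPoint, torusPoint, inv_pow, norm_inv, norm_pow, hn, one_pow, inv_one, inv_inv,
    add_comm W⁻¹, inv_neg, neg_mul, Circle.coe_neg, mul_neg]

theorem torusModel_inv {σ : Circle} {W : ℂ} (hn : ‖W‖ = 1) (h : (σ, W) ∈ torusChart) :
    torusModel ⟨(-σ, W⁻¹), inv_mem_torusChart hn h⟩ = torusModel ⟨(σ, W), h⟩ := by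
  have hW := ne_zero_of_one_le_norm h.1
  refine (modelMap_eq_iff.2 (Or.inr (Or.inr ⟨?_, ?_, ?_⟩))).symm
  · refine (norm_torusPoint h.1 σ).trans ?_
    simp only [norm_pow, hn, one_pow]
    exact collarRadius_one
  · exact torusPoint_inv hn
  · simp only [inv_pow]
    exact fibreAngle_inv (pow_ne_zero 2 hW)

theorem torusPiece_inv {σ : Circle} {W : ℂ} (hn : ‖W‖ = 1) (h : (σ, W) ∈ torusChart) :
    torusPiece s₀ ⟨(-σ, W⁻¹), inv_mem_torusChart hn h⟩ = torusPiece s₀ ⟨(σ, W), h⟩ := by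
  refine Prod.ext (Subtype.ext ?_) ?_
  · simp only [torusPiece, inv_inv]
    rw [inv_neg, Circle.coe_neg]
    ring
  · simp only [torusPiece, neg_sq]

/-! ### The maps to the model respect the identifications -/

/-- To compare two parameters over the same slice, one may assume that they have the same `s`. -/
theorem exterior_wlog {P : exteriorChart s₀ → Prop} {J : ℂ} {s t : Circle}
    (h : (J, s) ∈ exteriorChart s₀) (hst : s ^ 2 = t ^ 2)
    (hP : ∀ (J : ℂ) (h : (J, s) ∈ exteriorChart s₀), P ⟨(-J, -s), neg_mem_exteriorChart h⟩ →
      P ⟨(J, s), h⟩)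
    (hs : ∀ (J : ℂ) (h : (J, t) ∈ exteriorChart s₀), P ⟨(J, t), h⟩) : P ⟨(J, s), h⟩ := by
  rcases sq_eq_sq_iff_circle.1 hst with rfl | rfl
  · exact hs J h
  · apply hP
    have h' := neg_mem_exteriorChart h
    have e : (⟨(-J, - -t), h'⟩ : exteriorChart s₀) = ⟨(-J, t), by rwa [neg_neg] at h'⟩ :=
      Subtype.ext (by simp only [neg_neg])
    rw [e]
    exact hs _ _

theorem eight_le_norm_of_abs_re {J : ℂ} {s : Circle} (hJ : 1 ≤ ‖J‖)
    (h : |(exteriorPoint s₀ J s).re| = Real.pi) : 8 ≤ ‖J‖ := by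
  have h1 := Complex.abs_re_le_norm (exteriorPoint s₀ J s)
  rw [h, norm_exteriorPoint hJ] at h1
  by_contra! h8
  linarith [collarRadius_le_one h8.le, one_lt_pi]

/-- Over the vertical sides of the rectangle, the model coordinate is the one of the slice. -/
theorem seam_iff (hr : IsTubeRadius c r) {J K : ℂ} {s : Circle} (hJ : (J, s) ∈ exteriorChart s₀)
    (hK : (K, s) ∈ exteriorChart s₀) :
    ((position c s₀ r s (squash J)).re = Real.pi ∧ (position c s₀ r s (squash K)).re = -Real.pi ∧
      (position c s₀ r s (squash J)).im = (position c s₀ r s (squash K)).im) ↔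
    ((exteriorPoint s₀ J s).re = Real.pi ∧ (exteriorPoint s₀ K s).re = -Real.pi ∧
      (exteriorPoint s₀ J s).im = (exteriorPoint s₀ K s).im) := by
  have hpi := Real.pi_pos
  have hone := one_lt_pi
  rw [position_seam_iff hr s hJ.2.1 hK.2.1]
  have far1 : ∀ {J : ℂ}, 1 ≤ ‖J‖ → |(2 * frame s₀ s * squash J : ℂ).re| = 8 * Real.pi →
      8 ≤ ‖J‖ := by
    intro J hJ h
    have e : (2 * frame s₀ s * squash J : ℂ) = frame s₀ s * (2 * squash J) := by ring
    have h1 := Complex.abs_re_le_norm (2 * frame s₀ s * squash J : ℂ)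
    rw [h, e, norm_frame_mul] at h1
    rcases le_total 4 ‖J‖ with h4 | h4
    · rw [two_squash_of_four_le h4] at h1
      linarith
    · linarith [norm_two_squash_le_four hJ h4]
  have key : 8 ≤ ‖J‖ → 8 ≤ ‖K‖ → (((2 * frame s₀ s * squash J : ℂ).re = 8 * Real.pi ∧
      (2 * frame s₀ s * squash K : ℂ).re = -(8 * Real.pi) ∧
      (2 * frame s₀ s * squash J : ℂ).im = (2 * frame s₀ s * squash K : ℂ).im) ↔
      ((exteriorPoint s₀ J s).re = Real.pi ∧ (exteriorPoint s₀ K s).re = -Real.pi ∧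
      (exteriorPoint s₀ J s).im = (exteriorPoint s₀ K s).im)) := by
    intro hJ8 hK8
    have e : ∀ {J : ℂ}, 8 ≤ ‖J‖ →
        (2 * frame s₀ s * squash J : ℂ) = ((8 : ℝ) : ℂ) * exteriorPoint s₀ J s := by
      intro J h
      have := two_squash_of_four_le (J := J) (by linarith)
      rw [exteriorPoint_of_ge h]
      push_cast
      linear_combination (frame s₀ s : ℂ) * this
    rw [e hJ8, e hK8, Complex.re_ofReal_mul, Complex.re_ofReal_mul, Complex.im_ofReal_mul,
      Complex.im_ofReal_mul]
    constructor
    · rintro ⟨h1, h2, h3⟩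
      exact ⟨by linarith, by linarith, by linarith⟩
    · rintro ⟨h1, h2, h3⟩
      exact ⟨by linarith, by linarith, by linarith⟩
  constructor
  · rintro ⟨h1, h2, h3⟩
    refine (key (far1 hJ.1 ?_) (far1 hK.1 ?_)).1 ⟨h1, h2, h3⟩
    · rw [h1, abs_of_pos (by linarith)]
    · rw [h2, abs_neg, abs_of_pos (by linarith)]
  · rintro ⟨h1, h2, h3⟩
    refine (key (eight_le_norm_of_abs_re (s₀ := s₀) (s := s) hJ.1 ?_)
      (eight_le_norm_of_abs_re (s₀ := s₀) (s := s) hK.1 ?_)).2 ⟨h1, h2, h3⟩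
    · rw [h1, abs_of_pos hpi]
    · rw [h2, abs_neg, abs_of_pos hpi]

/-- Over the vertical sides, the fibre coordinate of the untwisted trivialisation is the square of
the frame, and determines the slice. -/
theorem fibreAngle_mul_dir_sq {J : ℂ} {s : Circle} (h : 8 ≤ ‖J‖) :
    fibreAngle J * dir (exteriorPoint s₀ J s) ^ 2 = frame s₀ s ^ 2 := by
  have hJ : J ≠ 0 := by rintro rfl; norm_num at h
  rw [exteriorPoint, cosquash_of_four_le (by linarith),
    dir_real_mul (collarRadius_pos (by linarith)), fibreAngle, mul_pow, mul_left_comm,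
    inv_mul_cancel, mul_one]

theorem abs_re_of_seam {p q : ℂ} (h : Seam p q) : |p.re| = Real.pi ∧ |q.re| = Real.pi := by
  obtain ⟨-, ⟨h1, h2⟩ | ⟨h1, h2⟩⟩ := h <;> rw [h1, h2, abs_neg, abs_of_pos Real.pi_pos] <;>
    exact ⟨rfl, rfl⟩

theorem exteriorModel_eq_of_piece_eq (hr : IsTubeRadius c r) {k l : exteriorChart s₀}
    (h : exteriorPiece hr k = exteriorPiece hr l) : exteriorModel k = exteriorModel l := by
  obtain ⟨⟨J, s⟩, hk⟩ := k
  obtain ⟨⟨K, t⟩, hl⟩ := l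
  have hst : s ^ 2 = t ^ 2 := congrArg (fun x => x.1.1.1) h
  revert h
  refine exterior_wlog (P := fun k => exteriorPiece hr k = exteriorPiece hr ⟨(K, t), hl⟩ →
    exteriorModel k = exteriorModel ⟨(K, t), hl⟩) hk hst ?_ ?_
  · intro J h
    rw [exteriorPiece_neg, exteriorModel_neg]
    exact id
  · intro J hk h
    have h1 : slicePosition c s₀ r J t = slicePosition c s₀ r K t := congrArg Subtype.val h
    rw [slicePosition, slicePosition, slicePoint, slicePoint, Prod.mk.injEq, Prod.mk.injEq,
      circle_exp_eq_iff (abs_position_le hr hk).1 (abs_position_le hr hl).1] at h1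
    obtain ⟨⟨-, h1⟩, h2⟩ := h1
    -- The points may agree because of the identification of the vertical sides of the slice.
    have seam : ∀ {J K : ℂ} (hk : (J, t) ∈ exteriorChart s₀) (hl : (K, t) ∈ exteriorChart s₀),
        (position c s₀ r t (squash J)).re = Real.pi ∧
        (position c s₀ r t (squash K)).re = -Real.pi ∧
        (position c s₀ r t (squash J)).im = (position c s₀ r t (squash K)).im →
        exteriorModel ⟨(J, t), hk⟩ = exteriorModel ⟨(K, t), hl⟩ := by
      intro J K hk hl h
      obtain ⟨h3, h4, h5⟩ := (seam_iff hr hk hl).1 h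
      refine modelMap_eq_iff.2 (Or.inr (Or.inl ⟨⟨h5, Or.inl ⟨h3, h4⟩⟩, ?_⟩))
      simp only
      rw [fibreAngle_mul_dir_sq, fibreAngle_mul_dir_sq]
      · refine eight_le_norm_of_abs_re hl.1 (s := t) (s₀ := s₀) ?_
        rw [h4, abs_neg, abs_of_pos Real.pi_pos]
      · refine eight_le_norm_of_abs_re hk.1 (s := t) (s₀ := s₀) ?_
        rw [h3, abs_of_pos Real.pi_pos]
    rcases h1 with h1 | ⟨h1, h3⟩ | ⟨h1, h3⟩
    · have h3 := position_injective hr t hk.2.1 hl.2.1 (Complex.ext h1 h2)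
      rcases squash_injective hk.1 hl.1 h3 with rfl | ⟨h4, h5⟩
      · rfl
      · rw [conj_eq_inv_of_norm_one h4] at h5
        simp only at h5
        subst h5
        exact (exteriorModel_inv h4 hk).symm
    · exact seam hk hl ⟨h1, h3, h2⟩
    · exact (seam hl hk ⟨h3, h1, h2.symm⟩).symm

theorem torusModel_eq_of_piece_eq {k l : torusChart} (h : torusPiece s₀ k = torusPiece s₀ l) :
    torusModel k = torusModel l := by
  obtain ⟨⟨σ, W⟩, hk⟩ := k
  obtain ⟨⟨τ, V⟩, hl⟩ := l
  have h1 : (W - W⁻¹) * (σ⁻¹ : Circle) = (V - V⁻¹) * (τ⁻¹ : Circle) :=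
    congrArg (fun y : SolidTorus => (y.1 : ℂ)) h
  have h2 : circleI * s₀ * σ ^ 2 = circleI * s₀ * τ ^ 2 := congrArg Prod.snd h
  have hW := re_pos_of_mem_torusChart hk
  have hV := re_pos_of_mem_torusChart hl
  rcases sq_eq_sq_iff_circle.1 (mul_left_cancel h2) with rfl | rfl
  · obtain rfl := eq_of_sub_inv_eq hW hV (mul_right_cancel₀ (Circle.coe_ne_zero _) h1)
    rfl
  · rw [inv_neg, Circle.coe_neg, mul_neg, ← neg_mul] at h1
    have h3 := mul_right_cancel₀ (Circle.coe_ne_zero _) h1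
    have h4 : V⁻¹ = W := by
      refine eq_of_sub_inv_eq (inv_re_pos hV) hW ?_
      rw [inv_inv, ← neg_sub V, ← h3, neg_neg]
    subst h4
    have h5 := hk.1
    have h6 := hl.1
    simp only [norm_inv] at h5 h6
    have h7 : ‖V‖ = 1 := le_antisymm ((one_le_inv₀ (zero_lt_one.trans_le h6)).1 h5) h6
    exact torusModel_inv h7 hl

end gluing

section gluing
variable {c : Circle → ℂ} {s₀ : Circle} {r : ℝ}

/-! ### The gluing along the boundary of the tube -/

theorem frame_eq_iff {s u : Circle} : frame s₀ s = u⁻¹ ↔ s = u * (circleI * s₀) := by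
  rw [frame, eq_inv_iff_mul_eq_one, mul_assoc, mul_comm s⁻¹, ← mul_assoc, mul_inv_eq_one,
    mul_comm _ u, eq_comm]

/-- The points glued to the boundary point of the solid torus with the parameters `(σ, W)`. The
condition on the frame says that `s = z * (i s₀ σ²)`, as in the gluing with coefficient `1`. -/
theorem slicePosition_eq_tube_iff (hr : IsTubeRadius c r) {J W : ℂ} {s σ z : Circle}
    (hk : (J, s) ∈ exteriorChart s₀) (hl : (σ, W) ∈ torusChart)
    (hz : (W - W⁻¹) = z * σ) (hs : frame s₀ s = (z * σ ^ 2)⁻¹) :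
    slicePosition c s₀ r J s = braidTube c r (z, s) ↔ squash J = squash (W ^ 2) := by
  rw [slicePosition, braidTube,
    slicePoint_eq_iff (abs_position_le hr hk).1 (abs_re_add_mul_lt hr s (Circle.norm_coe z).le),
    position_eq_boundary_iff hr s hk.2.1, squash_sq hl, hz, hs, and_iff_right rfl]
  have h1 : (1 + (z : ℂ) / (2 * ((z * σ ^ 2)⁻¹ : Circle))) = 1 + (z * σ : ℂ) ^ 2 / 2 := by
    have := z.coe_ne_zero
    have := σ.coe_ne_zero
    rw [Circle.coe_inv, Circle.coe_mul, Circle.coe_pow]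
    field_simp
  rw [h1]

theorem dir_cosquash_sq {W : ℂ} {σ z : Circle} (hl : (σ, W) ∈ torusChart)
    (hz : (W - W⁻¹) = z * σ) : dir (cosquash (W ^ 2)) = z * σ * dir (W + W⁻¹) := by
  rw [cosquash_sq hl, hz, ← Circle.coe_mul,
    dir_circle_mul _ (add_inv_ne_zero (ne_zero_of_one_le_norm hl.1) hl.2.2)]

/-- At the boundary of the tube, the points of the model plane agree if and only if the slices are
related as in the gluing. -/
theorem exteriorPoint_eq_torusPoint_iff {W : ℂ} {s σ z : Circle} (hl : (σ, W) ∈ torusChart)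
    (hz : (W - W⁻¹) = z * σ) :
    frame s₀ s * dir (cosquash (W ^ 2)) = σ⁻¹ * dir (W + W⁻¹) ↔
      frame s₀ s = (z * σ ^ 2)⁻¹ := by
  rw [dir_cosquash_sq hl hz, ← mul_assoc, mul_left_inj, eq_inv_iff_mul_eq_one,
    eq_inv_iff_mul_eq_one, pow_two]
  simp only [mul_assoc]

/-- The maps to the model agree where the two pieces are glued. -/
theorem model_eq_of_surgeryRel (hr : IsTubeRadius c r) {k : exteriorChart s₀} {l : torusChart}
    (h : SurgeryRel thickTorus (braidTube c r) 1 (Sum.inl (exteriorPiece hr k))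
      (Sum.inr (torusPiece s₀ l))) : exteriorModel k = torusModel l := by
  obtain ⟨⟨J, s⟩, hk⟩ := k
  obtain ⟨⟨σ, W⟩, hl⟩ := l
  obtain ⟨-, -, z, hz, he⟩ := h
  have hzW : W - W⁻¹ = z * σ := by
    have h1 : (W - W⁻¹) * (σ⁻¹ : Circle) = z := hz
    rw [← h1, Circle.coe_inv, mul_assoc, inv_mul_cancel₀ σ.coe_ne_zero, mul_one]
  obtain ⟨t, ht⟩ : ∃ t, t = z ^ (1 : ℤ) * (circleI * s₀ * σ ^ 2) := ⟨_, rfl⟩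
  have hframe : frame s₀ t = (z * σ ^ 2)⁻¹ := by
    rw [frame_eq_iff, ht, zpow_one]
    simp only [mul_comm, mul_left_comm]
  have he : slicePosition c s₀ r J s = braidTube c r (z, t) := by rw [ht]; exact he
  have hst : s ^ 2 = t ^ 2 := congrArg (fun x => x.1.1) he
  revert he
  refine exterior_wlog (P := fun k => slicePosition c s₀ r k.1.1 k.1.2 = braidTube c r (z, t) →
    exteriorModel k = torusModel ⟨(σ, W), hl⟩) hk hst ?_ ?_
  · intro J h
    rw [slicePosition_neg, exteriorModel_neg]
    exact id
  · intro J hk he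
    have h1 := (slicePosition_eq_tube_iff hr hk hl hzW hframe).1 he
    have core : ∀ hk' : (W ^ 2, t) ∈ exteriorChart s₀,
        exteriorModel ⟨(W ^ 2, t), hk'⟩ = torusModel ⟨(σ, W), hl⟩ := by
      intro hk'
      refine modelMap_eq_iff.2 (Or.inl ⟨?_, rfl⟩)
      simp only [exteriorPoint, torusPoint]
      rw [(exteriorPoint_eq_torusPoint_iff hl hzW).2 hframe]
    -- `J` is `W²`, or on the other side of the slit.
    rcases squash_injective hk.1 (one_le_norm_sq hl.1) h1 with h2 | ⟨h2, h3⟩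
    · simp only at h2
      subst h2
      exact core hk
    · simp only at h2 h3
      rw [conj_eq_inv_of_norm_one h2] at h3
      have h4 := inv_mem_exteriorChart h2 hk
      rw [← exteriorModel_inv h2 hk]
      have e : (⟨(J⁻¹, t), h4⟩ : exteriorChart s₀) = ⟨(W ^ 2, t), by rwa [h3]⟩ :=
        Subtype.ext (by simp only [h3])
      rw [e]
      exact core _

/-! ### The model makes no further identifications -/

theorem collarRadius_mul_eq_iff {x y : ℝ} (hx : 1 ≤ x) (hy : 1 ≤ y) {v w : Circle} :
    (collarRadius x * v : ℂ) = collarRadius y * w ↔ x = y ∧ v = w := by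
  constructor
  · intro h
    have h1 := congrArg norm h
    rw [norm_collarRadius_mul hx, norm_collarRadius_mul hy] at h1
    obtain rfl := collarRadius_strictMono.injective h1
    refine ⟨rfl, Circle.ext (mul_left_cancel₀ ?_ h)⟩
    exact_mod_cast (collarRadius_pos hx).ne'
  · rintro ⟨rfl, rfl⟩
    rfl

theorem norm_eq_one_of_norm_exteriorPoint {J : ℂ} {s : Circle} (hJ : 1 ≤ ‖J‖)
    (h : ‖exteriorPoint s₀ J s‖ = holeRadius) : ‖J‖ = 1 := by
  rw [norm_exteriorPoint hJ, ← collarRadius_one] at h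
  exact collarRadius_strictMono.injective h

theorem norm_eq_one_of_norm_torusPoint {W : ℂ} {σ : Circle} (hW : 1 ≤ ‖W‖)
    (h : ‖torusPoint σ W‖ = holeRadius) : ‖W‖ = 1 := by
  rw [norm_torusPoint hW, ← collarRadius_one] at h
  have h1 := collarRadius_strictMono.injective h
  rw [norm_pow] at h1
  exact le_antisymm (by nlinarith) hW

theorem exteriorPiece_eq_of_point_eq (hr : IsTubeRadius c r) {J K : ℂ} {s t : Circle}
    (hk : (J, s) ∈ exteriorChart s₀) (hl : (K, t) ∈ exteriorChart s₀)
    (h1 : exteriorPoint s₀ K t = exteriorPoint s₀ J s) (h2 : fibreAngle K = fibreAngle J) :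
    exteriorPiece hr ⟨(J, s), hk⟩ = exteriorPiece hr ⟨(K, t), hl⟩ := by
  have key : ∀ {t : Circle}, exteriorPoint s₀ J t = exteriorPoint s₀ J s → t = s := by
    intro t h
    have h3 := ((collarRadius_mul_eq_iff hk.1 hk.1).1 h).2
    rw [frame, frame] at h3
    exact inv_injective (mul_left_cancel (mul_right_cancel h3))
  have hn := ((collarRadius_mul_eq_iff hl.1 hk.1).1 h1).1
  simp only at hn
  rcases eq_or_eq_neg_of_fibreAngle_eq hn h2 with h3 | h3
  · subst h3
    obtain rfl := key h1
    rfl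
  · subst h3
    have h4 := neg_mem_exteriorChart hl
    have h5 : exteriorPoint s₀ J (-t) = exteriorPoint s₀ J s := by
      rw [← h1, ← exteriorPoint_neg hl, neg_neg]
    have h6 := key h5
    subst h6
    rw [← exteriorPiece_neg hr hl]
    refine Subtype.ext ?_
    simp only [exteriorPiece, neg_neg]

theorem exteriorPiece_eq_of_model_eq (hr : IsTubeRadius c r) {k l : exteriorChart s₀}
    (h : exteriorModel k = exteriorModel l) : exteriorPiece hr k = exteriorPiece hr l := by
  obtain ⟨⟨J, s⟩, hk⟩ := k
  obtain ⟨⟨K, t⟩, hl⟩ := l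
  rcases modelMap_eq_iff.1 h with ⟨h1, h2⟩ | ⟨h1, h2⟩ | ⟨h1, h2, h3⟩
  · exact exteriorPiece_eq_of_point_eq hr hk hl h1.symm h2.symm
  · simp only at h1 h2
    obtain ⟨h3, h4⟩ := abs_re_of_seam h1
    rw [fibreAngle_mul_dir_sq (eight_le_norm_of_abs_re hk.1 h3),
      fibreAngle_mul_dir_sq (eight_le_norm_of_abs_re hl.1 h4), frame, frame, mul_pow _ s⁻¹,
      mul_pow _ t⁻¹, mul_left_cancel_iff, inv_pow, inv_pow, inv_inj] at h2
    revert h1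
    refine exterior_wlog (P := fun k => Seam (exteriorPoint s₀ k.1.1 k.1.2) (exteriorPoint s₀ K t) →
      exteriorPiece hr k = exteriorPiece hr ⟨(K, t), hl⟩) hk h2 ?_ ?_
    · intro J hk
      rw [exteriorPiece_neg, exteriorPoint_neg hk]
      exact id
    · intro J hk h
      have key : ∀ {J K : ℂ} (hk : (J, t) ∈ exteriorChart s₀) (hl : (K, t) ∈ exteriorChart s₀),
          (exteriorPoint s₀ J t).re = Real.pi → (exteriorPoint s₀ K t).re = -Real.pi →
          (exteriorPoint s₀ J t).im = (exteriorPoint s₀ K t).im →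
          exteriorPiece hr ⟨(J, t), hk⟩ = exteriorPiece hr ⟨(K, t), hl⟩ := by
        intro J K hk hl h5 h6 h7
        obtain ⟨h8, h9, h10⟩ := (seam_iff hr hk hl).2 ⟨h5, h6, h7⟩
        refine Subtype.ext ?_
        simp only [exteriorPiece, slicePosition, slicePoint]
        rw [h8, h9, h10, (circle_exp_eq_iff (abs_of_pos Real.pi_pos).le
          (by rw [abs_neg]; exact (abs_of_pos Real.pi_pos).le)).2 (Or.inr (Or.inl ⟨rfl, rfl⟩))]
      obtain ⟨h5, ⟨h6, h7⟩ | ⟨h6, h7⟩⟩ := h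
      · exact key hk hl h6 h7 h5
      · exact (key hl hk h7 h6 h5.symm).symm
  · have hn := norm_eq_one_of_norm_exteriorPoint hk.1 h1
    rw [← exteriorPiece_inv hr hn hk]
    refine exteriorPiece_eq_of_point_eq hr _ hl ?_ ?_
    · rw [exteriorPoint_inv hn hk]
      exact h2
    · rw [fibreAngle_inv (ne_zero_of_one_le_norm hk.1)]
      exact h3

theorem eq_of_torusPoint_eq {W V : ℂ} {σ τ : Circle} (hk : (σ, W) ∈ torusChart)
    (hl : (τ, V) ∈ torusChart) (h1 : torusPoint τ V = torusPoint σ W)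
    (h2 : fibreAngle (V ^ 2) = fibreAngle (W ^ 2)) : τ = σ ∧ V = W := by
  have hW := re_pos_of_mem_torusChart hk
  have hV := re_pos_of_mem_torusChart hl
  obtain ⟨hn, hd⟩ := (collarRadius_mul_eq_iff (one_le_norm_sq hl.1) (one_le_norm_sq hk.1)).1 h1
  simp only at hn hd
  have hVW : V = W := by
    rcases eq_or_eq_neg_of_fibreAngle_eq hn h2 with h | h
    · rcases sq_eq_sq_iff_eq_or_eq_neg.1 h with h | h
      · exact h
      · rw [h, Complex.neg_re] at hV
        linarith
    · have h3 := re_sq_pos hk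
      have h4 := re_sq_pos hl
      rw [h, Complex.neg_re] at h4
      linarith
  subst hVW
  exact ⟨inv_injective (mul_right_cancel hd), rfl⟩

theorem torusPiece_eq_of_model_eq {k l : torusChart} (h : torusModel k = torusModel l) :
    torusPiece s₀ k = torusPiece s₀ l := by
  obtain ⟨⟨σ, W⟩, hk⟩ := k
  obtain ⟨⟨τ, V⟩, hl⟩ := l
  rcases modelMap_eq_iff.1 h with ⟨h1, h2⟩ | ⟨h1, -⟩ | ⟨h1, h2, h3⟩
  · obtain ⟨rfl, rfl⟩ := eq_of_torusPoint_eq hk hl h1.symm h2.symm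
    rfl
  · exfalso
    have h2 := (abs_re_of_seam h1).1
    have h3 := Complex.abs_re_le_norm (torusPoint σ W)
    simp only at h2
    linarith [norm_torusPoint_le_one hk, one_lt_pi]
  · have hn := norm_eq_one_of_norm_torusPoint hk.1 h1
    rw [← torusPiece_inv hn hk]
    obtain ⟨rfl, rfl⟩ := eq_of_torusPoint_eq (inv_mem_torusChart hn hk) hl
      (by rw [torusPoint_inv hn]; exact h2)
      (by rw [inv_pow, fibreAngle_inv (pow_ne_zero 2 (ne_zero_of_one_le_norm hk.1))]; exact h3)
    rfl

theorem surgeryRel_of_point_eq (hr : IsTubeRadius c r) {J W : ℂ} {s σ : Circle}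
    (hk : (J, s) ∈ exteriorChart s₀) (hl : (σ, W) ∈ torusChart)
    (h1 : exteriorPoint s₀ J s = torusPoint σ W) (h2 : fibreAngle J = fibreAngle (W ^ 2)) :
    SurgeryRel thickTorus (braidTube c r) 1 (Sum.inl (exteriorPiece hr ⟨(J, s), hk⟩))
      (Sum.inr (torusPiece s₀ ⟨(σ, W), hl⟩)) := by
  -- After a change of `(J, s)` to `(-J, -s)` one has `J = W²`.
  have core : ∀ {s : Circle} (hk : (W ^ 2, s) ∈ exteriorChart s₀),
      exteriorPoint s₀ (W ^ 2) s = torusPoint σ W →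
      SurgeryRel thickTorus (braidTube c r) 1 (Sum.inl (exteriorPiece hr ⟨(W ^ 2, s), hk⟩))
        (Sum.inr (torusPiece s₀ ⟨(σ, W), hl⟩)) := by
    intro s hk h1
    have hn : ‖W - W⁻¹‖ = 1 := by
      refine le_antisymm hl.2.2 ?_
      have h3 := hk.2.1.1
      simp only at h3
      rw [squash_sq hl, add_sub_cancel_left, norm_div, norm_pow] at h3
      norm_num at h3
      nlinarith [norm_nonneg (W - W⁻¹)]
    obtain ⟨z, hz⟩ : ∃ z : Circle, W - W⁻¹ = z * σ := by
      refine ⟨dir (W - W⁻¹) * σ⁻¹, ?_⟩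
      rw [← Circle.coe_mul, inv_mul_cancel_right]
      nth_rw 1 [← norm_mul_dir (W - W⁻¹), hn]
      simp
    have h3 := ((collarRadius_mul_eq_iff hk.1 (one_le_norm_sq hl.1)).1 h1).2
    have hframe := (exteriorPoint_eq_torusPoint_iff hl hz).1 h3
    have hs : z ^ (1 : ℤ) * (circleI * s₀ * σ ^ 2) = s := by
      rw [frame_eq_iff.1 hframe, zpow_one]
      simp only [mul_comm, mul_left_comm]
    refine SurgeryRel.glue _ _ z ?_ ?_
    · simp only [torusPiece]
      rw [hz, mul_assoc, ← Circle.coe_mul, mul_inv_cancel, Circle.coe_one, mul_one]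
    · simp only [torusPiece]
      rw [hs]
      exact (slicePosition_eq_tube_iff hr hk hl hz hframe).2 rfl
  have hn := ((collarRadius_mul_eq_iff hk.1 (one_le_norm_sq hl.1)).1 h1).1
  simp only at hn
  rcases eq_or_eq_neg_of_fibreAngle_eq hn h2 with h | h
  · subst h
    exact core hk h1
  · subst h
    rw [← exteriorPiece_neg hr hk]
    have h3 := neg_mem_exteriorChart hk
    have e : (⟨(- -W ^ 2, -s), h3⟩ : exteriorChart s₀) = ⟨(W ^ 2, -s), by rwa [neg_neg] at h3⟩ :=
      Subtype.ext (by simp only [neg_neg])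
    rw [e]
    refine core _ ?_
    rw [← h1, ← exteriorPoint_neg hk, neg_neg]

theorem surgeryRel_of_model_eq (hr : IsTubeRadius c r) {k : exteriorChart s₀} {l : torusChart}
    (h : exteriorModel k = torusModel l) :
    SurgeryRel thickTorus (braidTube c r) 1 (Sum.inl (exteriorPiece hr k))
      (Sum.inr (torusPiece s₀ l)) := by
  obtain ⟨⟨J, s⟩, hk⟩ := k
  obtain ⟨⟨σ, W⟩, hl⟩ := l
  rcases modelMap_eq_iff.1 h with ⟨h1, h2⟩ | ⟨h1, -⟩ | ⟨h1, h2, h3⟩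
  · exact surgeryRel_of_point_eq hr hk hl h1 h2
  · exfalso
    have h2 := (abs_re_of_seam h1).2
    have h3 := Complex.abs_re_le_norm (torusPoint σ W)
    simp only at h2
    linarith [norm_torusPoint_le_one hl, one_lt_pi]
  · have hn := norm_eq_one_of_norm_exteriorPoint hk.1 h1
    rw [← exteriorPiece_inv hr hn hk]
    refine surgeryRel_of_point_eq hr _ hl ?_ ?_
    · rw [exteriorPoint_inv hn hk]
      exact h2.symm
    · rw [fibreAngle_inv (ne_zero_of_one_le_norm hk.1)]
      exact h3.symm

/-! ### The charts parametrise the circle bundle -/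

/-- Every point of the circle bundle has parameters: the norm of `p` and the fibre coordinate
determine `J` up to sign, and the direction of `p` determines `s`, or `σ` if `squash J` is too close
to `±1`. -/
theorem exists_parameter (s₀ : Circle) (b : OrientableCircleBundle) :
    (∃ k : exteriorChart s₀, exteriorModel k = b) ∨ ∃ l, torusModel l = b := by
  obtain ⟨⟨⟨p, hp⟩, z⟩, rfl⟩ := modelMap_surjective b
  obtain ⟨ρ, hρ, hρp⟩ := exists_collarRadius_eq hp.2.2
  obtain ⟨ζ, hζ⟩ := exists_sq_eq z⁻¹
  have hp0 : p = collarRadius ρ * dir p := by rw [hρp, norm_mul_dir]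
  have hnorm : ∀ ζ : Circle, ‖(ρ * ζ : ℂ)‖ = ρ := by
    intro ζ
    rw [norm_mul, Circle.norm_coe, mul_one, Complex.norm_real, Real.norm_eq_abs, abs_of_pos]
    linarith
  have hfib : ∀ ζ : Circle, ζ ^ 2 = z⁻¹ → fibreAngle (ρ * ζ) = z := by
    intro ζ hζ
    rw [fibreAngle, dir_real_mul (by linarith), hζ, inv_inv]
  -- The discs about `±1` are covered by the solid torus, with `W` a square root of `J`.
  have near : ∀ ζ : Circle, ζ ^ 2 = z⁻¹ → ‖squash (ρ * ζ) - 1‖ ≤ 1 / 2 →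
      ∃ l, torusModel l = modelMap (⟨p, hp⟩, z) := by
    intro ζ hζ h
    have h1 : 1 ≤ ‖(ρ * ζ : ℂ)‖ := by rwa [hnorm]
    have h3 := norm_le_three_of_squash_near h1 h
    have hJ := ne_zero_of_one_le_norm h1
    obtain ⟨W, hW⟩ : ∃ W : ℂ, W ^ 2 = ρ * ζ := IsAlgClosed.exists_pow_nat_eq _ two_pos
    wlog hre : 0 ≤ W.re generalizing W
    · exact this (-W) (by rw [neg_sq, hW]) (by rw [Complex.neg_re]; linarith)
    have hW0 : W ≠ 0 := by
      rintro rfl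
      rw [zero_pow two_ne_zero] at hW
      exact hJ hW.symm
    have hW1 : 1 ≤ ‖W‖ := by
      rw [← hW, norm_pow] at h1
      exact (one_le_sq_iff₀ (norm_nonneg W)).1 h1
    have hn : ‖W - W⁻¹‖ ≤ 1 := by
      have e : squash (ρ * ζ) - 1 = (W - W⁻¹) ^ 2 / 2 := by
        rw [squash_of_le h1 h3, ← hW]
        field_simp
        ring
      rw [e, norm_div, norm_pow] at h
      norm_num at h
      nlinarith [norm_nonneg (W - W⁻¹)]
    refine ⟨⟨(dir (W + W⁻¹) * (dir p)⁻¹, W), hW1, hre, hn⟩, ?_⟩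
    refine modelMap_eq_iff.2 (Or.inl ⟨?_, ?_⟩)
    · simp only [torusPoint]
      rw [hW, hnorm, mul_inv, inv_inv, mul_comm _ (dir p), inv_mul_cancel_right, ← hp0]
    · simp only
      rw [hW, hfib ζ hζ]
  rcases le_total ‖squash (ρ * ζ) - 1‖ (1 / 2) with h | h
  · exact Or.inr (near ζ hζ h)
  rcases le_total ‖squash (ρ * ζ) + 1‖ (1 / 2) with h' | h'
  · refine Or.inr (near (-ζ) (by rw [neg_sq, hζ]) ?_)
    rwa [Circle.coe_neg, mul_neg, squash_neg, norm_neg_sub_one]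
  have hJ1 : 1 ≤ ‖(ρ * ζ : ℂ)‖ := by rwa [hnorm]
  obtain ⟨s, hs⟩ : ∃ s, frame s₀ s = (dir (cosquash (ρ * ζ)) * (dir p)⁻¹)⁻¹ :=
    ⟨_, frame_eq_iff.2 rfl⟩
  have hpoint : exteriorPoint s₀ (ρ * ζ) s = p := by
    rw [exteriorPoint, hnorm, hs, mul_inv, inv_inv, mul_comm _ (dir p), inv_mul_cancel_right, ← hp0]
  have hmem : (((ρ * ζ : ℂ)), s) ∈ exteriorChart s₀ := by
    refine ⟨hJ1, ⟨h, h'⟩, ?_⟩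
    simp only
    have hpi := one_lt_pi
    rcases le_total 8 ρ with h8 | h8
    · have e : (frame s₀ s * (ρ * ζ) : ℂ) = ((8 : ℝ) : ℂ) * p := by
        rw [← hpoint, exteriorPoint_of_ge (by rwa [hnorm])]
        push_cast
        ring
      rw [e, Complex.re_ofReal_mul, Complex.im_ofReal_mul, abs_mul, abs_mul,
        abs_of_pos (by norm_num : (0 : ℝ) < 8)]
      exact ⟨by linarith [hp.1], by linarith [hp.2.1]⟩
    · have h1 := Complex.abs_re_le_norm (frame s₀ s * (ρ * ζ) : ℂ)
      have h2 := Complex.abs_im_le_norm (frame s₀ s * (ρ * ζ) : ℂ)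
      rw [norm_frame_mul, hnorm] at h1 h2
      exact ⟨by linarith, by linarith⟩
  refine Or.inl ⟨⟨(ρ * ζ, s), hmem⟩, modelMap_eq_iff.2 (Or.inl ⟨hpoint, hfib ζ hζ⟩)⟩

end gluing

section orbit
variable {c : Circle → ℂ} {s₀ : Circle} {r : ℝ}

/-! ### The orbit segment -/

theorem circleI_sq : circleI ^ 2 = -1 := by
  apply Circle.ext
  rw [Circle.coe_pow, coe_circleI, Complex.I_sq, Circle.coe_neg, Circle.coe_one]

theorem dir_sq_of_re_eq_zero {x : ℂ} (hx : x ≠ 0) (h : x.re = 0) : dir x ^ 2 = -1 := by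
  apply Circle.ext
  have h1 : (‖x‖ : ℂ) ^ 2 = -x ^ 2 := by
    have h2 : x = x.im * Complex.I := Complex.ext (by simp [h]) (by simp)
    rw [← Complex.ofReal_pow, ← Complex.normSq_eq_norm_sq, Complex.normSq_apply, h]
    nth_rw 3 [h2]
    rw [mul_pow, Complex.I_sq]
    push_cast
    ring
  rw [Circle.coe_pow, coe_dir hx, div_pow, h1, Circle.coe_neg, Circle.coe_one, div_neg,
    div_self (pow_ne_zero 2 hx)]

/-- The central fibre lies over the points `± holeRadius` of the model plane. -/
theorem collarRadius_mul_central_iff {ρ : ℝ} (hρ : 1 ≤ ρ) {w : Circle} :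
    ((collarRadius ρ * w : ℂ) = holeRadius ∨ (collarRadius ρ * w : ℂ) = -holeRadius) ↔
      ρ = 1 ∧ w ^ 2 = 1 := by
  have h1 : (holeRadius : ℂ) = collarRadius 1 * (1 : Circle) := by
    rw [collarRadius_one, Circle.coe_one, mul_one]
  have h2 : (-holeRadius : ℂ) = collarRadius 1 * (-1 : Circle) := by
    rw [collarRadius_one, Circle.coe_neg, Circle.coe_one, mul_neg, mul_one]
  rw [h2, h1, collarRadius_mul_eq_iff hρ le_rfl, collarRadius_mul_eq_iff hρ le_rfl, ← and_or_left,
    ← sq_eq_sq_iff_circle, one_pow]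

theorem sub_inv_re {J : ℂ} (h : ‖J‖ = 1) : (J - J⁻¹).re = 0 := by
  rw [← conj_eq_inv_of_norm_one h, Complex.sub_re, Complex.conj_re, sub_self]

theorem exteriorModel_mem_fibre_iff {J : ℂ} {s : Circle} (h : (J, s) ∈ exteriorChart s₀) :
    exteriorModel ⟨(J, s), h⟩ ∈ bundleProj ⁻¹' {(Quot.mk _ centralPoint : RP2MinusTwoDiscs)} ↔
      ‖J‖ = 1 ∧ s ^ 2 = s₀ ^ 2 := by
  refine modelMap_mem_central_fibre_iff.trans ((collarRadius_mul_central_iff h.1).trans ?_)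
  refine and_congr_right fun hn => ?_
  simp only at hn
  have h1 : (cosquash J).re = 0 := by
    rw [cosquash_of_le hn.ge (by linarith)]
    exact sub_inv_re hn
  simp only
  rw [mul_pow, dir_sq_of_re_eq_zero (cosquash_ne_zero_of_mem h) h1, frame, mul_pow, mul_pow,
    circleI_sq, neg_one_mul, neg_mul, neg_mul_neg, mul_one, inv_pow, mul_inv_eq_one, eq_comm]

theorem torusModel_mem_fibre_iff {σ : Circle} {W : ℂ} (h : (σ, W) ∈ torusChart) :
    torusModel ⟨(σ, W), h⟩ ∈ bundleProj ⁻¹' {(Quot.mk _ centralPoint : RP2MinusTwoDiscs)} ↔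
      ‖W‖ = 1 ∧ σ ^ 2 = 1 := by
  refine modelMap_mem_central_fibre_iff.trans
    ((collarRadius_mul_central_iff (one_le_norm_sq h.1)).trans ?_)
  simp only
  rw [norm_pow, pow_eq_one_iff_of_nonneg (norm_nonneg W) two_ne_zero]
  refine and_congr_right fun hn => ?_
  have h1 : W + W⁻¹ = ((2 * W.re : ℝ) : ℂ) := by
    rw [← conj_eq_inv_of_norm_one hn, Complex.add_conj]
  rw [h1, dir_ofReal (by linarith [re_pos_of_mem_torusChart h]), mul_one, inv_pow, inv_eq_one]

/-- The segment `[-1, 1]` is the slit. -/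
theorem exists_squash_eq_ofReal_iff {J : ℂ} (hJ : 1 ≤ ‖J‖) :
    (∃ t : ℝ, |t| ≤ 1 ∧ squash J = t) ↔ ‖J‖ = 1 := by
  have key : ∀ {J : ℂ}, ‖J‖ = 1 → squash J = J.re := by
    intro J h
    rw [squash_of_le h.ge (by linarith), ← conj_eq_inv_of_norm_one h, Complex.add_conj]
    push_cast
    ring
  constructor
  · rintro ⟨t, ht, h⟩
    have h1 : 0 ≤ 1 - t ^ 2 := by
      rw [abs_le] at ht
      nlinarith
    set K : ℂ := ⟨t, √(1 - t ^ 2)⟩ with hK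
    have h2 : ‖K‖ = 1 := by
      rw [Complex.norm_eq_sqrt_sq_add_sq, hK, Real.sq_sqrt h1]
      simp
    have h3 : squash K = squash J := by rw [key h2, h]
    rcases squash_injective h2.ge hJ h3 with rfl | ⟨-, rfl⟩
    · exact h2
    · rwa [Complex.norm_conj]
  · intro h
    exact ⟨J.re, (Complex.abs_re_le_norm J).trans h.le, key h⟩

/-- The points of the slice on the orbit segment. -/
theorem mem_segment_iff (hc : IsNegativeTwoBraid c s₀) {x : ℂ} :
    (x.re = (c s₀).re ∧ (c (-s₀)).im ≤ x.im ∧ x.im ≤ (c s₀).im) ↔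
      ∃ t : ℝ, |t| ≤ 1 ∧ x = mid c s₀ + t * (gap c s₀ / 2) := by
  have h1 := hc.re_crossing
  have h2 := hc.im_crossing
  have e : ∀ t : ℝ, mid c s₀ + t * (gap c s₀ / 2) =
      ⟨(c s₀).re, ((c s₀).im + (c (-s₀)).im) / 2 + t * (((c s₀).im - (c (-s₀)).im) / 2)⟩ := by
    intro t
    have h3 : c s₀ = ⟨(c s₀).re, (c s₀).im⟩ := rfl
    have e1 : mid c s₀ = ⟨(c s₀).re, ((c s₀).im + (c (-s₀)).im) / 2⟩ := by
      rw [mid, show (2 : ℂ) = ((2 : ℝ) : ℂ) by norm_num]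
      apply Complex.ext
      · rw [Complex.div_ofReal_re, Complex.add_re, ← h1, add_self_div_two]
      · rw [Complex.div_ofReal_im, Complex.add_im]
    rw [e1, gap_crossing hc]
    apply Complex.ext
    · rw [Complex.add_re, Complex.re_ofReal_mul, show (2 : ℂ) = ((2 : ℝ) : ℂ) by norm_num,
        Complex.div_ofReal_re, Complex.re_ofReal_mul, Complex.I_re]
      simp
    · rw [Complex.add_im, Complex.im_ofReal_mul, show (2 : ℂ) = ((2 : ℝ) : ℂ) by norm_num,
        Complex.div_ofReal_im, Complex.im_ofReal_mul, Complex.I_im, mul_one]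
  constructor
  · rintro ⟨h3, h4, h5⟩
    have h6 : 0 < ((c s₀).im - (c (-s₀)).im) / 2 := by linarith
    refine ⟨(x.im - ((c s₀).im + (c (-s₀)).im) / 2) / (((c s₀).im - (c (-s₀)).im) / 2), ?_, ?_⟩
    · rw [abs_le, le_div_iff₀ h6, div_le_iff₀ h6]
      constructor <;> linarith
    · rw [e, div_mul_cancel₀ _ h6.ne']
      exact Complex.ext h3 (by simp)
  · rintro ⟨t, ht, rfl⟩
    rw [e]
    rw [abs_le] at ht
    refine ⟨rfl, ?_, ?_⟩ <;> simp only <;> nlinarith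

theorem slicePosition_mem_orbitSegment_iff (hc : IsNegativeTwoBraid c s₀) (hr : IsTubeRadius c r)
    {J : ℂ} {s : Circle} (h : (J, s) ∈ exteriorChart s₀) :
    slicePosition c s₀ r J s ∈ orbitSegment c s₀ ↔ ‖J‖ = 1 ∧ s ^ 2 = s₀ ^ 2 := by
  have hfst : ∀ x : (Circle × Circle) × ℝ, x ∈ orbitSegment c s₀ → x.1.1 = s₀ ^ 2 := by
    rintro x ⟨hx, -⟩
    exact congrArg Prod.fst hx
  by_cases hs : s ^ 2 = s₀ ^ 2
  swap
  · exact iff_of_false (fun h' => hs (hfst _ h')) fun h' => hs h'.2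
  refine exterior_wlog (P := fun k => slicePosition c s₀ r k.1.1 k.1.2 ∈ orbitSegment c s₀ ↔
    ‖k.1.1‖ = 1 ∧ s ^ 2 = s₀ ^ 2) h hs ?_ ?_
  · intro J h
    rw [slicePosition_neg, norm_neg]
    exact id
  · intro J h
    rw [and_iff_left hs, ← exists_squash_eq_ofReal_iff h.1,
      ← position_crossing_mem_segment_iff hc hr h.2.1, ← mem_segment_iff hc, orbitSegment,
      Set.mem_prod, Set.mem_singleton_iff, slicePosition, braidCurve, slicePoint, slicePoint,
      Prod.mk.injEq, and_iff_right rfl,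
      circle_exp_eq_iff (abs_position_le hr h).1 (hc.abs_re_lt s₀).le]
    refine and_congr (or_iff_left ?_) Iff.rfl
    have h1 := hc.abs_re_lt s₀
    rintro (⟨-, h2⟩ | ⟨-, h2⟩) <;> rw [h2] at h1
    · rw [abs_neg, abs_of_pos Real.pi_pos] at h1
      exact lt_irrefl _ h1
    · rw [abs_of_pos Real.pi_pos] at h1
      exact lt_irrefl _ h1

theorem torusPiece_mem_diameter_iff {σ : Circle} {W : ℂ} (h : (σ, W) ∈ torusChart) :
    (((torusPiece s₀ ⟨(σ, W), h⟩).1 : ℂ).re = 0 ∧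
      ((torusPiece s₀ ⟨(σ, W), h⟩).2 : ℂ) = Complex.I * s₀) ↔ ‖W‖ = 1 ∧ σ ^ 2 = 1 := by
  have h1 : ((torusPiece s₀ ⟨(σ, W), h⟩).2 : ℂ) = Complex.I * s₀ ↔ σ ^ 2 = 1 := by
    rw [← coe_circleI, ← Circle.coe_mul, Circle.coe_inj]
    simp only [torusPiece]
    exact mul_eq_left
  rw [h1]
  refine and_congr_left fun hσ => ?_
  have h2 : ((torusPiece s₀ ⟨(σ, W), h⟩).1 : ℂ).re = 0 ↔ (W - W⁻¹).re = 0 := by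
    simp only [torusPiece]
    rcases sq_eq_sq_iff_circle.1 (hσ.trans (one_pow 2).symm) with rfl | rfl
    · rw [inv_one, Circle.coe_one, mul_one]
    · rw [inv_neg, inv_one, Circle.coe_neg, Circle.coe_one, mul_neg, mul_one, Complex.neg_re,
        neg_eq_zero]
  rw [h2]
  refine ⟨fun h3 => ?_, sub_inv_re⟩
  have h4 := re_inv_mul h.1
  have h5 := re_pos_of_mem_torusChart h
  simp only at h4
  rw [Complex.sub_re, sub_eq_zero] at h3
  rw [← h3] at h4
  have h6 : ‖W‖ ^ 2 = 1 := by
    refine mul_left_cancel₀ h5.ne' (h4.trans (mul_one _).symm)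
  exact (pow_eq_one_iff_of_nonneg (norm_nonneg W) two_ne_zero).1 h6

end orbit

end BraidSurgery

open BraidSurgery
theorem mainTheorem10 (c : Circle → ℂ) (s₀ : Circle) (hc : IsNegativeTwoBraid c s₀)
    (r : ℝ) (hr : IsTubeRadius c r) :
    ∃ Φ : DehnSurgery thickTorus (braidTube c r) 1 ≃ₜ OrientableCircleBundle,
      ∃ x : RP2MinusTwoDiscs, Φ '' closedOrbitSegment c s₀ r = bundleProj ⁻¹' {x} := by
  have : CompactSpace (exteriorChart s₀) :=
    isCompact_iff_compactSpace.1 (isCompact_exteriorChart s₀)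
  have : CompactSpace torusChart := isCompact_iff_compactSpace.1 isCompact_torusChart
  let g : exteriorChart s₀ ⊕ torusChart → tubeExterior thickTorus (braidTube c r) ⊕ SolidTorus :=
    Sum.map (exteriorPiece hr) (torusPiece s₀)
  let f : exteriorChart s₀ ⊕ torusChart → OrientableCircleBundle :=
    Sum.elim exteriorModel torusModel
  have hg : Continuous g := (continuous_exteriorPiece hc hr).sumMap continuous_torusPiece
  have hgs : Function.Surjective g :=
    (exteriorPiece_surjective hr).sumMap torusPiece_surjective
  have hf : Continuous f := continuous_exteriorModel.sumElim continuous_torusModel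
  have hfs : Function.Surjective f := by
    intro b
    rcases exists_parameter s₀ b with ⟨k, hk⟩ | ⟨l, hl⟩
    · exact ⟨Sum.inl k, hk⟩
    · exact ⟨Sum.inr l, hl⟩
  obtain ⟨Φ, hΦ⟩ := exists_homeomorph_of_parametrisation thickTorus (braidTube c r) 1 g hg hgs f hf
    hfs
    (by
      rintro (k | k) (l | l) h
      · exact exteriorModel_eq_of_piece_eq hr (Sum.inl_injective h)
      · cases h
      · cases h
      · exact torusModel_eq_of_piece_eq (Sum.inr_injective h))
    (by
      rintro (k | k) (l | l) h
      · cases h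
      · exact model_eq_of_surgeryRel hr h
      · cases h
      · cases h)
    (by
      rintro (k | k) (l | l) h
      · exact congrArg (fun e => Quot.mk _ (Sum.inl e)) (exteriorPiece_eq_of_model_eq hr h)
      · exact Quot.sound (surgeryRel_of_model_eq hr h)
      · exact (Quot.sound (surgeryRel_of_model_eq hr (Eq.symm h))).symm
      · exact congrArg (fun y => Quot.mk _ (Sum.inr y)) (torusPiece_eq_of_model_eq h))
  have key : ∀ k, f k ∈ bundleProj ⁻¹' {(Quot.mk _ centralPoint : RP2MinusTwoDiscs)} ↔
      g k ∈ Sum.inl '' {e : tubeExterior thickTorus (braidTube c r) |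
          (e : (Circle × Circle) × ℝ) ∈ orbitSegment c s₀} ∪
        Sum.inr '' {y : SolidTorus | (y.1 : ℂ).re = 0 ∧ (y.2 : ℂ) = Complex.I * s₀} := by
    rintro (⟨⟨J, s⟩, h⟩ | ⟨⟨σ, W⟩, h⟩)
    · refine (exteriorModel_mem_fibre_iff h).trans
        ((slicePosition_mem_orbitSegment_iff hc hr h).symm.trans ⟨fun h' => ?_, ?_⟩)
      · exact Or.inl ⟨_, h', rfl⟩
      · rintro (⟨e, he, h'⟩ | ⟨y, -, h'⟩)
        · obtain rfl := Sum.inl_injective h'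
          exact he
        · cases h'
    · refine (torusModel_mem_fibre_iff h).trans
        ((torusPiece_mem_diameter_iff (s₀ := s₀) h).symm.trans ⟨fun h' => ?_, ?_⟩)
      · exact Or.inr ⟨_, h', rfl⟩
      · rintro (⟨e, -, h'⟩ | ⟨y, hy, h'⟩)
        · cases h'
        · obtain rfl := Sum.inr_injective h'
          exact hy
  refine ⟨Φ, Quot.mk _ centralPoint, Set.ext fun b => ⟨?_, ?_⟩⟩
  · rintro ⟨-, ⟨x, hx, rfl⟩, rfl⟩
    obtain ⟨k, rfl⟩ := hgs x
    rw [hΦ]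
    exact (key k).2 hx
  · intro hb
    obtain ⟨k, rfl⟩ := hfs b
    exact ⟨_, ⟨g k, (key k).1 hb, rfl⟩, hΦ k⟩
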